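/- **Theorem 1.2.** Bits are elements of $\{0,1\}$. For a predicate $P:\{0,1\}^d\to\{0,1\}$, a hypergraph $G=(S_1,\dots,S_m)$ on the vertex set $[n]$ with $m$ ordered hyperedges $S_i=(j_{i,1},\dots,j_{i,d})\in[n]^d$ (repeated vertices are allowed), and $s\in\{0,1\}^n$, let $f_{G,P}(s)\in\{0,1\}^m$ be the string whose $i$-th bit is $P(s_{j_{i,1}},\dots,s_{j_{i,d}})$. Let $G_{n,m,d}$ be the set of all such hypergraphs and $\eta=\Pr_{x}[P(x)=1]$ for uniformly random $x\in\{0,1\}^d$. An algorithm is *efficient* if it is probabilistic and, on every input $(G,y)$ with $G\in G_{n,m,d}$ and $y\in\{0,1\}^m$, it halts within a number of steps that is polynomial in $n+m$ (for fixed $d$). All probabilities below are also over the coins of the algorithms. Let $d$ be a constant and let $P$ be any $d$-ary predicate; $P$ need not be sensitive. There are constants $c,C>0$ and a function $M(n,m,\varepsilon)$ with values in the nonnegative integers, depending only on $P$, such that $$M(n,m,\varepsilon)\le C\,m\left(\frac n\varepsilon\right)^2\log^3\left(\frac n\varepsilon\right)\qquad\text{for all } n\ge 1,\ m\ge 0,\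 0<\varepsilon\le 1,$$ and the following holds. For every efficient algorithm $D$ there is an efficient algorithm $A$ such that for all $n\ge1$, $m\ge 0$ and $\varepsilon>0$: if $$\Pr_{G\gets G_{n,m,d},\ s\gets\{0,1\}^n}\big[D(G,f_{G,P}(s))=1\big]-\Pr_{G\gets G_{n,m,d},\ b\gets \mathrm{Bern}(\eta)^m}\big[D(G,b)=1\big]\ \ge\ \varepsilon,$$ then, with $M=M(n,m,\varepsilon)$, $$\Pr_{G\gets G_{n,M,d},\ s\gets\{0,1\}^n}\big[A(G,f_{G,P}(s))=s\big]\ \ge\ c\,\varepsilon .$$ -/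

import Mathlib

open scoped BigOperators

noncomputable section

namespace RandomLocal

/-! ### Random local functions -/

/-- Hypergraphs with `n` vertices and `m` ordered hyperedges, each an ordered `d`-tuple of vertices
in which repetitions are allowed. Bits are elements of `Bool`. -/
abbrev Hypergraph (n m d : ℕ) : Type := Fin m → Fin d → Fin n

/-- The local function `f_{G,P}`: its `i`-th output bit is `P` applied to the bits of `s` indexed by
the `i`-th hyperedge of `G`. -/
def localFn {n m d : ℕ} (P : (Fin d → Bool) → Bool) (G : Hypergraph n m d) (s : Fin n → Bool) :
    Fin m → Bool :=
  fun i => P (fun k => s (G i k))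

/-- `η = Pr_x[P(x) = 1]` for a uniformly random `x`. -/
def bias {d : ℕ} (P : (Fin d → Bool) → Bool) : ℝ :=
  𝔼 x : Fin d → Bool, if P x = true then (1 : ℝ) else 0

/-- The probability of the string `b` under `Bern(η)^m`. -/
def bernWeight {m : ℕ} (η : ℝ) (b : Fin m → Bool) : ℝ :=
  ∏ i, if b i = true then η else 1 - η

/-! ### Probabilistic algorithms and their running time

Algorithms are programs of the WHILE language over binary trees, with fair coin flips. Every command
that is executed costs one step. Since copying can be done by sharing, and a test only
asks whether a tree is `nil`, such programs and probabilistic Turing machines simulate each other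
with polynomial overhead. -/

/-- Data values: binary trees. -/
inductive Data : Type
  | nil : Data
  | cons : Data → Data → Data

/-- A list of data values. -/
def Data.ofList : List Data → Data
  | [] => Data.nil
  | a :: l => Data.cons a (Data.ofList l)

/-- A natural number, in unary. -/
def Data.ofNat (k : ℕ) : Data := Data.ofList (List.replicate k Data.nil)

/-- A bit. -/
def Data.ofBool : Bool → Data
  | false => Data.nil
  | true => Data.cons Data.nil Data.nil

/-- A bit string. -/
def Data.ofBits {k : ℕ} (y : Fin k → Bool) : Data :=
  Data.ofList (List.ofFn fun i => Data.ofBool (y i))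

/-- Head of a pair (and `nil` for `nil`). -/
def Data.hd : Data → Data
  | Data.nil => Data.nil
  | Data.cons a _ => a

/-- Tail of a pair (and `nil` for `nil`). -/
def Data.tl : Data → Data
  | Data.nil => Data.nil
  | Data.cons _ b => b

/-- The truth value of a tree: `nil` is false, everything else is true. -/
def Data.test : Data → Bool
  | Data.nil => false
  | Data.cons _ _ => true

/-- The contents of the program variables, which are numbered. -/
abbrev Store : Type := ℕ → Data

/-- Expressions. -/
inductive Expr : Type
  | var : ℕ → Expr
  | nil : Expr
  | cons : Expr → Expr → Expr
  | hd : Expr → Expr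
  | tl : Expr → Expr

/-- The value of an expression. -/
def Expr.eval (σ : Store) : Expr → Data
  | Expr.var x => σ x
  | Expr.nil => Data.nil
  | Expr.cons e f => Data.cons (e.eval σ) (f.eval σ)
  | Expr.hd e => (e.eval σ).hd
  | Expr.tl e => (e.eval σ).tl

/-- Programs: assignment, coin flip into a variable, sequence, conditional, while loop. -/
inductive Cmd : Type
  | assign : ℕ → Expr → Cmd
  | flip : ℕ → Cmd
  | seq : Cmd → Cmd → Cmd
  | ite : Expr → Cmd → Cmd → Cmd
  | loop : Expr → Cmd → Cmd

/-- A configuration: the commands that remain to be executed, and the store. -/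
structure Config : Type where
  todo : List Cmd
  store : Store

/-- One step of the computation. A configuration with nothing left to execute has halted. -/
def step : Config → PMF Config
  | ⟨[], σ⟩ => PMF.pure ⟨[], σ⟩
  | ⟨Cmd.assign x e :: k, σ⟩ => PMF.pure ⟨k, Function.update σ x (e.eval σ)⟩
  | ⟨Cmd.flip x :: k, σ⟩ =>
      (PMF.uniformOfFintype Bool).map fun b => ⟨k, Function.update σ x (Data.ofBool b)⟩
  | ⟨Cmd.seq p q :: k, σ⟩ => PMF.pure ⟨p :: q :: k, σ⟩
  | ⟨Cmd.ite e p q :: k, σ⟩ =>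
      PMF.pure (if (e.eval σ).test = true then ⟨p :: k, σ⟩ else ⟨q :: k, σ⟩)
  | ⟨Cmd.loop e p :: k, σ⟩ =>
      PMF.pure (if (e.eval σ).test = true then ⟨p :: Cmd.loop e p :: k, σ⟩ else ⟨k, σ⟩)

/-- The distribution of the configuration after `T` steps. -/
def runFor : ℕ → Config → PMF Config
  | 0, c => PMF.pure c
  | T + 1, c => (step c).bind (runFor T)

/-- Start of the program `p`: variable `0` holds the input, all other variables hold `nil`. -/
def start (p : Cmd) (input : Data) : Config :=
  ⟨[p], fun x => if x = 0 then input else Data.nil⟩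

/-- Whatever the coins show, `p` halts on the input after at most `T` steps. -/
def HaltsWithin (p : Cmd) (input : Data) (T : ℕ) : Prop :=
  ∀ c ∈ (runFor T (start p input)).support, c.todo = []

/-- The probability that `p` halts on the input with the value `v` in variable `0`. (The
probability of having done so within `T` steps is nondecreasing in `T`.) -/
def outputProb (p : Cmd) (input v : Data) : ℝ :=
  (⨆ T : ℕ,
    (runFor T (start p input)).toOuterMeasure {c | c.todo = [] ∧ c.store 0 = v}).toReal

/-! ### The decision problem and the search problem -/

/-- An instance `(G, y)` as the input of a program: the number of vertices, the list of hyperedges,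
and the list of output bits. -/
def encodeInstance {n m d : ℕ} (G : Hypergraph n m d) (y : Fin m → Bool) : Data :=
  Data.cons (Data.ofNat n)
    (Data.cons
      (Data.ofList (List.ofFn fun i =>
        Data.ofList (List.ofFn fun k => Data.ofNat (G i k : ℕ))))
      (Data.ofBits y))

/-- Probabilistic polynomial time on instances of locality `d`: on all inputs `(G, y)` with `n`
vertices and `m` hyperedges, the number of steps is at most a polynomial in `n + m`. -/
def Efficient (d : ℕ) (p : Cmd) : Prop :=
  ∃ q : Polynomial ℕ, ∀ (n m : ℕ) (G : Hypergraph n m d) (y : Fin m → Bool),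
    HaltsWithin p (encodeInstance G y) (q.eval (n + m))

/-- `Pr[D(G, y) = 1]`, over the coins of `D`. -/
def acceptProb {n m d : ℕ} (D : Cmd) (G : Hypergraph n m d) (y : Fin m → Bool) : ℝ :=
  outputProb D (encodeInstance G y) (Data.ofBool true)

/-- The advantage `Pr[D(G, f_{G,P}(s)) = 1] - Pr[D(G, b) = 1]` of `D` in the decision problem with
`n` inputs and `m` outputs, where `G` and `s` are uniformly random and `b` is drawn from
`Bern(η)^m`, independently of `G`. -/
def advantage {d : ℕ} (P : (Fin d → Bool) → Bool) (D : Cmd) (n m : ℕ) : ℝ :=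
  (𝔼 G : Hypergraph n m d, 𝔼 s : Fin n → Bool, acceptProb D G (localFn P G s)) -
    𝔼 G : Hypergraph n m d, ∑ b : Fin m → Bool, bernWeight (bias P) b * acceptProb D G b

/-- The success probability `Pr[A(G, f_{G,P}(s)) = s]` of `A` in the search problem with `n` inputs
and `m` outputs, where `G` and `s` are uniformly random. -/
def successProb {d : ℕ} (P : (Fin d → Bool) → Bool) (A : Cmd) (n m : ℕ) : ℝ :=
  𝔼 G : Hypergraph n m d, 𝔼 s : Fin n → Bool,
    outputProb A (encodeInstance G (localFn P G s)) (Data.ofBits s)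

end RandomLocal

end

/-!
The proof fixes the secret `s` and compares the two kinds of input of the distinguisher `D` by a hybrid
argument over the vertices. `hybrid P D m φ` is the acceptance probability of `D` on a random
hypergraph when each hyperedge draws the bits of its vertices afresh from the laws `φ`. When the bits of
the vertices below `k` are fair coins and the others are those of `s` (`stepLaw s k`), this interpolates
between `D` on `f_{G,P}(s)` for `k = 0` and `D` on `Bern(η)^m` for `k = n`. For a fraction of at least
`ε / 2` of the secrets, `D` has advantage `ε / 2`, and then some vertex `k` contributes `ε / (2 * n)`
(`exists_step`).

The inverter does not know `s`, but it can simulate such hybrids from the given hyperedges and output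
bits. It chooses a random set `T` of vertices and relabels: an occurrence of an element of `T` may stand
for a vertex below `k`, chosen at random by means of a second hyperedge, whereas the vertices above `k`
stand for themselves. The vertex `k` stands for itself, or, in the mixed version, occurrences of `k` and
of another vertex `j` stand for `k` with equal probability. Rejection makes all labels equally likely, so
that a batch of such hyperedges is an instance of the kind that `hybrid` describes (`expect_batch`).
If `T` is balanced, that is, if `s` is one on exactly half of its elements, then the vertices below `k`
carry fair bits. Mixing makes the bit of `k` fair as well if `s j ≠ s k`, and it has no effect if
`s j = s k`, whatever `T` is (`vertexLaw_false`, `vertexLaw_true`, `expect_gap_of_eq`). Hence a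
comparison of the numbers of accepted batches, over about `((n / ε) * log n) ^ 2` batches, detects
exactly the vertices that differ from `k`, up to errors that the exponential moment bounds
`prob_sum_ge_le` and `prob_sum_le_le` make rarer than the number of tests requires. All detected
differences being true ones, those from `k` determine `s` up to a global flip, which is guessed
(`invert_eq_of_detected`).

A random set is balanced for `s` exactly as often as a random string has as many ones as `s`
(`prob_balanced`). There are only `n + 1` possible numbers of ones, so for all but a fraction of `ε / 8`
of the secrets this probability is at least `ε / (8 * (n + 1))` (`prob_prob_balanced_lt`), and one of the
many random sets that the inverter tries is balanced. It must also have at least `n / 4` elements, for a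
batch to be long enough. Smaller sets occur with probability at most `0.9 ^ n`, which is negligible
against `ε / n` as long as `1 / ε` is polynomially bounded in `n` (`le_prob_invert_of_few`). Otherwise
there are at least `(d + 4) * n ^ (d + 1)` hyperedges, among which all `d`-tuples of vertices
presumably occur. Two hyperedges with different output bits that become equal on identifying `k` with
`j` then prove that `s k ≠ s j`, and such pairs exist whenever `P` is not constant
(`le_prob_invert_of_many`). The inverter gets neither `m` nor `ε`; it tries all parameters for which
the required number of hyperedges is exactly the given one.

Efficiency is shown in the WHILE language itself. `RT` and `PT` express that a function is computed in
polynomial time, uniformly over a family of inputs, and they are closed under composition, case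
distinction and iteration. `D` is run on given coins (`tapeAccepts`), and the inverter flips all its
coins at the start (`exists_efficient_of_PT`, `exists_inverter`), so that its success probability is a
count over bit strings.
-/

noncomputable section

namespace RandomLocal

/-! ### Running programs -/

theorem runFor_add (a b : ℕ) (c : Config) :
    runFor (a + b) c = (runFor a c).bind (runFor b) := by
  induction a generalizing c with
  | zero => simp [runFor]
  | succ a ih =>
    rw [Nat.succ_add]
    simp only [runFor, PMF.bind_bind]
    congr 1
    funext c'
    exact ih c'

theorem runFor_halted (t : ℕ) (σ : Store) : runFor t ⟨[], σ⟩ = PMF.pure ⟨[], σ⟩ := by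
  induction t with
  | zero => rfl
  | succ t ih => simp [runFor, step, ih]

/-- The program `p` deterministically turns the store `σ` into the store `τ`, in at most `t`
steps. -/
def Exec (p : Cmd) (σ τ : Store) (t : ℕ) : Prop :=
  ∃ t' ≤ t, ∀ k, runFor t' ⟨p :: k, σ⟩ = PMF.pure ⟨k, τ⟩

theorem Exec.mono {p : Cmd} {σ τ : Store} {t u : ℕ} (h : Exec p σ τ t) (htu : t ≤ u) :
    Exec p σ τ u := by
  obtain ⟨t', h1, h2⟩ := h
  exact ⟨t', h1.trans htu, h2⟩

theorem exec_assign (x : ℕ) (e : Expr) (σ : Store) :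
    Exec (Cmd.assign x e) σ (Function.update σ x (e.eval σ)) 1 :=
  ⟨1, le_rfl, fun k => by simp [runFor, step]⟩

theorem Exec.seq {p q : Cmd} {σ τ υ : Store} {t u : ℕ} (hp : Exec p σ τ t) (hq : Exec q τ υ u) :
    Exec (Cmd.seq p q) σ υ (t + u + 1) := by
  obtain ⟨t', h1, h2⟩ := hp
  obtain ⟨u', h3, h4⟩ := hq
  refine ⟨1 + t' + u', by omega, fun k => ?_⟩
  rw [runFor_add, runFor_add]
  simp [runFor, step, h2, h4]

theorem exec_ite {e : Expr} {p q : Cmd} {σ τ : Store} {t : ℕ}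
    (h1 : (e.eval σ).test = true → Exec p σ τ t) (h2 : (e.eval σ).test = false → Exec q σ τ t) :
    Exec (Cmd.ite e p q) σ τ (t + 1) := by
  rcases h : (e.eval σ).test with _ | _
  · obtain ⟨t', h3, h4⟩ := h2 h
    refine ⟨1 + t', by omega, fun k => ?_⟩
    rw [runFor_add]
    simp [runFor, step, h4, h]
  · obtain ⟨t', h3, h4⟩ := h1 h
    refine ⟨1 + t', by omega, fun k => ?_⟩
    rw [runFor_add]
    simp [runFor, step, h4, h]

theorem exec_loop_done {e : Expr} (p : Cmd) {σ : Store} (h : (e.eval σ).test = false) :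
    Exec (Cmd.loop e p) σ σ 1 :=
  ⟨1, le_rfl, fun k => by simp [runFor, step, h]⟩

theorem exec_loop_step {e : Expr} {p : Cmd} {σ τ υ : Store} {t u : ℕ}
    (h : (e.eval σ).test = true) (hp : Exec p σ τ t) (hl : Exec (Cmd.loop e p) τ υ u) :
    Exec (Cmd.loop e p) σ υ (t + u + 1) := by
  obtain ⟨t', h1, h2⟩ := hp
  obtain ⟨u', h3, h4⟩ := hl
  refine ⟨1 + t' + u', by omega, fun k => ?_⟩
  rw [runFor_add, runFor_add]
  simp [runFor, step, h, h2, h4]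

/-! ### Output probabilities of programs that always halt -/

theorem toOuterMeasure_bind_mono {α : Type*} (μ : PMF α) (f : α → PMF α) (S : Set α)
    (hS : ∀ a ∈ S, f a = PMF.pure a) :
    μ.toOuterMeasure S ≤ (μ.bind f).toOuterMeasure S := by
  rw [PMF.toOuterMeasure_bind_apply, PMF.toOuterMeasure_apply]
  refine ENNReal.tsum_le_tsum fun a => ?_
  by_cases ha : a ∈ S
  · simp [hS a ha, ha]
  · simp [ha]

/-- If the computation has halted everywhere at time `T`, then the output probability can be read
off at time `T`. -/
theorem outputProb_eq_of_halts {p : Cmd} {x v : Data} {T : ℕ} (μ : PMF Store)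
    (h : runFor T (start p x) = μ.map fun τ => (⟨[], τ⟩ : Config)) :
    outputProb p x v = (μ.toOuterMeasure {τ | τ 0 = v}).toReal := by
  have hT : (runFor T (start p x)).toOuterMeasure {c | c.todo = [] ∧ c.store 0 = v}
      = μ.toOuterMeasure {τ | τ 0 = v} := by
    rw [h, PMF.toOuterMeasure_map_apply]
    congr 1
    ext τ
    simp
  unfold outputProb
  congr 1
  rw [← hT]
  refine le_antisymm (iSup_le fun S => ?_)
    (le_iSup (fun T => (runFor T (start p x)).toOuterMeasure
      {c | c.todo = [] ∧ c.store 0 = v}) T)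
  have hstay : ∀ (R : ℕ), ∀ c ∈ {c : Config | c.todo = [] ∧ c.store 0 = v},
      runFor R c = PMF.pure c := by
    rintro R ⟨k, σ⟩ ⟨hk, -⟩
    simp only at hk
    subst hk
    exact runFor_halted R σ
  rcases le_total S T with hST | hTS
  · obtain ⟨R, rfl⟩ := Nat.exists_eq_add_of_le hST
    rw [runFor_add]
    exact toOuterMeasure_bind_mono _ _ _ (hstay R)
  · obtain ⟨R, rfl⟩ := Nat.exists_eq_add_of_le hTS
    have : runFor (T + R) (start p x) = runFor T (start p x) := by
      rw [runFor_add, h, PMF.bind_map, PMF.map]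
      congr 1
      funext τ
      exact runFor_halted R τ
    rw [this]

theorem haltsWithin_of_runFor {p : Cmd} {x : Data} {T : ℕ} (μ : PMF Store)
    (h : runFor T (start p x) = μ.map fun τ => (⟨[], τ⟩ : Config)) : HaltsWithin p x T := by
  intro c hc
  rw [h, PMF.mem_support_map_iff] at hc
  obtain ⟨τ, -, rfl⟩ := hc
  rfl

/-! ### Functions computed in polynomial time, uniformly over a family of inputs -/

/-- A type whose elements are presented to programs as data values. -/
class Enc (α : Type) where
  /-- The data value that represents an element. -/
  enc : α → Data

open Enc (enc)

instance : Enc Data := ⟨id⟩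
instance : Enc Unit := ⟨fun _ => Data.nil⟩
instance : Enc Bool := ⟨Data.ofBool⟩
instance : Enc ℕ := ⟨Data.ofNat⟩
instance {α : Type} [Enc α] : Enc (List α) := ⟨fun l => Data.ofList (l.map enc)⟩
instance {α β : Type} [Enc α] [Enc β] : Enc (α × β) := ⟨fun z => Data.cons (enc z.1) (enc z.2)⟩

@[simp] theorem enc_true : enc true = Data.cons Data.nil Data.nil := rfl

@[simp] theorem enc_false : enc false = Data.nil := rfl

@[simp] theorem enc_list_nil {α : Type} [Enc α] : enc ([] : List α) = Data.nil := rfl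

@[simp] theorem enc_list_cons {α : Type} [Enc α] (x : α) (l : List α) :
    enc (x :: l) = Data.cons (enc x) (enc l) := rfl

@[simp] theorem enc_prod {α β : Type} [Enc α] [Enc β] (z : α × β) :
    enc z = Data.cons (enc z.1) (enc z.2) := rfl

@[simp] theorem enc_zero : enc (0 : ℕ) = Data.nil := rfl

@[simp] theorem enc_succ (n : ℕ) : enc (n + 1) = Data.cons Data.nil (enc n) := rfl

theorem enc_nat_eq_replicate (n : ℕ) : enc n = enc (List.replicate n ()) := by
  induction n with
  | zero => rfl
  | succ n ih => rw [List.replicate_succ, enc_succ, enc_list_cons, ih]; rfl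

/-- Boundedness by a polynomial in the size parameter. -/
def Bdd {ι : Type} (sz f : ι → ℕ) : Prop := ∃ q : Polynomial ℕ, ∀ i, f i ≤ q.eval (sz i)

section Bdd
variable {ι κ : Type} {sz f g : ι → ℕ}

theorem Bdd.const (c : ℕ) : Bdd sz fun _ => c := ⟨Polynomial.C c, fun i => by simp⟩

theorem Bdd.self : Bdd sz sz := ⟨Polynomial.X, fun i => by simp⟩

theorem Bdd.mono (hf : Bdd sz f) (h : ∀ i, g i ≤ f i) : Bdd sz g :=
  ⟨hf.choose, fun i => (h i).trans (hf.choose_spec i)⟩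

theorem Bdd.add (hf : Bdd sz f) (hg : Bdd sz g) : Bdd sz fun i => f i + g i := by
  obtain ⟨p, hp⟩ := hf
  obtain ⟨q, hq⟩ := hg
  exact ⟨p + q, fun i => by simpa using add_le_add (hp i) (hq i)⟩

theorem Bdd.mul (hf : Bdd sz f) (hg : Bdd sz g) : Bdd sz fun i => f i * g i := by
  obtain ⟨p, hp⟩ := hf
  obtain ⟨q, hq⟩ := hg
  exact ⟨p * q, fun i => by simpa using Nat.mul_le_mul (hp i) (hq i)⟩

theorem Bdd.reindex (hf : Bdd sz f) (g : κ → ι) : Bdd (fun z => sz (g z)) fun z => f (g z) :=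
  ⟨hf.choose, fun z => hf.choose_spec (g z)⟩

theorem eval_mono (q : Polynomial ℕ) {a b : ℕ} (h : a ≤ b) : q.eval a ≤ q.eval b := by
  rw [Polynomial.eval_eq_sum_range, Polynomial.eval_eq_sum_range]
  exact Finset.sum_le_sum fun i _ => Nat.mul_le_mul_left _ (Nat.pow_le_pow_left h i)

end Bdd

/-- The program `p` turns the value `a` of variable `0` into `b` in at most `t` steps. It uses only
the variables below `K`; it expects them, except variable `0`, to hold `nil`, and it leaves them in
that state, so that the variables from `K` on can serve its callers. -/
def Computes (p : Cmd) (K : ℕ) (a b : Data) (t : ℕ) : Prop :=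
  ∀ σ : Store, σ 0 = a → (∀ x, 0 < x → x < K → σ x = Data.nil) →
    Exec p σ (Function.update σ 0 b) t

/-- A single program computes `b i` from `a i` for all `i`, in time polynomial in `sz i`. -/
def RT {ι : Type} (sz : ι → ℕ) (a b : ι → Data) : Prop :=
  ∃ (p : Cmd) (K : ℕ) (q : Polynomial ℕ), ∀ i, Computes p K (a i) (b i) (q.eval (sz i))

section RT
variable {ι κ : Type} {sz : ι → ℕ} {a b c : ι → Data}

theorem RT.reindex (h : RT sz a b) (g : κ → ι) :
    RT (fun z => sz (g z)) (fun z => a (g z)) fun z => b (g z) := by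
  obtain ⟨p, K, q, h⟩ := h
  exact ⟨p, K, q, fun z => h (g z)⟩

theorem RT.congr {b' : ι → Data} (h : RT sz a b) (hb : ∀ i, b i = b' i) : RT sz a b' := by
  rwa [← funext hb]

theorem RT.comp (hab : RT sz a b) (hbc : RT sz b c) : RT sz a c := by
  obtain ⟨p, K, q, h⟩ := hab
  obtain ⟨p', K', q', h'⟩ := hbc
  refine ⟨Cmd.seq p p', max K K', q + q' + 1, fun i σ h0 hx => ?_⟩
  have h1 := h i σ h0 fun x hx0 hxK => hx x hx0 (lt_max_of_lt_left hxK)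
  have h2 := h' i (Function.update σ 0 (b i)) (by simp) fun x hx0 hxK => by
    rw [Function.update_of_ne hx0.ne']
    exact hx x hx0 (lt_max_of_lt_right hxK)
  simpa using h1.seq h2

theorem RT.assign (e : Expr) (he : ∀ i (σ : Store), σ 0 = a i → e.eval σ = b i) : RT sz a b := by
  refine ⟨Cmd.assign 0 e, 0, 1, fun i σ h0 _ => ?_⟩
  simpa [he i σ h0] using exec_assign 0 e σ

theorem RT.id : RT sz a a := RT.assign (Expr.var 0) fun _ _ h => h

theorem RT.nil : RT sz a fun _ => Data.nil := RT.assign Expr.nil fun _ _ _ => rfl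

theorem RT.hd (h : RT sz a b) : RT sz a fun i => (b i).hd :=
  h.comp (RT.assign (Expr.hd (Expr.var 0)) fun i σ h => by simp [Expr.eval, h])

theorem RT.tl (h : RT sz a b) : RT sz a fun i => (b i).tl :=
  h.comp (RT.assign (Expr.tl (Expr.var 0)) fun i σ h => by simp [Expr.eval, h])

theorem RT.cons (hb : RT sz a b) (hc : RT sz a c) : RT sz a fun i => Data.cons (b i) (c i) := by
  obtain ⟨p, K₁, q, h⟩ := hb
  obtain ⟨p', K₂, q', h'⟩ := hc
  obtain ⟨K, hK₁, hK₂, hK⟩ : ∃ K, K₁ ≤ K ∧ K₂ ≤ K ∧ 0 < K :=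
    ⟨K₁ + K₂ + 1, by omega, by omega, by omega⟩
  refine ⟨Cmd.seq (Cmd.assign K (Expr.var 0)) (Cmd.seq p (Cmd.seq (Cmd.assign (K + 1) (Expr.var 0))
    (Cmd.seq (Cmd.assign 0 (Expr.var K)) (Cmd.seq p' (Cmd.seq
      (Cmd.assign 0 (Expr.cons (Expr.var (K + 1)) (Expr.var 0)))
      (Cmd.seq (Cmd.assign K Expr.nil) (Cmd.assign (K + 1) Expr.nil))))))), K + 2,
      q + q' + 13, fun i σ h0 hx => ?_⟩
  have e1 := h i (Function.update σ K (σ 0)) (by simp [hK.ne, h0]) fun x hx0 hxK => by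
    rw [Function.update_of_ne (by omega)]
    exact hx x hx0 (by omega)
  have e2 := h' i (Function.update (Function.update (Function.update (Function.update σ K (σ 0)) 0
      (b i)) (K + 1) (b i)) 0 (a i)) (by simp) fun x hx0 hxK => by
    rw [Function.update_of_ne (by omega), Function.update_of_ne (by omega),
      Function.update_of_ne (by omega), Function.update_of_ne (by omega)]
    exact hx x hx0 (by omega)
  have E := (exec_assign K (Expr.var 0) σ).seq (e1.seq
    ((exec_assign (K + 1) (Expr.var 0) _).seq ((exec_assign 0 (Expr.var K) _).seq
    (Exec.seq (p := p') (by simpa [Expr.eval, hK.ne, hK.ne', h0] using e2)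
    ((exec_assign 0 (Expr.cons (Expr.var (K + 1)) (Expr.var 0)) _).seq
      ((exec_assign K Expr.nil _).seq (exec_assign (K + 1) Expr.nil _)))))))
  convert E.mono (u := (q + q' + 13).eval (sz i)) (by simp; omega) using 1
  have hK1 := hx K hK (by omega)
  have hK2 := hx (K + 1) (by omega) (by omega)
  funext x
  by_cases x0 : x = 0
  · subst x0
    simp [Expr.eval, hK.ne, hK.ne']
  · by_cases x1 : x = K
    · subst x1
      simp [Expr.eval, hK.ne', hK1]
    · by_cases x2 : x = K + 1
      · subst x2
        simp [Expr.eval, hK2]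
      · simp [Expr.eval, x0, x1, x2]

/-- Case distinction. Each branch needs to work only where it is taken. -/
theorem RT.ite {t : ι → Bool} (ht : RT sz a fun i => enc (t i))
    (hb : RT (fun i : {i // t i = true} => sz i) (fun i => a i) fun i => b i)
    (hc : RT (fun i : {i // t i = false} => sz i) (fun i => a i) fun i => c i) :
    RT sz a fun i => if t i = true then b i else c i := by
  obtain ⟨p₁, K₁, q₁, h₁⟩ := hb
  obtain ⟨p₂, K₂, q₂, h₂⟩ := hc
  have hpair := RT.cons ht (RT.id (sz := sz) (a := a))
  refine hpair.comp ?_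
  obtain ⟨K, hK₁, hK₂, hK⟩ : ∃ K, K₁ ≤ K ∧ K₂ ≤ K ∧ 0 < K :=
    ⟨K₁ + K₂ + 1, by omega, by omega, by omega⟩
  refine ⟨Cmd.seq (Cmd.assign K (Expr.hd (Expr.var 0))) (Cmd.seq
    (Cmd.assign 0 (Expr.tl (Expr.var 0)))
      (Cmd.seq (Cmd.ite (Expr.var K) p₁ p₂) (Cmd.assign K Expr.nil))), K + 1, q₁ + q₂ + 7,
      fun i σ h0 hx => ?_⟩
  have hK1 := hx K hK (by omega)
  have e : Exec (Cmd.ite (Expr.var K) p₁ p₂)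
      (Function.update (Function.update σ K (enc (t i))) 0 (a i))
      (Function.update (Function.update σ K (enc (t i))) 0 (if t i = true then b i else c i))
      (q₁.eval (sz i) + q₂.eval (sz i) + 1) := by
    rcases hti : t i with _ | _
    · refine exec_ite (fun h => ?_) fun h => ?_
      · simp [Expr.eval, hK.ne', Data.test] at h
      · have := h₂ ⟨i, hti⟩ (Function.update (Function.update σ K (enc (t i))) 0 (a i)) (by simp)
          fun x hx0 hxK => by
            rw [Function.update_of_ne (by omega), Function.update_of_ne (by omega)]
            exact hx x hx0 (by omega)
        simpa [hti] using this.mono (Nat.le_add_left _ _)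
    · refine exec_ite (fun h => ?_) fun h => ?_
      · have := h₁ ⟨i, hti⟩ (Function.update (Function.update σ K (enc (t i))) 0 (a i)) (by simp)
          fun x hx0 hxK => by
            rw [Function.update_of_ne (by omega), Function.update_of_ne (by omega)]
            exact hx x hx0 (by omega)
        simpa [hti] using this.mono (Nat.le_add_right _ _)
      · simp [Expr.eval, hK.ne', Data.test] at h
  have E := (exec_assign K (Expr.hd (Expr.var 0)) σ).seq ((exec_assign 0 (Expr.tl (Expr.var 0)) _).seq
    (Exec.seq (by simpa [Expr.eval, h0, Data.hd, Data.tl, hK.ne, hK.ne'] using e) (exec_assign K Expr.nil _)))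
  convert E.mono (u := (q₁ + q₂ + 7).eval (sz i)) (by simp; omega) using 1
  funext x
  by_cases x0 : x = 0
  · subst x0
    simp [hK.ne]
  · by_cases x1 : x = K
    · subst x1
      simp [Expr.eval, hK.ne', hK1]
    · simp [x0, x1]

/-- Iteration over a list. The loop body needs to work only for the states that satisfy the
invariant and the members of the list. -/
theorem RT.foldl {α β : Type} [Enc α] [Enc β] {l : ι → List α} {s₀ : ι → β}
    {f : ι → β → α → β} (Inv : ι → β → Prop) (hl : RT sz a fun i => enc (l i))
    (hlen : Bdd sz fun i => (l i).length) (hs : RT sz a fun i => enc (s₀ i))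
    (hinv₀ : ∀ i, Inv i (s₀ i)) (hinv : ∀ i s, Inv i s → ∀ x ∈ l i, Inv i (f i s x))
    (hf : RT (fun z : {z : ι × β × α // Inv z.1 z.2.1 ∧ z.2.2 ∈ l z.1} => sz z.1.1)
      (fun z => Data.cons (a z.1.1) (Data.cons (enc z.1.2.1) (enc z.1.2.2)))
      fun z => enc (f z.1.1 z.1.2.1 z.1.2.2)) :
    RT sz a fun i => enc ((l i).foldl (f i) (s₀ i)) := by
  have hstart := RT.cons (RT.id (sz := sz) (a := a)) (RT.cons hl hs)
  refine hstart.comp ?_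
  obtain ⟨p, K₁, q, hp⟩ := hf
  obtain ⟨r, hr⟩ := hlen
  obtain ⟨K, hK₁, hK⟩ : ∃ K, K₁ ≤ K ∧ 0 < K := ⟨K₁ + 1, by omega, by omega⟩
  set body : Cmd := Cmd.seq (Cmd.assign 0 (Expr.cons (Expr.var K) (Expr.cons (Expr.var (K + 2))
    (Expr.hd (Expr.var (K + 1)))))) (Cmd.seq p (Cmd.seq (Cmd.assign (K + 2) (Expr.var 0))
      (Cmd.seq (Cmd.assign 0 Expr.nil) (Cmd.assign (K + 1) (Expr.tl (Expr.var (K + 1)))))))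
    with hbody
  have loop : ∀ (i : ι) (m : List α) (s : β) (σ : Store), (∀ x ∈ m, x ∈ l i) → Inv i s →
      σ K = a i → σ (K + 1) = enc m → σ (K + 2) = enc s → (∀ x, x < K → σ x = Data.nil) →
      Exec (Cmd.loop (Expr.var (K + 1)) body) σ
        (Function.update (Function.update σ (K + 1) Data.nil) (K + 2) (enc (m.foldl (f i) s)))
        (m.length * (q.eval (sz i) + 9) + 1) := by
    intro i m
    induction m with
    | nil =>
      intro s σ _ _ h1 h2 h3 h4
      convert (exec_loop_done body (e := Expr.var (K + 1)) (σ := σ)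
        (by simp [Expr.eval, h2, Data.test])).mono (Nat.le_add_left 1 _) using 1
      funext x
      by_cases x1 : x = K + 2
      · subst x1; simp [h3]
      · by_cases x2 : x = K + 1
        · subst x2; simp [h2]
        · simp [x1, x2]
    | cons y m ih =>
      intro s σ hm hI h1 h2 h3 h4
      have e1 := hp ⟨(i, s, y), hI, hm y (by simp)⟩
        (Function.update σ 0 (Data.cons (a i) (Data.cons (enc s) (enc y)))) (by simp)
        fun x hx0 hxK => by
          rw [Function.update_of_ne hx0.ne']
          exact h4 x (by omega)
      have E := (exec_assign 0 (Expr.cons (Expr.var K) (Expr.cons (Expr.var (K + 2))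
        (Expr.hd (Expr.var (K + 1))))) σ).seq (Exec.seq (p := p)
          (by simpa [Expr.eval, h1, h2, h3, Data.hd] using e1)
          ((exec_assign (K + 2) (Expr.var 0) _).seq ((exec_assign 0 Expr.nil _).seq
            (exec_assign (K + 1) (Expr.tl (Expr.var (K + 1))) _))))
      have hstore : ∀ υ : Store, υ = Function.update (Function.update (Function.update σ 0 Data.nil)
          (K + 2) (enc (f i s y))) (K + 1) (enc m) →
          Exec (Cmd.loop (Expr.var (K + 1)) body) υ
            (Function.update (Function.update σ (K + 1) Data.nil) (K + 2)
              (enc (m.foldl (f i) (f i s y)))) (m.length * (q.eval (sz i) + 9) + 1) := by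
        intro υ hυ
        convert ih (f i s y) υ (fun x hx => hm x (by simp [hx])) (hinv i s hI y (hm y (by simp)))
          (by simp [hυ, hK.ne', h1]) (by simp [hυ]) (by simp [hυ]) ?_ using 1
        · funext x
          by_cases x0 : x = 0
          · subst x0
            simp [hυ, h4 0 hK]
          · by_cases x1 : x = K + 2
            · subst x1; simp
            · by_cases x2 : x = K + 1
              · subst x2; simp
              · simp [hυ, x0, x1, x2]
        · intro x hx
          by_cases x0 : x = 0
          · subst x0; simp [hυ]
          · rw [hυ, Function.update_of_ne (by omega), Function.update_of_ne (by omega),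
              Function.update_of_ne x0]
            exact h4 x hx
      refine (exec_loop_step (by simp [Expr.eval, h2, Data.test]) E (hstore _ ?_)).mono ?_
      · funext x
        by_cases x0 : x = 0
        · subst x0; simp [Expr.eval]
        · by_cases x1 : x = K + 2
          · subst x1; simp [Expr.eval]
          · by_cases x2 : x = K + 1
            · subst x2; simp [Expr.eval, h2, Data.tl]
            · simp [x0, x1, x2]
      · simp only [List.length_cons]
        ring_nf
        omega
  refine ⟨Cmd.seq (Cmd.assign K (Expr.hd (Expr.var 0))) (Cmd.seq
    (Cmd.assign (K + 1) (Expr.hd (Expr.tl (Expr.var 0)))) (Cmd.seq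
    (Cmd.assign (K + 2) (Expr.tl (Expr.tl (Expr.var 0)))) (Cmd.seq (Cmd.assign 0 Expr.nil)
    (Cmd.seq (Cmd.loop (Expr.var (K + 1)) body) (Cmd.seq (Cmd.assign 0 (Expr.var (K + 2)))
    (Cmd.seq (Cmd.assign K Expr.nil) (Cmd.assign (K + 2) Expr.nil))))))), K + 3,
    r * (q + 9) + 15, fun i σ h0 hx => ?_⟩
  have hK0 := hx K hK (by omega)
  have hK1 := hx (K + 1) (by omega) (by omega)
  have hK2 := hx (K + 2) (by omega) (by omega)
  have e := loop i (l i) (s₀ i) (Function.update (Function.update (Function.update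
    (Function.update σ K (a i)) (K + 1) (enc (l i))) (K + 2) (enc (s₀ i))) 0 Data.nil)
    (fun x hx => hx) (hinv₀ i) (by simp [hK.ne']) (by simp) (by simp) fun x hxK => by
      by_cases x0 : x = 0
      · subst x0; simp
      · rw [Function.update_of_ne x0, Function.update_of_ne (by omega),
          Function.update_of_ne (by omega), Function.update_of_ne (by omega)]
        exact hx x (by omega) (by omega)
  have E := (exec_assign K (Expr.hd (Expr.var 0)) σ).seq
    ((exec_assign (K + 1) (Expr.hd (Expr.tl (Expr.var 0))) _).seq
    ((exec_assign (K + 2) (Expr.tl (Expr.tl (Expr.var 0))) _).seq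
    ((exec_assign 0 Expr.nil _).seq (Exec.seq
      (by simpa [Expr.eval, h0, hK.ne, hK.ne', Data.hd, Data.tl] using e)
      ((exec_assign 0 (Expr.var (K + 2)) _).seq ((exec_assign K Expr.nil _).seq
        (exec_assign (K + 2) Expr.nil _)))))))
  convert E.mono (u := (r * (q + 9) + 15).eval (sz i)) ?_ using 1
  · funext x
    by_cases x0 : x = 0
    · subst x0; simp [Expr.eval, hK.ne]
    · by_cases x1 : x = K + 2
      · subst x1; simp [Expr.eval, hK2]
      · by_cases x2 : x = K
        · subst x2; simp [Expr.eval, hK0, x0]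
        · by_cases x3 : x = K + 1
          · subst x3; simp [hK1]
          · simp [x0, x1, x2, x3]
  · have : (l i).length * (q.eval (sz i) + 9) ≤ r.eval (sz i) * (q.eval (sz i) + 9) :=
      Nat.mul_le_mul_right _ (hr i)
    simp
    omega

end RT

/-! ### A library of polynomial-time functions -/

/-- The number of nodes of a tree. -/
def Data.size : Data → ℕ
  | Data.nil => 1
  | Data.cons a b => a.size + b.size + 1

@[simp] theorem Data.size_nil : Data.nil.size = 1 := rfl
@[simp] theorem Data.size_cons (a b : Data) : (Data.cons a b).size = a.size + b.size + 1 := rfl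

theorem Data.size_hd (a : Data) : a.hd.size ≤ a.size := by
  cases a <;> simp [Data.hd]; omega

theorem Data.size_tl (a : Data) : a.tl.size ≤ a.size := by
  cases a <;> simp [Data.tl]; omega

@[simp] theorem size_enc_nat (n : ℕ) : (enc n).size = 2 * n + 1 := by
  induction n with
  | zero => rfl
  | succ n ih => simp [ih]; omega

theorem size_enc_bool (b : Bool) : (enc b).size ≤ 3 := by cases b <;> simp

theorem size_enc_list_le {α : Type} [Enc α] {B : ℕ} (l : List α)
    (h : ∀ x ∈ l, (enc x).size ≤ B) : (enc l).size ≤ l.length * (B + 1) + 1 := by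
  induction l with
  | nil => simp
  | cons x l ih =>
    have h1 := ih fun y hy => h y (by simp [hy])
    have h2 := h x (by simp)
    simp only [enc_list_cons, Data.size_cons, List.length_cons]
    ring_nf at h1 ⊢
    omega

theorem length_le_size {α : Type} [Enc α] (l : List α) : l.length ≤ (enc l).size := by
  induction l with
  | nil => simp
  | cons x l ih => simp; omega

theorem size_le_of_mem {α : Type} [Enc α] {l : List α} {x : α} (hx : x ∈ l) :
    (enc x).size ≤ (enc l).size := by
  induction l with
  | nil => simp at hx
  | cons y l ih =>
    rcases List.mem_cons.1 hx with rfl | hx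
    · simp; omega
    · have := ih hx
      simp; omega

theorem size_enc_sublist {α : Type} [Enc α] {l m : List α} (h : l.Sublist m) :
    (enc l).size ≤ (enc m).size := by
  induction h with
  | slnil => simp
  | cons x _ ih => simp; omega
  | cons_cons x _ ih => simp; omega

/-- The element `f i` is computed from the data `a i` in polynomial time, and its size is polynomially
bounded. The second requirement does not follow from the first one: assignments share subtrees, so
that polynomial time suffices to build trees of exponential size. -/
def PT {ι α : Type} [Enc α] (sz : ι → ℕ) (a : ι → Data) (f : ι → α) : Prop :=
  RT sz a (fun i => enc (f i)) ∧ Bdd sz fun i => (enc (f i)).size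

section PT
variable {ι κ α β γ : Type} [Enc α] [Enc β] [Enc γ] {sz : ι → ℕ} {a : ι → Data}

theorem PT.congr {f g : ι → α} (h : PT sz a f) (hfg : ∀ i, f i = g i) : PT sz a g := by
  rwa [← funext hfg]

/-- Passage to another family of inputs, from which the old ones can be computed. -/
theorem PT.lift {f : ι → α} {b : κ → Data} (h : PT sz a f) (g : κ → ι)
    (hb : RT (fun z => sz (g z)) b fun z => a (g z)) :
    PT (fun z => sz (g z)) b fun z => f (g z) :=
  ⟨hb.comp (h.1.reindex g), h.2.reindex g⟩

theorem RT.const (x : Data) : RT sz a fun _ => x := by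
  induction x with
  | nil => exact RT.nil
  | cons x y hx hy => exact hx.cons hy

theorem PT.const (x : α) : PT sz a fun _ => x := ⟨RT.const _, Bdd.const _⟩

theorem PT.pair {f : ι → α} {g : ι → β} (hf : PT sz a f) (hg : PT sz a g) :
    PT sz a fun i => (f i, g i) :=
  ⟨hf.1.cons hg.1, (hf.2.add hg.2).add (Bdd.const 1)⟩

theorem PT.fst {f : ι → α × β} (hf : PT sz a f) : PT sz a fun i => (f i).1 :=
  ⟨hf.1.hd, hf.2.mono fun i => Data.size_hd (enc (f i))⟩

theorem PT.snd {f : ι → α × β} (hf : PT sz a f) : PT sz a fun i => (f i).2 :=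
  ⟨hf.1.tl, hf.2.mono fun i => Data.size_tl (enc (f i))⟩

theorem PT.data {f : ι → α} (hf : PT sz a f) : PT sz a fun i => enc (f i) := hf

theorem PT.dataCons {f g : ι → Data} (hf : PT sz a f) (hg : PT sz a g) :
    PT sz a fun i => Data.cons (f i) (g i) :=
  ⟨hf.1.cons hg.1, (hf.2.add hg.2).add (Bdd.const 1)⟩

theorem PT.bdd_length {f : ι → List α} (hf : PT sz a f) : Bdd sz fun i => (f i).length :=
  hf.2.mono fun i => length_le_size (f i)

theorem PT.bdd_nat {f : ι → ℕ} (hf : PT sz a f) : Bdd sz f :=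
  hf.2.mono fun i => by rw [size_enc_nat]; omega

theorem PT.of_bdd {f : ι → ℕ} (hf : RT sz a fun i => enc (f i)) (hb : Bdd sz f) : PT sz a f :=
  ⟨hf, (((Bdd.const 2).mul hb).add (Bdd.const 1)).mono fun i => by simp⟩

theorem PT.of_bool {f : ι → Bool} (hf : RT sz a fun i => enc (f i)) : PT sz a f :=
  ⟨hf, (Bdd.const 3).mono fun i => size_enc_bool (f i)⟩

/-- Case distinction. Each branch needs to work only where it is taken. -/
theorem PT.ite' {t : ι → Bool} {f g : ι → α} (ht : PT sz a t)
    (hf : PT (fun i : {i // t i = true} => sz i) (fun i => a i) fun i => f i)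
    (hg : PT (fun i : {i // t i = false} => sz i) (fun i => a i) fun i => g i) :
    PT sz a fun i => if t i = true then f i else g i := by
  refine ⟨(RT.ite (b := fun i => enc (f i)) (c := fun i => enc (g i)) ht.1 hf.1 hg.1).congr
    fun i => by dsimp only; split_ifs <;> rfl, ?_⟩
  obtain ⟨p, hp⟩ := hf.2
  obtain ⟨q, hq⟩ := hg.2
  refine ⟨p + q, fun i => ?_⟩
  rcases h : t i with _ | _
  · have := hq ⟨i, h⟩
    simp [h] at this ⊢
    omega
  · have := hp ⟨i, h⟩
    simp [h] at this ⊢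
    omega

theorem PT.ite {t : ι → Bool} {f g : ι → α} (ht : PT sz a t) (hf : PT sz a f) (hg : PT sz a g) :
    PT sz a fun i => if t i = true then f i else g i :=
  PT.ite' ht (hf.lift (fun i : {i // t i = true} => i.1) RT.id)
    (hg.lift (fun i : {i // t i = false} => i.1) RT.id)

theorem PT.and {f g : ι → Bool} (hf : PT sz a f) (hg : PT sz a g) : PT sz a fun i => f i && g i :=
  (PT.ite hf hg (PT.const false)).congr fun i => by cases f i <;> simp

theorem PT.not {f : ι → Bool} (hf : PT sz a f) : PT sz a fun i => !f i :=
  (PT.ite hf (PT.const false) (PT.const true)).congr fun i => by cases f i <;> simp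

theorem PT.beq_bool {f g : ι → Bool} (hf : PT sz a f) (hg : PT sz a g) :
    PT sz a fun i => f i == g i :=
  (PT.ite hf hg hg.not).congr fun i => by cases f i <;> cases g i <;> rfl

/-! ### Lists in polynomial time -/

theorem PT.reverse {f : ι → List α} (hf : PT sz a f) : PT sz a fun i => (f i).reverse := by
  refine ⟨?_, hf.2.mono fun i => le_of_eq ?_⟩
  · have := RT.foldl (f := fun _ (s : List α) x => x :: s) (s₀ := fun _ => []) (fun _ _ => True)
      hf.1 hf.bdd_length RT.nil (fun _ => trivial) (fun _ _ _ _ _ => trivial)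
      (RT.id.tl.tl.cons RT.id.tl.hd)
    refine this.congr fun i => ?_
    dsimp only
    rw [← List.foldr_reverse, List.foldr_cons_nil]
  · have key : ∀ l m : List α, (enc (l ++ m)).size + 1 = (enc l).size + (enc m).size := by
      intro l m
      induction l with
      | nil => simp; omega
      | cons x l ih => simp; omega
    dsimp only
    induction f i with
    | nil => rfl
    | cons x l ih =>
      have := key l.reverse [x]
      simp at this ⊢
      omega

/-- The inputs of the body of an iteration over the list `l i`: the data `a i`, and a member of the
list. -/
abbrev Mem (l : ι → List α) : Type := {z : ι × α // z.2 ∈ l z.1}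

/-- The size parameter inside an iteration. -/
abbrev inSz (sz : ι → ℕ) (l : ι → List α) : Mem l → ℕ := fun z => sz z.1.1

/-- The input data inside an iteration. -/
abbrev inEnv (a : ι → Data) (l : ι → List α) : Mem l → Data :=
  fun z => Data.cons (a z.1.1) (enc z.1.2)

theorem PT.inside {l : ι → List α} {f : ι → β} (hf : PT sz a f) :
    PT (inSz sz l) (inEnv a l) fun z => f z.1.1 :=
  hf.lift (fun z : Mem l => z.1.1) RT.id.hd

theorem PT.elem {l : ι → List α} (hl : PT sz a l) : PT (inSz sz l) (inEnv a l) fun z => z.1.2 :=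
  ⟨RT.id.tl, (hl.2.reindex fun z : Mem l => z.1.1).mono fun z => size_le_of_mem z.2⟩

theorem PT.map {l : ι → List α} {f : ι → α → β} (hl : PT sz a l)
    (hf : PT (inSz sz l) (inEnv a l) fun z => f z.1.1 z.1.2) :
    PT sz a fun i => (l i).map (f i) := by
  have hb : Bdd sz fun i => (enc ((l i).map (f i))).size := by
    obtain ⟨p, hp⟩ := hl.bdd_length
    obtain ⟨q, hq⟩ := hf.2
    refine ⟨p * (q + 1) + 1, fun i => ?_⟩
    refine (size_enc_list_le (B := q.eval (sz i)) _ fun y hy => ?_).trans ?_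
    · obtain ⟨x, hx, rfl⟩ := List.mem_map.1 hy
      exact hq ⟨(i, x), hx⟩
    · simpa using Nat.mul_le_mul_right (q.eval (sz i) + 1) (hp i)
  have hrev : PT sz a fun i => ((l i).map (f i)).reverse := by
    refine ⟨?_, ?_⟩
    · have := RT.foldl (f := fun i (s : List β) x => f i x :: s) (l := l) (a := a) (sz := sz)
        (s₀ := fun _ => []) (fun _ _ => True)
        hl.1 hl.bdd_length RT.nil (fun _ => trivial) (fun _ _ _ _ _ => trivial) ?_
      · refine this.congr fun i => ?_
        congr 1
        dsimp only
        simp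
      · refine RT.cons (RT.comp (RT.id.hd.cons RT.id.tl.tl)
          (hf.1.reindex fun z : {z : ι × List β × α // True ∧ z.2.2 ∈ l z.1} =>
            ⟨(z.1.1, z.1.2.2), z.2.2⟩)) RT.id.tl.hd
    · obtain ⟨p, hp⟩ := hl.bdd_length
      obtain ⟨q, hq⟩ := hf.2
      refine ⟨p * (q + 1) + 1, fun i => ?_⟩
      refine (size_enc_list_le (B := q.eval (sz i)) _ fun y hy => ?_).trans ?_
      · obtain ⟨x, hx, rfl⟩ := List.mem_map.1 (List.mem_reverse.1 hy)
        exact hq ⟨(i, x), hx⟩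
      · simpa using Nat.mul_le_mul_right (q.eval (sz i) + 1) (hp i)
  exact hrev.reverse.congr fun i => by simp

theorem PT.filter {l : ι → List α} {f : ι → α → Bool} (hl : PT sz a l)
    (hf : PT (inSz sz l) (inEnv a l) fun z => f z.1.1 z.1.2) :
    PT sz a fun i => (l i).filter (f i) := by
  have hrev : PT sz a fun i => ((l i).reverse.filter (f i)) := by
    refine ⟨?_, hl.reverse.2.mono fun i => size_enc_sublist List.filter_sublist⟩
    have := RT.foldl (f := fun i (s : List α) x => if f i x = true then x :: s else s) (l := l)
      (a := a) (sz := sz) (s₀ := fun _ => []) (fun _ _ => True)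
      hl.1 hl.bdd_length RT.nil (fun _ => trivial) (fun _ _ _ _ _ => trivial) ?_
    · refine this.congr fun i => ?_
      congr 1
      dsimp only
      generalize l i = m
      have : ∀ s : List α, m.foldl (fun s x => if f i x = true then x :: s else s) s
          = m.reverse.filter (f i) ++ s := by
        induction m with
        | nil => simp
        | cons x m ih =>
          intro s
          rcases h : f i x with _ | _ <;> simp [ih, h]
      simpa using this []
    · refine (RT.ite (b := fun z => Data.cons (enc z.1.2.2) (enc z.1.2.1))
        (c := fun z => enc z.1.2.1) (t := fun z : {z : ι × List α × α // True ∧ z.2.2 ∈ l z.1} =>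
        f z.1.1 z.1.2.2) (RT.comp (RT.id.hd.cons RT.id.tl.tl)
          (hf.1.reindex fun z : {z : ι × List α × α // True ∧ z.2.2 ∈ l z.1} =>
            ⟨(z.1.1, z.1.2.2), z.2.2⟩)) (RT.id.tl.tl.cons RT.id.tl.hd) RT.id.tl.hd).congr
        fun z => by split_ifs <;> rfl
  exact hrev.reverse.congr fun i => by simp

theorem PT.any {l : ι → List α} {f : ι → α → Bool} (hl : PT sz a l)
    (hf : PT (inSz sz l) (inEnv a l) fun z => f z.1.1 z.1.2) :
    PT sz a fun i => (l i).any (f i) := by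
  have := RT.foldl (f := fun _ (_ : Bool) (_ : α) => true) (s₀ := fun _ => false)
    (fun _ _ => True) (hl.filter hf).1 (hl.filter hf).bdd_length RT.nil (fun _ => trivial)
    (fun _ _ _ _ _ => trivial) (RT.const _)
  refine PT.of_bool (this.congr fun i => ?_)
  congr 1
  generalize l i = m
  induction m with
  | nil => rfl
  | cons x m ih =>
    rcases h : f i x with _ | _
    · simpa [h] using ih
    · simp only [h, List.filter_cons, if_true, List.any_cons, Bool.true_or, List.foldl_cons]
      generalize List.filter (f i) m = m'
      induction m' with
      | nil => rfl
      | cons y m' ih => exact ih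

theorem PT.all {l : ι → List α} {f : ι → α → Bool} (hl : PT sz a l)
    (hf : PT (inSz sz l) (inEnv a l) fun z => f z.1.1 z.1.2) :
    PT sz a fun i => (l i).all (f i) :=
  (hl.any (f := fun i x => !f i x) hf.not).not.congr fun i => by simp [List.not_any_eq_all_not]

theorem PT.length {l : ι → List α} (hl : PT sz a l) : PT sz a fun i => (l i).length := by
  refine PT.of_bdd ?_ hl.bdd_length
  have := RT.foldl (f := fun _ (s : ℕ) (_ : α) => s + 1) (s₀ := fun _ => 0)
    (fun _ _ => True) hl.1 hl.bdd_length RT.nil (fun _ => trivial)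
    (fun _ _ _ _ _ => trivial) (RT.nil.cons RT.id.tl.hd)
  refine this.congr fun i => ?_
  congr 1
  simp

/-! ### Arithmetic in polynomial time -/

theorem foldl_replicate_unit {δ : Type} (f : δ → δ) (n : ℕ) (s : δ) :
    (List.replicate n ()).foldl (fun t _ => f t) s = f^[n] s := by
  induction n generalizing s with
  | zero => rfl
  | succ n ih => simp [List.replicate_succ, ih]

/-- Iteration. The step needs to work only for the states that satisfy the invariant. -/
theorem RT.iterate {n : ι → ℕ} {s₀ : ι → β} {f : ι → β → β} (Inv : ι → β → Prop) (hn : PT sz a n)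
    (hs : RT sz a fun i => enc (s₀ i)) (hinv₀ : ∀ i, Inv i (s₀ i))
    (hinv : ∀ i s, Inv i s → Inv i (f i s))
    (hf : RT (fun z : {z : ι × β // Inv z.1 z.2} => sz z.1.1)
      (fun z => Data.cons (a z.1.1) (enc z.1.2)) fun z => enc (f z.1.1 z.1.2)) :
    RT sz a fun i => enc ((f i)^[n i] (s₀ i)) := by
  have hl : RT sz a fun i => enc (List.replicate (n i) ()) := by
    simpa only [enc_nat_eq_replicate] using hn.1
  have := RT.foldl (f := fun i s (_ : Unit) => f i s) (s₀ := s₀) Inv hl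
    (by simpa using hn.bdd_nat) hs hinv₀ (fun i s h _ _ => hinv i s h)
    (RT.comp (RT.id.hd.cons RT.id.tl.hd)
      (hf.reindex fun z : {z : ι × β × Unit // Inv z.1 z.2.1 ∧ z.2.2 ∈ List.replicate (n z.1) ()} =>
        ⟨(z.1.1, z.1.2.1), z.2.1⟩))
  exact this.congr fun i => by rw [foldl_replicate_unit]

theorem PT.succ {f : ι → ℕ} (hf : PT sz a f) : PT sz a fun i => f i + 1 :=
  PT.of_bdd (RT.nil.cons hf.1) (hf.bdd_nat.add (Bdd.const 1))

theorem PT.add {f g : ι → ℕ} (hf : PT sz a f) (hg : PT sz a g) : PT sz a fun i => f i + g i := by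
  refine PT.of_bdd ?_ (hf.bdd_nat.add hg.bdd_nat)
  refine (RT.iterate (f := fun _ (s : ℕ) => s + 1) (fun _ _ => True) hg hf.1 (fun _ => trivial)
    (fun _ _ _ => trivial) (RT.nil.cons RT.id.tl)).congr fun i => ?_
  rw [Nat.succ_iterate]

theorem PT.mul {f g : ι → ℕ} (hf : PT sz a f) (hg : PT sz a g) : PT sz a fun i => f i * g i := by
  refine PT.of_bdd ?_ (hf.bdd_nat.mul hg.bdd_nat)
  -- the number of iterations of the inner loop is the fixed factor, so that no bound on the state
  -- is needed
  have hstep : RT (fun z : {z : ι × ℕ // True} => sz z.1.1)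
      (fun z => Data.cons (a z.1.1) (enc z.1.2)) fun z => enc (z.1.2 + f z.1.1) := by
    refine (RT.iterate (f := fun _ (s : ℕ) => s + 1) (fun _ _ => True)
      (hf.lift (fun z : {z : ι × ℕ // True} => z.1.1) RT.id.hd) RT.id.tl (fun _ => trivial)
      (fun _ _ _ => trivial) (RT.nil.cons RT.id.tl)).congr fun i => ?_
    rw [Nat.succ_iterate]
  refine (RT.iterate (f := fun i (s : ℕ) => s + f i) (fun _ _ => True) hg RT.nil (s₀ := fun _ => 0)
    (fun _ => trivial) (fun _ _ _ => trivial) hstep).congr fun i => ?_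
  congr 1
  induction g i with
  | zero => simp
  | succ m ih => rw [Function.iterate_succ_apply', ih, Nat.mul_succ]

theorem PT.drop {f : ι → List α} {k : ι → ℕ} (hf : PT sz a f) (hk : PT sz a k) :
    PT sz a fun i => (f i).drop (k i) := by
  refine ⟨?_, hf.2.mono fun i => size_enc_sublist (List.drop_sublist _ _)⟩
  have hstep : RT (fun z : {z : ι × List α // True} => sz z.1.1)
      (fun z => Data.cons (a z.1.1) (enc z.1.2)) fun z => enc z.1.2.tail := by
    refine RT.id.tl.tl.congr fun z => ?_
    cases h : z.1.2 <;> simp [Data.tl]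
  refine (RT.iterate (f := fun _ (s : List α) => s.tail) (fun _ _ => True) hk hf.1
    (fun _ => trivial) (fun _ _ _ => trivial) hstep).congr fun i => ?_
  congr 1
  dsimp only
  generalize f i = l
  induction k i generalizing l with
  | zero => rfl
  | succ m ih => rw [Function.iterate_succ_apply, ih, List.drop_tail]

/-- Random access to a list. The default value has to be represented by `nil`, which is what reading
beyond the end of a list yields. -/
theorem PT.getD {f : ι → List α} {k : ι → ℕ} {x : α} (hx : enc x = Data.nil) (hf : PT sz a f)
    (hk : PT sz a k) : PT sz a fun i => (f i).getD (k i) x := by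
  have h : ∀ i, (enc ((f i).drop (k i))).hd = enc ((f i).getD (k i) x) := by
    intro i
    generalize f i = l
    rw [List.getD_eq_getElem?_getD, ← Nat.add_zero (k i), ← List.getElem?_drop, Nat.add_zero]
    cases l.drop (k i) <;> simp [Data.hd, hx]
  refine ⟨(hf.drop hk).1.hd.congr h, (hf.drop hk).2.mono fun i => ?_⟩
  rw [← h]
  exact Data.size_hd _

theorem PT.sub {f g : ι → ℕ} (hf : PT sz a f) (hg : PT sz a g) : PT sz a fun i => f i - g i := by
  have hl : PT sz a fun i => List.replicate (f i) () := by
    simpa only [PT, enc_nat_eq_replicate] using hf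
  have := hl.drop hg
  simpa only [List.drop_replicate, PT, ← enc_nat_eq_replicate] using this

theorem PT.lt {f g : ι → ℕ} (hf : PT sz a f) (hg : PT sz a g) :
    PT sz a fun i => decide (f i < g i) := by
  have hl : PT sz a fun i => List.replicate (g i - f i) () := by
    simpa only [PT, enc_nat_eq_replicate] using hg.sub hf
  refine (hl.any (f := fun _ _ => true) (PT.const true)).congr fun i => ?_
  rw [Bool.eq_iff_iff, List.any_eq_true, decide_eq_true_iff, ← Nat.sub_pos_iff_lt]
  simp [List.mem_replicate]
  omega

theorem PT.le {f g : ι → ℕ} (hf : PT sz a f) (hg : PT sz a g) :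
    PT sz a fun i => decide (f i ≤ g i) :=
  (hf.lt hg.succ).congr fun i => by simp

theorem PT.beq_nat {f g : ι → ℕ} (hf : PT sz a f) (hg : PT sz a g) :
    PT sz a fun i => f i == g i :=
  ((hf.le hg).and (hg.le hf)).congr fun i => by
    rw [Bool.eq_iff_iff]
    simp
    omega

theorem PT.eval {f : ι → ℕ} (hf : PT sz a f) (q : Polynomial ℕ) :
    PT sz a fun i => q.eval (f i) := by
  induction q using Polynomial.induction_on' with
  | add p q hp hq => simpa using hp.add hq
  | monomial n c =>
    simp only [Polynomial.eval_monomial]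
    refine (PT.const c).mul ?_
    induction n with
    | zero => simpa using PT.const 1
    | succ n ih => simpa [pow_succ] using ih.mul hf

theorem PT.range {n : ι → ℕ} (hn : PT sz a n) : PT sz a fun i => List.range (n i) := by
  have hrev : PT sz a fun i => (List.range (n i)).reverse := by
    refine ⟨?_, ?_⟩
    · have := RT.iterate (f := fun _ (s : ℕ × List ℕ) => (s.1 + 1, s.1 :: s.2)) (fun _ _ => True)
        (s₀ := fun _ => (0, [])) hn (RT.const _)
        (fun _ => trivial) (fun _ _ _ => trivial)
        ((RT.nil.cons RT.id.tl.hd).cons (RT.id.tl.hd.cons RT.id.tl.tl))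
      refine this.tl.congr fun i => ?_
      have h : ∀ k, (fun s : ℕ × List ℕ => (s.1 + 1, s.1 :: s.2))^[k] (0, [])
          = (k, (List.range k).reverse) := by
        intro k
        induction k with
        | zero => rfl
        | succ k ih => rw [Function.iterate_succ_apply', ih]; simp [List.range_succ]
      rw [h]
      rfl
    · obtain ⟨q, hq⟩ := hn.bdd_nat
      refine ⟨q * (2 * q + 2) + 1, fun i => ?_⟩
      refine (size_enc_list_le (B := 2 * n i + 1) _ fun x hx => ?_).trans ?_
      · have := List.mem_range.1 (List.mem_reverse.1 hx)
        rw [size_enc_nat]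
        omega
      · have : n i * (2 * n i + 2) ≤ q.eval (sz i) * (2 * q.eval (sz i) + 2) := by
          gcongr <;> exact hq i
        simpa using this
  exact hrev.reverse.congr fun i => by simp

end PT

/-! ### Reading the coins of a program from a tape -/

/-- The results of `n` fair coin flips. -/
def coins : ℕ → PMF (List Bool)
  | 0 => PMF.pure []
  | n + 1 => (PMF.uniformOfFintype Bool).bind fun b => (coins n).map (List.cons b)

theorem mem_support_coins (w : List Bool) : w ∈ (coins w.length).support := by
  induction w with
  | nil => simp [coins]
  | cons b w ih =>
    simp only [List.length_cons, coins, PMF.mem_support_bind_iff, PMF.mem_support_map_iff]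
    exact ⟨b, by simp, w, ih, rfl⟩

theorem length_of_mem_support_coins {n : ℕ} {w : List Bool} (h : w ∈ (coins n).support) :
    w.length = n := by
  induction n generalizing w with
  | zero => simpa [coins] using h
  | succ n ih =>
    simp only [coins, PMF.mem_support_bind_iff, PMF.mem_support_map_iff] at h
    obtain ⟨b, -, v, hv, rfl⟩ := h
    simp [ih hv]

theorem expect_cons {n : ℕ} {α : Type} [Fintype α] (f : (Fin (n + 1) → α) → ℝ) :
    𝔼 ω, f ω = 𝔼 b : α, 𝔼 ω : Fin n → α, f (Fin.cons b ω) := by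
  have h := Finset.expect_product Finset.univ Finset.univ
    (fun z : α × (Fin n → α) => f (Fin.cons z.1 z.2))
  rw [Finset.univ_product_univ] at h
  rw [← h]
  exact Fintype.expect_equiv (Fin.consEquiv fun _ => α).symm _ _ fun ω => by
    simp [Fin.consEquiv]

theorem toOuterMeasure_ne_top {α : Type*} (μ : PMF α) (S : Set α) : μ.toOuterMeasure S ≠ ⊤ := by
  refine ne_top_of_le_ne_top ENNReal.one_ne_top ?_
  rw [PMF.toOuterMeasure_apply, ← μ.tsum_coe]
  exact ENNReal.tsum_le_tsum fun a => Set.indicator_le_self _ _ a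

/-- Probabilities for coin flips are averages over bit strings. -/
theorem coins_toReal (n : ℕ) (S : Set (List Bool)) [DecidablePred (· ∈ S)] :
    ((coins n).toOuterMeasure S).toReal
      = 𝔼 ω : Fin n → Bool, if List.ofFn ω ∈ S then (1 : ℝ) else 0 := by
  classical
  induction n generalizing S with
  | zero =>
    rw [coins, PMF.toOuterMeasure_pure_apply]
    have : (fun ω : Fin 0 → Bool => if List.ofFn ω ∈ S then (1 : ℝ) else 0)
        = fun _ => if [] ∈ S then (1 : ℝ) else 0 := by
      funext ω; simp
    rw [this, Fintype.expect_const]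
    split_ifs <;> simp
  | succ n ih =>
    rw [coins, PMF.toOuterMeasure_bind_apply, tsum_fintype, expect_cons,
      ENNReal.toReal_sum (fun b _ => ENNReal.mul_ne_top (PMF.apply_ne_top _ _)
        (toOuterMeasure_ne_top _ _)),
      Fintype.expect_eq_sum_div_card, Finset.sum_div]
    refine Finset.sum_congr rfl fun b _ => ?_
    rw [PMF.toOuterMeasure_map_apply, ENNReal.toReal_mul, ih]
    simp [List.ofFn_succ, div_eq_inv_mul]

/-- One step of the computation in which the coins are read from a tape (and show `false` at its
end). -/
def tapeStep : Config × List Bool → Config × List Bool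
  | (⟨[], σ⟩, w) => (⟨[], σ⟩, w)
  | (⟨Cmd.assign x e :: k, σ⟩, w) => (⟨k, Function.update σ x (e.eval σ)⟩, w)
  | (⟨Cmd.flip x :: k, σ⟩, w) =>
      (⟨k, Function.update σ x (Data.ofBool (w.headD false))⟩, w.tail)
  | (⟨Cmd.seq p q :: k, σ⟩, w) => (⟨p :: q :: k, σ⟩, w)
  | (⟨Cmd.ite e p q :: k, σ⟩, w) =>
      (if (e.eval σ).test = true then ⟨p :: k, σ⟩ else ⟨q :: k, σ⟩, w)
  | (⟨Cmd.loop e p :: k, σ⟩, w) =>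
      (if (e.eval σ).test = true then ⟨p :: Cmd.loop e p :: k, σ⟩ else ⟨k, σ⟩, w)

theorem runFor_eq_map_tapeStep {T Q : ℕ} (h : T ≤ Q) (c : Config) :
    runFor T c = (coins Q).map fun w => (tapeStep^[T] (c, w)).1 := by
  induction T generalizing c Q with
  | zero => exact (PMF.map_const _ _).symm
  | succ T ih =>
    have hdet : ∀ c', step c = PMF.pure c' → (∀ w, tapeStep (c, w) = (c', w)) →
        runFor (T + 1) c = (coins Q).map fun w => (tapeStep^[T + 1] (c, w)).1 := by
      intro c' h1 h2
      simp only [runFor, h1, PMF.pure_bind, Function.iterate_succ_apply, h2]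
      exact ih (by omega) c'
    obtain ⟨k, σ⟩ := c
    match k with
    | [] => exact hdet _ rfl fun _ => rfl
    | Cmd.assign x e :: k => exact hdet _ rfl fun _ => rfl
    | Cmd.seq p q :: k => exact hdet _ rfl fun _ => rfl
    | Cmd.ite e p q :: k => exact hdet _ rfl fun _ => rfl
    | Cmd.loop e p :: k => exact hdet _ rfl fun _ => rfl
    | Cmd.flip x :: k =>
      obtain ⟨Q, rfl⟩ : ∃ R, Q = R + 1 := ⟨Q - 1, by omega⟩
      simp only [runFor, step, PMF.bind_map, coins, PMF.map_bind, PMF.map_comp]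
      congr 1
      funext b
      simp only [Function.comp_apply]
      rw [ih (Q := Q) (by omega)]
      rfl

/-- All variables of the expression are below the bound. -/
def Expr.Below (r : ℕ) : Expr → Prop
  | Expr.var x => x < r
  | Expr.nil => True
  | Expr.cons e f => e.Below r ∧ f.Below r
  | Expr.hd e => e.Below r
  | Expr.tl e => e.Below r

/-- All variables of the program are below the bound. -/
def Cmd.Below (r : ℕ) : Cmd → Prop
  | Cmd.assign x e => x < r ∧ e.Below r
  | Cmd.flip x => x < r
  | Cmd.seq p q => p.Below r ∧ q.Below r
  | Cmd.ite e p q => e.Below r ∧ p.Below r ∧ q.Below r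
  | Cmd.loop e p => e.Below r ∧ p.Below r

theorem Expr.Below.mono {r s : ℕ} (h : r ≤ s) : ∀ {e : Expr}, e.Below r → e.Below s
  | Expr.var _, he => lt_of_lt_of_le he h
  | Expr.nil, _ => trivial
  | Expr.cons _ _, he => ⟨Expr.Below.mono h he.1, Expr.Below.mono h he.2⟩
  | Expr.hd e, he => Expr.Below.mono (e := e) h he
  | Expr.tl e, he => Expr.Below.mono (e := e) h he

theorem Cmd.Below.mono {r s : ℕ} (h : r ≤ s) : ∀ {p : Cmd}, p.Below r → p.Below s
  | Cmd.assign _ _, hp => ⟨lt_of_lt_of_le hp.1 h, hp.2.mono h⟩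
  | Cmd.flip _, hp => lt_of_lt_of_le hp h
  | Cmd.seq _ _, hp => ⟨Cmd.Below.mono h hp.1, Cmd.Below.mono h hp.2⟩
  | Cmd.ite _ _ _, hp => ⟨hp.1.mono h, Cmd.Below.mono h hp.2.1, Cmd.Below.mono h hp.2.2⟩
  | Cmd.loop _ _, hp => ⟨hp.1.mono h, Cmd.Below.mono h hp.2⟩

theorem Expr.exists_below (e : Expr) : ∃ r, e.Below r := by
  induction e with
  | var x => exact ⟨x + 1, Nat.lt_succ_self x⟩
  | nil => exact ⟨0, trivial⟩
  | cons e f he hf =>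
    obtain ⟨r, hr⟩ := he
    obtain ⟨s, hs⟩ := hf
    exact ⟨max r s, hr.mono (le_max_left _ _), hs.mono (le_max_right _ _)⟩
  | hd e he => exact he
  | tl e he => exact he

theorem Cmd.exists_below (p : Cmd) : ∃ r, 0 < r ∧ p.Below r := by
  suffices h : ∃ r, p.Below r by
    obtain ⟨r, hr⟩ := h
    exact ⟨r + 1, Nat.succ_pos r, hr.mono (Nat.le_succ r)⟩
  induction p with
  | assign x e =>
    obtain ⟨r, hr⟩ := e.exists_below
    exact ⟨max (x + 1) r, lt_of_lt_of_le (Nat.lt_succ_self x) (le_max_left _ _),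
      hr.mono (le_max_right _ _)⟩
  | flip x => exact ⟨x + 1, Nat.lt_succ_self x⟩
  | seq p q hp hq =>
    obtain ⟨r, hr⟩ := hp
    obtain ⟨s, hs⟩ := hq
    exact ⟨max r s, hr.mono (le_max_left _ _), hs.mono (le_max_right _ _)⟩
  | ite e p q hp hq =>
    obtain ⟨r, hr⟩ := hp
    obtain ⟨s, hs⟩ := hq
    obtain ⟨t, ht⟩ := e.exists_below
    exact ⟨max t (max r s), ht.mono (le_max_left _ _), hr.mono (by simp), hs.mono (by simp)⟩
  | loop e p hp =>
    obtain ⟨r, hr⟩ := hp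
    obtain ⟨t, ht⟩ := e.exists_below
    exact ⟨max t r, ht.mono (le_max_left _ _), hr.mono (le_max_right _ _)⟩

theorem Expr.eval_congr {r : ℕ} {σ τ : Store} (h : ∀ x < r, σ x = τ x) :
    ∀ {e : Expr}, e.Below r → e.eval σ = e.eval τ
  | Expr.var x, he => h x he
  | Expr.nil, _ => rfl
  | Expr.cons _ _, he => by simp only [Expr.eval, Expr.eval_congr h he.1, Expr.eval_congr h he.2]
  | Expr.hd e, he => by simp only [Expr.eval, Expr.eval_congr (e := e) h he]
  | Expr.tl e, he => by simp only [Expr.eval, Expr.eval_congr (e := e) h he]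

/-- The deterministic program that takes its coins from the list in variable `r`. -/
def Cmd.detape (r : ℕ) : Cmd → Cmd
  | Cmd.assign x e => Cmd.assign x e
  | Cmd.flip x => Cmd.seq (Cmd.assign x (Expr.hd (Expr.var r)))
      (Cmd.assign r (Expr.tl (Expr.var r)))
  | Cmd.seq p q => Cmd.seq (p.detape r) (q.detape r)
  | Cmd.ite e p q => Cmd.ite e (p.detape r) (q.detape r)
  | Cmd.loop e p => Cmd.loop e (p.detape r)

theorem detape_step {r : ℕ} {k : List Cmd} {σ τ : Store} {w : List Bool}
    (hk : ∀ p ∈ k, p.Below r) (hστ : ∀ x < r, τ x = σ x) (hw : τ r = enc w) :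
    (∀ p ∈ (tapeStep (⟨k, σ⟩, w)).1.todo, p.Below r) ∧
    ∃ t ≤ 3, ∃ τ' : Store, (∀ rest, runFor t ⟨k.map (Cmd.detape r) ++ rest, τ⟩
        = PMF.pure ⟨(tapeStep (⟨k, σ⟩, w)).1.todo.map (Cmd.detape r) ++ rest, τ'⟩) ∧
      (∀ x < r, τ' x = (tapeStep (⟨k, σ⟩, w)).1.store x) ∧
      τ' r = enc (tapeStep (⟨k, σ⟩, w)).2 ∧ ∀ x, r < x → τ' x = τ x := by
  match k with
  | [] => exact ⟨hk, 0, by omega, τ, fun rest => rfl, hστ, hw, fun _ _ => rfl⟩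
  | Cmd.assign x e :: k =>
    have h1 := hk _ List.mem_cons_self
    refine ⟨fun p hp => hk p (List.mem_cons_of_mem _ hp), 1, by omega,
      Function.update τ x (e.eval τ), fun rest => by simp [runFor, step, tapeStep, Cmd.detape],
      fun y hy => ?_, ?_, fun y hy => ?_⟩
    · simp only [tapeStep, Function.update_apply, hστ y hy, Expr.eval_congr hστ h1.2]
    · rw [Function.update_of_ne (ne_of_gt h1.1), hw]
      rfl
    · rw [Function.update_of_ne (ne_of_gt (h1.1.trans hy))]
  | Cmd.seq p q :: k =>
    have h1 := hk _ List.mem_cons_self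
    refine ⟨fun p' hp => ?_, 1, by omega, τ, fun rest => by
      simp [runFor, step, tapeStep, Cmd.detape], hστ, hw, fun _ _ => rfl⟩
    simp only [tapeStep, List.mem_cons] at hp
    rcases hp with rfl | rfl | hp
    · exact h1.1
    · exact h1.2
    · exact hk _ (List.mem_cons_of_mem _ hp)
  | Cmd.ite e p q :: k =>
    have h1 := hk _ List.mem_cons_self
    have he := Expr.eval_congr hστ h1.1
    rcases hb : (e.eval σ).test with _ | _
    · refine ⟨fun p' hp => ?_, 1, by omega, τ, fun rest => by
        simp [runFor, step, tapeStep, Cmd.detape, he, hb], fun x hx => by simp [tapeStep, hb, hστ x hx],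
          hw, fun _ _ => rfl⟩
      simp [tapeStep, hb] at hp
      rcases hp with rfl | hp
      · exact h1.2.2
      · exact hk _ (List.mem_cons_of_mem _ hp)
    · refine ⟨fun p' hp => ?_, 1, by omega, τ, fun rest => by
        simp [runFor, step, tapeStep, Cmd.detape, he, hb], fun x hx => by simp [tapeStep, hb, hστ x hx],
          hw, fun _ _ => rfl⟩
      simp [tapeStep, hb] at hp
      rcases hp with rfl | hp
      · exact h1.2.1
      · exact hk _ (List.mem_cons_of_mem _ hp)
  | Cmd.loop e p :: k =>
    have h1 := hk _ List.mem_cons_self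
    have he := Expr.eval_congr hστ h1.1
    rcases hb : (e.eval σ).test with _ | _
    · refine ⟨fun p' hp => ?_, 1, by omega, τ, fun rest => by
        simp [runFor, step, tapeStep, Cmd.detape, he, hb], fun x hx => by simp [tapeStep, hb, hστ x hx],
          hw, fun _ _ => rfl⟩
      simp [tapeStep, hb] at hp
      exact hk _ (List.mem_cons_of_mem _ hp)
    · refine ⟨fun p' hp => ?_, 1, by omega, τ, fun rest => by
        simp [runFor, step, tapeStep, Cmd.detape, he, hb], fun x hx => by simp [tapeStep, hb, hστ x hx],
          hw, fun _ _ => rfl⟩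
      simp [tapeStep, hb] at hp
      rcases hp with rfl | rfl | hp
      · exact h1.2
      · exact h1
      · exact hk _ (List.mem_cons_of_mem _ hp)
  | Cmd.flip x :: k =>
    have h1 : x < r := hk _ List.mem_cons_self
    have hhd : (enc w).hd = Data.ofBool (w.headD false) := by cases w <;> rfl
    have htl : (enc w).tl = enc w.tail := by cases w <;> rfl
    refine ⟨fun p hp => hk p (List.mem_cons_of_mem _ hp), 3, le_rfl,
      Function.update (Function.update τ x (Data.ofBool (w.headD false))) r (enc w.tail),
      fun rest => ?_, fun y hy => ?_, ?_, fun y hy => ?_⟩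
    · simp [runFor, step, tapeStep, Cmd.detape, Expr.eval, hw, hhd, htl, h1.ne']
    · rw [Function.update_of_ne hy.ne]
      simp only [tapeStep, Function.update_apply, hστ y hy]
    · simp [tapeStep]
    · rw [Function.update_of_ne hy.ne', Function.update_of_ne (h1.trans hy).ne']

theorem detape_run {r : ℕ} (T : ℕ) {k : List Cmd} {σ τ : Store} {w : List Bool}
    (hk : ∀ p ∈ k, p.Below r) (hστ : ∀ x < r, τ x = σ x) (hw : τ r = enc w) :
    ∃ t ≤ 3 * T, ∃ τ' : Store, (∀ rest, runFor t ⟨k.map (Cmd.detape r) ++ rest, τ⟩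
        = PMF.pure ⟨(tapeStep^[T] (⟨k, σ⟩, w)).1.todo.map (Cmd.detape r) ++ rest, τ'⟩) ∧
      (∀ x < r, τ' x = (tapeStep^[T] (⟨k, σ⟩, w)).1.store x) ∧ ∀ x, r < x → τ' x = τ x := by
  induction T generalizing k σ τ w with
  | zero => exact ⟨0, le_rfl, τ, fun rest => rfl, hστ, fun _ _ => rfl⟩
  | succ T ih =>
    obtain ⟨hk', t, ht, τ', h1, h2, h3, h4⟩ := detape_step hk hστ hw
    obtain ⟨t', ht', τ'', h5, h6, h7⟩ := ih hk' h2 h3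
    refine ⟨t + t', by omega, τ'', fun rest => ?_, h6, fun x hx => (h7 x hx).trans (h4 x hx)⟩
    rw [runFor_add, h1, PMF.pure_bind, h5]
    rfl

/-- The program that resets the variables `1, …, r`. -/
def clearUpTo : ℕ → Cmd
  | 0 => Cmd.assign 0 (Expr.var 0)
  | r + 1 => Cmd.seq (clearUpTo r) (Cmd.assign (r + 1) Expr.nil)

theorem exec_clearUpTo (r : ℕ) (σ : Store) :
    Exec (clearUpTo r) σ (fun x => if 0 < x ∧ x ≤ r then Data.nil else σ x) (2 * r + 1) := by
  induction r with
  | zero =>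
    have := exec_assign 0 (Expr.var 0) σ
    refine (congrArg (fun τ => Exec (clearUpTo 0) σ τ 1) ?_).mp this
    funext x
    by_cases hx : x = 0
    · subst hx; simp [Expr.eval]
    · simp [hx]
  | succ r ih =>
    have := (ih.seq (exec_assign (r + 1) Expr.nil _)).mono (u := 2 * (r + 1) + 1) (by omega)
    refine (congrArg (fun τ => Exec (clearUpTo (r + 1)) σ τ (2 * (r + 1) + 1)) ?_).mp this
    funext x
    by_cases hx : x = r + 1
    · subst hx; simp [Expr.eval]
    · rw [Function.update_of_ne hx]
      have : x ≤ r + 1 ↔ x ≤ r := by omega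
      simp [this]

theorem RT.test {ι : Type} {sz : ι → ℕ} {a b : ι → Data} (h : RT sz a b) :
    RT sz a fun i => enc (b i).test := by
  refine h.comp ⟨Cmd.ite (Expr.var 0) (Cmd.assign 0 (Expr.cons Expr.nil Expr.nil))
    (Cmd.assign 0 Expr.nil), 0, 2, fun i σ h0 _ => ?_⟩
  have := exec_ite (e := Expr.var 0) (p := Cmd.assign 0 (Expr.cons Expr.nil Expr.nil))
    (q := Cmd.assign 0 Expr.nil) (σ := σ) (τ := Function.update σ 0 (enc (b i).test)) (t := 1)
    (fun h => by
      convert exec_assign 0 _ σ using 1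
      simp only [Expr.eval, h0] at h
      simp [Expr.eval, h])
    (fun h => by
      convert exec_assign 0 _ σ using 1
      simp only [Expr.eval, h0] at h
      simp [Expr.eval, h])
  simpa using this

theorem tapeStep_iterate_halted (T : ℕ) (σ : Store) (w : List Bool) :
    tapeStep^[T] (⟨[], σ⟩, w) = (⟨[], σ⟩, w) :=
  Function.iterate_fixed rfl T

open Classical in
/-- Whether the program `D` halts with output `1` on the input `x` when its coins show `w`. -/
def tapeAccepts (D : Cmd) (x : Data) (w : List Bool) : Bool :=
  decide (∃ T, (tapeStep^[T] (start D x, w)).1.todo = [] ∧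
    (tapeStep^[T] (start D x, w)).1.store 0 = Data.ofBool true)

theorem tapeAccepts_iff {D : Cmd} {x : Data} {w : List Bool} {T : ℕ}
    (h : (tapeStep^[T] (start D x, w)).1.todo = []) :
    tapeAccepts D x w = true ↔ (tapeStep^[T] (start D x, w)).1.store 0 = Data.ofBool true := by
  simp only [tapeAccepts, decide_eq_true_eq]
  refine ⟨fun ⟨S, hS, hv⟩ => ?_, fun hv => ⟨T, h, hv⟩⟩
  have stay : ∀ {A B : ℕ}, A ≤ B → (tapeStep^[A] (start D x, w)).1.todo = [] →
      tapeStep^[B] (start D x, w) = tapeStep^[A] (start D x, w) := by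
    intro A B hAB hA
    obtain ⟨R, rfl⟩ := Nat.exists_eq_add_of_le' hAB
    rw [Function.iterate_add_apply]
    rcases hc : tapeStep^[A] (start D x, w) with ⟨⟨k, σ⟩, v⟩
    rw [hc] at hA
    simp only at hA
    subst hA
    exact tapeStep_iterate_halted R σ v
  rcases le_total S T with hle | hle
  · rw [stay hle hS, hv]
  · rw [← stay hle h, hv]

theorem HaltsWithin.tape {D : Cmd} {x : Data} {T : ℕ} (h : HaltsWithin D x T) {w : List Bool}
    (hw : T ≤ w.length) : (tapeStep^[T] (start D x, w)).1.todo = [] := by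
  refine h _ ?_
  rw [runFor_eq_map_tapeStep hw, PMF.mem_support_map_iff]
  exact ⟨w, mem_support_coins w, rfl⟩

theorem outputProb_eq_expect {D : Cmd} {x : Data} {T Q : ℕ} (h : HaltsWithin D x T) (hQ : T ≤ Q) :
    outputProb D x (Data.ofBool true)
      = 𝔼 ω : Fin Q → Bool, if tapeAccepts D x (List.ofFn ω) = true then (1 : ℝ) else 0 := by
  classical
  have hmem : ∀ w ∈ (coins Q).support, (tapeStep^[T] (start D x, w)).1.todo = [] := by
    intro w hw
    exact h.tape (by rw [length_of_mem_support_coins hw]; exact hQ)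
  have hrun : runFor T (start D x) = ((coins Q).map fun w =>
      (tapeStep^[T] (start D x, w)).1.store).map fun τ => (⟨[], τ⟩ : Config) := by
    rw [runFor_eq_map_tapeStep hQ, PMF.map_comp]
    refine PMF.ext fun c => ?_
    rw [PMF.map_apply, PMF.map_apply]
    refine tsum_congr fun w => ?_
    by_cases hw : w ∈ (coins Q).support
    · have := hmem w hw
      rcases hc : (tapeStep^[T] (start D x, w)).1 with ⟨k, σ⟩
      rw [hc] at this
      simp only at this
      simp [hc, this]
    · simp [(PMF.apply_eq_zero_iff _ _).2 hw]
  rw [outputProb_eq_of_halts _ hrun, PMF.toOuterMeasure_map_apply, coins_toReal]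
  refine Finset.expect_congr rfl fun ω _ => ?_
  have h1 := tapeAccepts_iff (h.tape (w := List.ofFn ω) (by simpa using hQ))
  simp only [Set.mem_preimage, Set.mem_ofPred_eq, h1]

theorem size_ge_of_encodeInstance {n m d : ℕ} (G : Hypergraph n m d) (y : Fin m → Bool) :
    n + m ≤ (encodeInstance G y).size := by
  have h1 : n ≤ (Data.ofNat n).size := by
    have := size_enc_nat n
    change (Data.ofNat n).size = _ at this
    omega
  have h2 : m ≤ (Data.ofBits y).size := by
    have := length_le_size (List.ofFn y)
    rw [List.length_ofFn] at this
    refine this.trans (le_of_eq ?_)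
    change (Data.ofList _).size = (Data.ofList _).size
    rw [List.map_ofFn]
    rfl
  simp only [encodeInstance, Data.size_cons]
  omega

/-- Running an efficient program with given coins takes polynomial time. -/
theorem PT.tapeAccepts {d : ℕ} {D : Cmd} {q : Polynomial ℕ}
    (hD : ∀ (n m : ℕ) (G : Hypergraph n m d) (y : Fin m → Bool),
      HaltsWithin D (encodeInstance G y) (q.eval (n + m)))
    {ι : Type} {sz : ι → ℕ} {a : ι → Data} {x : ι → Data} {w : ι → List Bool}
    (hx : PT sz a x) (hw : PT sz a w)
    (h : ∀ i, ∃ (n m : ℕ) (G : Hypergraph n m d) (y : Fin m → Bool),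
      x i = encodeInstance G y ∧ q.eval (n + m) ≤ (w i).length) :
    PT sz a fun i => tapeAccepts D (x i) (w i) := by
  obtain ⟨r, hr, hDr⟩ := D.exists_below
  obtain ⟨s, hs⟩ := hx.2
  -- the time bound for the run on `x i`, expressed through the size of `x i`
  set T : ι → ℕ := fun i => (q.comp s).eval (sz i) with hT
  have hhalt : ∀ i, ∃ S ≤ T i, (tapeStep^[S] (start D (x i), w i)).1.todo = [] := by
    intro i
    obtain ⟨n, m, G, y, hxi, hlen⟩ := h i
    refine ⟨q.eval (n + m), ?_, ?_⟩
    · have h1 := size_ge_of_encodeInstance G y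
      have h2 : (x i).size ≤ s.eval (sz i) := hs i
      rw [hxi] at h2
      simp only [hT, Polynomial.eval_comp]
      exact eval_mono q (h1.trans h2)
    · rw [hxi]
      exact (hD n m G y).tape hlen
  choose S hST hhalt using hhalt
  have key : RT sz (fun i => Data.cons (x i) (enc (w i)))
      fun i => (tapeStep^[S i] (start D (x i), w i)).1.store 0 := by
    refine ⟨Cmd.seq (Cmd.assign r (Expr.tl (Expr.var 0))) (Cmd.seq
      (Cmd.assign 0 (Expr.hd (Expr.var 0))) (Cmd.seq (D.detape r) (clearUpTo r))), r + 1,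
      3 * q.comp s + 2 * Polynomial.C r + 6, fun i σ h0 hσ => ?_⟩
    set τ : Store := Function.update (Function.update σ r (enc (w i))) 0 (x i) with hτ
    obtain ⟨t, ht, τ', h1, h2, h3⟩ := detape_run (r := r) (S i) (k := [D])
      (σ := (start D (x i)).store) (τ := τ) (w := w i) (by simpa using hDr)
      (fun y hy => by
        by_cases hy0 : y = 0
        · subst hy0; simp [hτ, start]
        · simp [hτ, start, hy0, Function.update_of_ne hy.ne, hσ y (by omega) (by omega)])
      (by simp [hτ, hr.ne'])
    have hc : (⟨[D], (start D (x i)).store⟩ : Config) = start D (x i) := rfl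
    rw [hc] at h1 h2
    have e1 : Exec (D.detape r) τ τ' (3 * S i) := by
      refine ⟨t, ht, fun rest => ?_⟩
      have := h1 rest
      rw [hhalt i] at this
      simpa using this
    have E := (exec_assign r (Expr.tl (Expr.var 0)) σ).seq
      ((exec_assign 0 (Expr.hd (Expr.var 0)) _).seq (Exec.seq (p := D.detape r)
        (by simpa [Expr.eval, h0, Data.hd, Data.tl, hr.ne, hτ] using e1) (exec_clearUpTo r τ')))
    convert E.mono (u := (3 * q.comp s + 2 * Polynomial.C r + 6).eval (sz i)) ?_ using 1
    · funext y
      by_cases hy0 : y = 0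
      · subst hy0; simp [h2 0 hr]
      · by_cases hyr : y ≤ r
        · simp [hy0, hyr, Nat.pos_of_ne_zero hy0, hσ y (by omega) (by omega)]
        · simp [hy0, hyr, h3 y (by omega), hτ, show y ≠ r by omega]
    · have := hST i
      simp only [hT] at this
      simp only [Polynomial.eval_add, Polynomial.eval_mul, Polynomial.eval_C,
        Polynomial.eval_ofNat]
      omega
  have hv := (hx.1.cons hw.1).comp key
  have hand : ∀ (f g : ι → Bool), RT sz a (fun i => enc (f i)) → RT sz a (fun i => enc (g i)) →
      RT sz a fun i => enc (f i && g i) := fun f g hf hg =>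
    ((PT.of_bool hf).and (PT.of_bool hg)).1
  have hnot : ∀ (f : ι → Bool), RT sz a (fun i => enc (f i)) → RT sz a fun i => enc (!f i) :=
    fun f hf => (PT.of_bool hf).not.1
  refine PT.of_bool ((hand _ _ hv.test (hand _ _ (hnot _ hv.hd.test) (hnot _ hv.tl.test))).congr
    fun i => ?_)
  congr 1
  rw [Bool.eq_iff_iff, tapeAccepts_iff (hhalt i)]
  generalize (tapeStep^[S i] (start D (x i), w i)).1.store 0 = v
  rcases v with _ | ⟨_ | ⟨_, _⟩, _ | ⟨_, _⟩⟩ <;> simp [Data.test, Data.hd, Data.tl, Data.ofBool]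

/-! ### Programs that flip all their coins at the start -/

theorem coins_succ_append (n : ℕ) :
    coins (n + 1) = (PMF.uniformOfFintype Bool).bind fun b => (coins n).map fun w => w ++ [b] := by
  induction n with
  | zero => simp [coins, PMF.pure_map]
  | succ n ih =>
    rw [coins]
    conv_lhs => rw [ih]
    simp only [PMF.map_bind]
    rw [PMF.bind_comm]
    congr 1
    funext b
    rw [coins, PMF.map_bind]
    simp only [PMF.map_comp]
    rfl

/-- The program that flips as many coins as variable `K + 1` says, and puts the results in front of
the list in variable `K + 2`. -/
def flipLoop (K : ℕ) : Cmd :=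
  Cmd.loop (Expr.var (K + 1)) (Cmd.seq (Cmd.flip (K + 3)) (Cmd.seq
    (Cmd.assign (K + 2) (Expr.cons (Expr.var (K + 3)) (Expr.var (K + 2)))) (Cmd.seq
      (Cmd.assign (K + 1) (Expr.tl (Expr.var (K + 1)))) (Cmd.assign (K + 3) Expr.nil))))

theorem runFor_flipLoop (K N : ℕ) (k : List Cmd) (σ : Store) (acc : List Bool)
    (h1 : σ (K + 1) = enc N) (h2 : σ (K + 2) = enc acc) (h3 : σ (K + 3) = Data.nil) :
    runFor (N * 8 + 1) ⟨flipLoop K :: k, σ⟩ = (coins N).map fun w =>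
      ⟨k, Function.update (Function.update σ (K + 1) Data.nil) (K + 2) (enc (w ++ acc))⟩ := by
  induction N generalizing σ acc with
  | zero =>
    have : Function.update (Function.update σ (K + 1) Data.nil) (K + 2) (enc acc) = σ := by
      funext x
      by_cases x1 : x = K + 2
      · subst x1; simp [h2]
      · by_cases x2 : x = K + 1
        · subst x2; simp [h1]
        · simp [x1, x2]
    simp [runFor, flipLoop, step, Expr.eval, h1, Data.test, coins, PMF.pure_map, this]
  | succ N ih =>
    rw [show (N + 1) * 8 + 1 = 8 + (N * 8 + 1) by ring, runFor_add]
    have h8 : runFor 8 ⟨flipLoop K :: k, σ⟩ = (PMF.uniformOfFintype Bool).map fun b =>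
        ⟨flipLoop K :: k, Function.update (Function.update (Function.update (Function.update σ
          (K + 3) (Data.ofBool b)) (K + 2) (Data.cons (Data.ofBool b) (enc acc))) (K + 1) (enc N))
            (K + 3) Data.nil⟩ := by
      simp [runFor, flipLoop, step, Expr.eval, h1, h2, Data.test, Data.tl, PMF.map, PMF.bind_bind]
      rfl
    rw [h8, PMF.bind_map, coins_succ_append, PMF.map_bind]
    congr 1
    funext b
    simp only [Function.comp_apply]
    rw [ih _ (b :: acc) (by simp) (by simp; rfl) (by simp), PMF.map_comp]
    congr 1
    funext w
    simp only [Function.comp_apply, Config.mk.injEq, true_and, List.append_assoc,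
      List.singleton_append]
    funext x
    by_cases x1 : x = K + 2
    · subst x1; simp
    · by_cases x2 : x = K + 1
      · subst x2; simp
      · by_cases x3 : x = K + 3
        · subst x3; simp [h3]
        · simp [x1, x2, x3]

theorem enc_bits_injective : Function.Injective (enc : List Bool → Data) := by
  intro l
  induction l with
  | nil =>
    rintro (_ | ⟨b, m⟩) h
    · rfl
    · simp at h
  | cons b l ih =>
    rintro (_ | ⟨c, m⟩) h
    · simp at h
    · simp only [enc_list_cons, Data.cons.injEq] at h
      rw [ih h.2]
      cases b <;> cases c <;> simp_all

/-- The instances of locality `d`. -/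
structure Inst (d : ℕ) : Type where
  n : ℕ
  m : ℕ
  G : Hypergraph n m d
  y : Fin m → Bool

/-- The size of an instance, in terms of which running times are measured. -/
def Inst.sz {d : ℕ} (I : Inst d) : ℕ := I.n + I.m

/-- An instance as input of a program. -/
def Inst.data {d : ℕ} (I : Inst d) : Data := encodeInstance I.G I.y

/-- A polynomial-time function of an instance and of polynomially many coins gives rise to an
efficient program. -/
theorem exists_efficient_of_PT {d : ℕ} {len : Inst d → ℕ} (hlen : PT Inst.sz Inst.data len)
    {f : Inst d → List Bool → List Bool}
    (hf : PT (fun z : {z : Inst d × List Bool // z.2.length = len z.1} => z.1.1.sz)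
      (fun z => Data.cons z.1.1.data (enc z.1.2)) fun z => f z.1.1 z.1.2) :
    ∃ A : Cmd, Efficient d A ∧ ∀ (I : Inst d) (v : List Bool),
      outputProb A I.data (enc v) = 𝔼 ω : Fin (len I) → Bool,
        if f I (List.ofFn ω) = v then (1 : ℝ) else 0 := by
  classical
  obtain ⟨B, hB⟩ := hlen.bdd_nat
  obtain ⟨p₁, K₁, q₁, h₁⟩ := hlen.1
  obtain ⟨p₂, K₂, q₂, h₂⟩ := hf.1
  obtain ⟨K, hK₁, hK₂, hK⟩ : ∃ K, K₁ ≤ K ∧ K₂ ≤ K ∧ 0 < K :=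
    ⟨K₁ + K₂ + 1, by omega, by omega, by omega⟩
  set c₁ : Cmd := Cmd.seq (Cmd.assign K (Expr.var 0)) (Cmd.seq p₁
    (Cmd.assign (K + 1) (Expr.var 0))) with hc₁
  set c₂ : Cmd := Cmd.seq (Cmd.assign 0 (Expr.cons (Expr.var K) (Expr.var (K + 2)))) (Cmd.seq
    (Cmd.assign K Expr.nil) (Cmd.seq (Cmd.assign (K + 2) Expr.nil) p₂)) with hc₂
  set A : Cmd := Cmd.seq c₁ (Cmd.seq (flipLoop K) c₂) with hA
  set p : Polynomial ℕ := q₁ + q₂ + B * 8 + 20 with hp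
  have main : ∀ I : Inst d, runFor (p.eval I.sz) (start A I.data) = ((coins (len I)).map fun w =>
      Function.update (start A I.data).store 0 (enc (f I w))).map
        fun τ => (⟨[], τ⟩ : Config) := by
    intro I
    set σ : Store := (start A I.data).store with hσ
    have hσ0 : σ 0 = I.data := by simp [hσ, start]
    have hσx : ∀ x, 0 < x → σ x = Data.nil := fun x hx => by simp [hσ, start, hx.ne']
    obtain ⟨t, ht, e1⟩ : Exec c₁ σ (Function.update (Function.update (Function.update σ K I.data) 0
        (enc (len I))) (K + 1) (enc (len I))) (q₁.eval I.sz + 4) := by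
      have e := h₁ I (Function.update σ K I.data) (by simp [hK.ne, hσ0]) fun x hx0 hxK => by
        rw [Function.update_of_ne (by omega)]
        exact hσx x hx0
      have E := (exec_assign K (Expr.var 0) σ).seq (Exec.seq (p := p₁)
        (by simpa [Expr.eval, hσ0] using e) (exec_assign (K + 1) (Expr.var 0) _))
      convert E.mono (u := q₁.eval I.sz + 4) (by omega) using 1
      simp [Expr.eval]
    set σ₁ : Store := Function.update (Function.update (Function.update σ K I.data) 0
        (enc (len I))) (K + 1) (enc (len I)) with hσ₁
    have e2 : ∀ w ∈ (coins (len I)).support, Exec c₂ (Function.update (Function.update σ₁ (K + 1)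
        Data.nil) (K + 2) (enc (w ++ []))) (Function.update σ 0 (enc (f I w)))
        (q₂.eval I.sz + 7) := by
      intro w hw
      have e := h₂ ⟨(I, w), length_of_mem_support_coins hw⟩
        (Function.update σ 0 (Data.cons I.data (enc w))) (by simp) fun x hx0 hxK => by
          rw [Function.update_of_ne hx0.ne']
          exact hσx x hx0
      have hst : Function.update (Function.update (Function.update (Function.update (Function.update
          σ₁ (K + 1) Data.nil) (K + 2) (enc (w ++ []))) 0 (Data.cons I.data (enc w))) K Data.nil)
          (K + 2) Data.nil = Function.update σ 0 (Data.cons I.data (enc w)) := by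
        funext x
        by_cases x0 : x = 0
        · subst x0; simp [hK.ne]
        · by_cases x1 : x = K + 2
          · subst x1; simp [hσx]
          · by_cases x2 : x = K
            · subst x2; simp [x0, hσx x hK]
            · by_cases x3 : x = K + 1
              · subst x3; simp [hσx]
              · simp [x0, x1, x2, x3, hσ₁]
      obtain ⟨t₁, ht₁, E1⟩ := (exec_assign 0 (Expr.cons (Expr.var K) (Expr.var (K + 2)))
        (Function.update (Function.update σ₁ (K + 1) Data.nil) (K + 2) (enc (w ++ [])))).seq
        ((exec_assign K Expr.nil _).seq ((exec_assign (K + 2) Expr.nil _).seq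
          (show Exec p₂ _ _ _ by
            convert e using 1
            rw [← hst]
            simp [Expr.eval, hσ₁, hK.ne'])))
      refine ⟨t₁, ht₁.trans (by dsimp only; omega), fun k => ?_⟩
      rw [E1]
      simp
    have hlenB : len I ≤ B.eval I.sz := hB I
    obtain ⟨R, hR⟩ : ∃ R, p.eval I.sz = 1 + t + 1 + (len I * 8 + 1) + R ∧
        q₂.eval I.sz + 7 ≤ R := by
      refine ⟨p.eval I.sz - (1 + t + 1 + (len I * 8 + 1)), ?_, ?_⟩ <;>
      · simp only [hp, Polynomial.eval_add, Polynomial.eval_mul, Polynomial.eval_ofNat]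
        omega
    rw [hR.1]
    simp only [runFor_add]
    have s1 : runFor 1 (start A I.data) = PMF.pure ⟨[c₁, Cmd.seq (flipLoop K) c₂], σ⟩ := by
      simp [runFor, step, start, hA, hσ]
    have s2 : runFor 1 ⟨[Cmd.seq (flipLoop K) c₂], σ₁⟩ = PMF.pure ⟨[flipLoop K, c₂], σ₁⟩ := by
      simp [runFor, step]
    rw [s1, PMF.pure_bind, e1, PMF.pure_bind, s2, PMF.pure_bind,
      runFor_flipLoop K (len I) [c₂] σ₁ [] (by simp [hσ₁]) (by simp [hσ₁, hσx]) (by simp [hσ₁, hσx]),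
      PMF.bind_map, PMF.map_comp, PMF.map]
    refine PMF.ext fun c => ?_
    rw [PMF.bind_apply, PMF.bind_apply]
    refine tsum_congr fun w => ?_
    by_cases hw : w ∈ (coins (len I)).support
    · congr 1
      obtain ⟨u, hu, e⟩ := e2 w hw
      obtain ⟨R', rfl⟩ := Nat.exists_eq_add_of_le (hu.trans hR.2)
      simp only [Function.comp_apply]
      rw [runFor_add, e, PMF.pure_bind, runFor_halted]
    · simp [(PMF.apply_eq_zero_iff _ _).2 hw]
  refine ⟨A, ⟨p, fun n m G y => haltsWithin_of_runFor _ (main ⟨n, m, G, y⟩)⟩, fun I v => ?_⟩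
  rw [outputProb_eq_of_halts _ (main I), PMF.toOuterMeasure_map_apply, coins_toReal]
  refine Finset.expect_congr rfl fun ω _ => ?_
  simp [enc_bits_injective.eq_iff]

/-! ### The inverting algorithm -/

/-- The number of binary digits of `n`, and the power of two that exceeds `n`, for `n > 0`: the
result of `n` rounds of doubling, which stop once `n` is exceeded. -/
def lgPair (n : ℕ) : ℕ × ℕ :=
  (fun s : ℕ × ℕ => if decide (s.2 ≤ n) = true then (s.1 + 1, s.2 + s.2) else s)^[n] (0, 1)

/-- The number of binary digits of `n`. -/
def lg (n : ℕ) : ℕ := (lgPair n).1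

/-- What the algorithm works with: the number of vertices, the hyperedges, the output bits, and the
coins. -/
abbrev Ctx : Type := ℕ × List (List ℕ) × List Bool × List Bool

namespace Ctx

/-- The number of hyperedges. -/
def M (X : Ctx) : ℕ := X.2.1.length

/-- The `e`-th vertex of the `i`-th hyperedge. -/
def vtx (X : Ctx) (i e : ℕ) : ℕ := (X.2.1.getD i []).getD e 0

/-- The `i`-th output bit. -/
def bit (X : Ctx) (i : ℕ) : Bool := X.2.2.1.getD i false

/-- Membership of the vertex `u` in the `r`-th random set, whose characteristic function is read from
the first part of the coins. -/
def inSet (X : Ctx) (r u : ℕ) : Bool := X.2.2.2.getD (r * X.1 + u) false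

/-- The `c`-th coin (`c < 3`) of the `e`-th entry of the `x`-th hyperedge, from the second part of
the coins. -/
def coin (d : ℕ) (X : Ctx) (x c e : ℕ) : Bool :=
  X.2.2.2.getD (X.M * X.1 + (x * (3 * d) + (c * d + e))) false

/-- The coins for the distinguisher on the `b`-th batch, from the third part of the coins. -/
def runCoins (d : ℕ) (q : Polynomial ℕ) (X : Ctx) (b : ℕ) : List Bool :=
  (List.range (q.eval (X.1 + X.M))).map fun i =>
    X.2.2.2.getD (X.M * X.1 + (X.M * (3 * d) + (b * q.eval (X.1 + X.M) + i))) false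

/-- The coin that decides which of the two vertex classes holds ones. -/
def lastCoin (d : ℕ) (q : Polynomial ℕ) (X : Ctx) : Bool :=
  X.2.2.2.getD (X.M * X.1 + (X.M * (3 * d) + X.M * q.eval (X.1 + X.M))) false

end Ctx

/-- Whether the source vertex `v` and the label candidate `u` produce an entry of a simulated
hyperedge. Vertices below `k` are simulated by vertices from the set `T`, vertices above `k` by
themselves. The vertex `k` is simulated by itself, or, if `mix` is set, by either itself or `j`,
depending on the coin `c₂`. Every vertex is produced with the same probability. -/
def entryOk (T : ℕ → Bool) (k j : ℕ) (mix : Bool) (v u : ℕ) (c₀ c₁ c₂ : Bool) : Bool :=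
  if c₀ = true then
    (if c₁ = true then T u && v == (if (mix && c₂) = true then j else k) else T u && decide (k < v))
  else !c₁ && (T v && decide (u < k))

/-- The vertex of the simulated hyperedge that the source vertex `v` and the label candidate `u`
produce. -/
def entryLabel (k v u : ℕ) (c₀ c₁ : Bool) : ℕ :=
  if c₀ = true then (if c₁ = true then k else v) else u

namespace Ctx

/-- Whether the hyperedge `x` (as source) and the hyperedge `z` (for labels) produce a simulated
hyperedge. -/
def pairOk (d : ℕ) (X : Ctx) (r k j : ℕ) (mix : Bool) (x z : ℕ) : Bool :=
  (List.range d).all fun e => entryOk (X.inSet r) k j mix (X.vtx x e) (X.vtx z e)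
    (X.coin d x 0 e) (X.coin d x 1 e) (X.coin d x 2 e)

/-- The simulated hyperedge produced by the hyperedge `x` and the hyperedge `z`. -/
def pairEdge (d : ℕ) (X : Ctx) (k x z : ℕ) : List ℕ :=
  (List.range d).map fun e =>
    entryLabel k (X.vtx x e) (X.vtx z e) (X.coin d x 0 e) (X.coin d x 1 e)

/-- Those of `L` consecutive pairs of hyperedges, starting with `x` and `z`, that produce a simulated
hyperedge. -/
def selected (d : ℕ) (X : Ctx) (r k j : ℕ) (mix : Bool) (L x z : ℕ) : List ℕ :=
  (List.range L).filter fun i => X.pairOk d r k j mix (x + i) (z + i)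

/-- The instance that consists of the first `m` simulated hyperedges. -/
def simulated (d : ℕ) (X : Ctx) (k m : ℕ) (sel : List ℕ) (x z : ℕ) : Data :=
  Data.cons (enc X.1) (Data.cons
    (enc ((List.range m).map fun t => X.pairEdge d k (x + sel.getD t 0) (z + sel.getD t 0)))
    (enc ((List.range m).map fun t => X.bit (x + sel.getD t 0))))

/-- The verdict of the distinguisher on the `b`-th of `N` batches, which uses `L` hyperedges as
sources and `L` hyperedges for labels. -/
def batch (d : ℕ) (D : Cmd) (q : Polynomial ℕ) (X : Ctx) (N L m r k j : ℕ) (mix : Bool) (b : ℕ) :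
    Bool :=
  if decide (m ≤ (X.selected d r k j mix L (b * L) (N * L + b * L)).length) = true then
    tapeAccepts D (X.simulated d k m (X.selected d r k j mix L (b * L) (N * L + b * L))
      (b * L) (N * L + b * L)) (X.runCoins d q b)
  else false

/-- The number of batches on which the distinguisher accepts. -/
def count (d : ℕ) (D : Cmd) (q : Polynomial ℕ) (X : Ctx) (N L m r k j : ℕ) (mix : Bool) : ℕ :=
  ((List.range N).filter fun b => X.batch d D q N L m r k j mix b).length

/-- Whether the distinguisher accepts significantly less often when occurrences of `k` are mixed with
occurrences of `j`, judging from `p * p` batches for instances with `m` hyperedges. If the set has at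
least `n / 4` elements, then a trial succeeds with probability at least `1 / 16 ^ d`, and
`2 * 16 ^ d * m` trials suffice with a probability that is bounded below. -/
def exceeds (d : ℕ) (D : Cmd) (q : Polynomial ℕ) (X : Ctx) (p m r k j : ℕ) : Bool :=
  decide (X.count d D q (p * p) (2 * 16 ^ d * m) m r k j true + p * (8 * (d + 1) * lg X.1)
    < X.count d D q (p * p) (2 * 16 ^ d * m) m r k j false)

/-- Whether there are exactly as many hyperedges as the test with parameters `p` and `m` needs, and
one of the random sets makes it succeed. -/
def exceedsSome (d : ℕ) (D : Cmd) (q : Polynomial ℕ) (X : Ctx) (p m k j : ℕ) : Bool :=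
  (p * p * (4 * 16 ^ d * m) + 1 == X.M) &&
    (List.range (p * p)).any fun r => X.exceeds d D q p m r k j

/-- Statistical evidence that the vertices `k` and `j` carry different bits. -/
def statistical (d : ℕ) (D : Cmd) (q : Polynomial ℕ) (X : Ctx) (k j : ℕ) : Bool :=
  (List.range (X.M + 1)).any fun p => (List.range X.M).any fun m =>
    X.exceedsSome d D q p (m + 1) k j

/-- The vertex `v`, with `j` replaced by `k`. -/
def merge (k j v : ℕ) : ℕ := if (v == j) = true then k else v

/-- Whether the hyperedges `x` and `z` coincide when `j` is replaced by `k`, but have different output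
bits. -/
def clash (d : ℕ) (X : Ctx) (k j x z : ℕ) : Bool :=
  !(X.bit x == X.bit z) && (List.range d).all fun e => merge k j (X.vtx x e) == merge k j (X.vtx z e)

/-- Conclusive evidence that the vertices `k` and `j` carry different bits. -/
def conclusive (d : ℕ) (X : Ctx) (k j : ℕ) : Bool :=
  (List.range X.M).any fun x => (List.range X.M).any fun z => X.clash d k j x z

/-- Evidence that the vertices `k` and `j` carry different bits. Conclusive evidence suffices when
there are so many hyperedges that presumably all tuples occur. -/
def detected (d : ℕ) (D : Cmd) (q : Polynomial ℕ) (X : Ctx) (k j : ℕ) : Bool :=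
  if decide ((d + 4) * X.1 ^ (d + 1) ≤ X.M) = true then X.conclusive d k j
  else X.statistical d D q k j

/-- The string that the algorithm proposes. Vertices carry the same bit as the random vertex `v`, the
first one of the last hyperedge, if some vertex differs from both. No test uses this hyperedge, hence
`v` is independent of the statistical evidence. The last coin is the guess for the bit of `v`. -/
def invert (d : ℕ) (D : Cmd) (q : Polynomial ℕ) (X : Ctx) : List Bool :=
  (List.range X.1).map fun i =>
    if ((List.range X.1).any fun k => X.detected d D q k (X.vtx (X.M - 1) 0) &&
      X.detected d D q k i) = true then X.lastCoin d q else !X.lastCoin d q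

/-- All vertices are less than their number. -/
def Valid (X : Ctx) : Prop := ∀ l ∈ X.2.1, ∀ v ∈ l, v < X.1

theorem getD_mem_or {α : Type} (l : List α) (k : ℕ) (x : α) : l.getD k x ∈ l ∨ l.getD k x = x := by
  rcases lt_or_ge k l.length with h | h
  · left; rw [List.getD_eq_getElem _ _ h]; exact List.getElem_mem h
  · right; exact List.getD_eq_default _ _ h

theorem Valid.vtx_lt {X : Ctx} (h : X.Valid) (h0 : 0 < X.1) (i e : ℕ) : X.vtx i e < X.1 := by
  rw [vtx]
  rcases getD_mem_or (X.2.1.getD i []) e 0 with h1 | h1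
  · rcases getD_mem_or X.2.1 i [] with h2 | h2
    · exact h _ h2 _ h1
    · rw [h2] at h1
      simp at h1
  · rwa [h1]

end Ctx

/-! ### The inverting algorithm runs in polynomial time -/

section
variable {ι : Type} {sz : ι → ℕ} {a : ι → Data}

theorem lgPair_spec (n : ℕ) :
    (lgPair n).2 = 2 ^ (lgPair n).1 ∧ (n < (lgPair n).2) ∧ (lgPair n).2 ≤ 2 * n + 1 := by
  have h : ∀ m, let s := (fun s : ℕ × ℕ => if decide (s.2 ≤ n) = true then
      (s.1 + 1, s.2 + s.2) else s)^[m] (0, 1)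
      s.2 = 2 ^ s.1 ∧ (n < s.2 ∨ s.1 = m) ∧ s.2 ≤ 2 * n + 1 := by
    intro m
    induction m with
    | zero => simp
    | succ m ih =>
      simp only [Function.iterate_succ_apply'] at ih ⊢
      generalize (fun s : ℕ × ℕ => if decide (s.2 ≤ n) = true then
        (s.1 + 1, s.2 + s.2) else s)^[m] (0, 1) = s at ih ⊢
      obtain ⟨h1, h2, h3⟩ := ih
      by_cases hs : s.2 ≤ n
      · simp only [hs, decide_true, if_true]
        refine ⟨by rw [pow_succ, ← h1]; ring, Or.inr ?_, by omega⟩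
        rcases h2 with h2 | h2
        · omega
        · rw [h2]
      · simp only [hs, decide_false, Bool.false_eq_true, if_false]
        exact ⟨h1, Or.inl (by omega), h3⟩
  obtain ⟨h1, h2, h3⟩ := h n
  refine ⟨h1, ?_, h3⟩
  rcases h2 with h2 | h2
  · exact h2
  · change (lgPair n).1 = n at h2
    change (lgPair n).2 = 2 ^ (lgPair n).1 at h1
    rw [h1, h2]
    exact Nat.lt_two_pow_self

theorem lt_two_pow_lg (n : ℕ) : n < 2 ^ lg n := by
  have := lgPair_spec n
  rw [lg, ← this.1]
  exact this.2.1

theorem two_pow_lg_le {n : ℕ} (hn : 0 < n) : 2 ^ lg n ≤ 2 * n := by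
  obtain ⟨h1, h2, h3⟩ := lgPair_spec n
  rw [lg, ← h1]
  -- the only odd power of two is `1`
  rcases h : (lgPair n).1 with _ | l
  · rw [h1, h]; simp; omega
  · rw [h, pow_succ] at h1
    omega

theorem lg_le_self {n : ℕ} (hn : 0 < n) : lg n ≤ n := by
  have h1 := two_pow_lg_le hn
  have h2 : n < 2 ^ n := Nat.lt_two_pow_self
  have h3 : 2 ^ lg n < 2 ^ (n + 1) := by rw [pow_succ]; omega
  have := (Nat.pow_lt_pow_iff_right (by norm_num : 1 < 2)).1 h3
  omega

theorem PT.lg {n : ι → ℕ} (hn : PT sz a n) : PT sz a fun i => lg (n i) := by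
  refine PT.of_bdd ?_ (hn.bdd_nat.mono fun i => ?_)
  · have hstep : PT (fun z : {z : ι × (ℕ × ℕ) // z.2.1 < z.2.2 ∧ z.2.2 ≤ 2 * n z.1 + 1} => sz z.1.1)
        (fun z => Data.cons (a z.1.1) (enc z.1.2))
        fun z => if decide (z.1.2.2 ≤ n z.1.1) = true then (z.1.2.1 + 1, z.1.2.2 + z.1.2.2)
          else z.1.2 := by
      have hn' := hn.lift (fun z : {z : ι × (ℕ × ℕ) // z.2.1 < z.2.2 ∧ z.2.2 ≤ 2 * n z.1 + 1} =>
        z.1.1) (b := fun z => Data.cons (a z.1.1) (enc z.1.2)) RT.id.hd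
      have hb : Bdd (fun z : {z : ι × (ℕ × ℕ) // z.2.1 < z.2.2 ∧ z.2.2 ≤ 2 * n z.1 + 1} => sz z.1.1)
          fun z => z.1.2.2 :=
        (((Bdd.const 2).mul hn'.bdd_nat).add (Bdd.const 1)).mono fun z => z.2.2
      have h1 : PT (fun z : {z : ι × (ℕ × ℕ) // z.2.1 < z.2.2 ∧ z.2.2 ≤ 2 * n z.1 + 1} => sz z.1.1)
          (fun z => Data.cons (a z.1.1) (enc z.1.2)) fun z => z.1.2.1 :=
        PT.of_bdd RT.id.tl.hd (hb.mono fun z => z.2.1.le)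
      have h2 : PT (fun z : {z : ι × (ℕ × ℕ) // z.2.1 < z.2.2 ∧ z.2.2 ≤ 2 * n z.1 + 1} => sz z.1.1)
          (fun z => Data.cons (a z.1.1) (enc z.1.2)) fun z => z.1.2.2 :=
        PT.of_bdd RT.id.tl.tl hb
      exact PT.ite (h2.le hn') (h1.succ.pair (h2.add h2)) (h1.pair h2)
    have := RT.iterate (s₀ := fun _ => ((0, 1) : ℕ × ℕ)) (f := fun i (s : ℕ × ℕ) =>
      if decide (s.2 ≤ n i) = true then (s.1 + 1, s.2 + s.2) else s)
      (fun i s => s.1 < s.2 ∧ s.2 ≤ 2 * n i + 1) hn (RT.const _) (fun i => by simp)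
      (fun i s hs => by
        by_cases h : s.2 ≤ n i
        · simp only [h, decide_true, if_true]
          omega
        · simpa [h] using hs) hstep.1
    exact this.hd
  · rcases Nat.eq_zero_or_pos (n i) with h | h
    · rw [h]; rfl
    · exact lg_le_self h

namespace Ctx
variable {X : ι → Ctx}

theorem PT_n (hX : PT sz a X) : PT sz a fun i => (X i).1 := hX.fst

theorem PT_M (hX : PT sz a X) : PT sz a fun i => (X i).M := hX.snd.fst.length

theorem PT_vtx (hX : PT sz a X) {x e : ι → ℕ} (hx : PT sz a x) (he : PT sz a e) :
    PT sz a fun i => (X i).vtx (x i) (e i) :=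
  PT.getD rfl (PT.getD rfl hX.snd.fst hx) he

theorem PT_bit (hX : PT sz a X) {x : ι → ℕ} (hx : PT sz a x) :
    PT sz a fun i => (X i).bit (x i) :=
  PT.getD rfl hX.snd.snd.fst hx

theorem PT_inSet (hX : PT sz a X) {r u : ι → ℕ} (hr : PT sz a r) (hu : PT sz a u) :
    PT sz a fun i => (X i).inSet (r i) (u i) :=
  PT.getD rfl hX.snd.snd.snd ((hr.mul hX.fst).add hu)

theorem PT_coin (d : ℕ) (hX : PT sz a X) {x c e : ι → ℕ} (hx : PT sz a x) (hc : PT sz a c)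
    (he : PT sz a e) : PT sz a fun i => (X i).coin d (x i) (c i) (e i) :=
  PT.getD rfl hX.snd.snd.snd (((PT_M hX).mul hX.fst).add ((hx.mul (PT.const (3 * d))).add
    ((hc.mul (PT.const d)).add he)))

theorem PT_runCoins (d : ℕ) (q : Polynomial ℕ) (hX : PT sz a X) {b : ι → ℕ} (hb : PT sz a b) :
    PT sz a fun i => (X i).runCoins d q (b i) := by
  have hq : PT sz a fun i => q.eval ((X i).1 + (X i).M) := (hX.fst.add (PT_M hX)).eval q
  exact hq.range.map (f := fun i s => (X i).2.2.2.getD ((X i).M * (X i).1 + ((X i).M * (3 * d) +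
    (b i * q.eval ((X i).1 + (X i).M) + s))) false)
    (PT.getD rfl hX.snd.snd.snd.inside ((((PT_M hX).mul hX.fst).inside).add
      (((PT_M hX).mul (PT.const (3 * d))).inside.add ((hb.mul hq).inside.add hq.range.elem))))

theorem PT_lastCoin (d : ℕ) (q : Polynomial ℕ) (hX : PT sz a X) :
    PT sz a fun i => (X i).lastCoin d q :=
  PT.getD rfl hX.snd.snd.snd (((PT_M hX).mul hX.fst).add (((PT_M hX).mul (PT.const (3 * d))).add
    ((PT_M hX).mul ((hX.fst.add (PT_M hX)).eval q))))

theorem PT_pairOk (d : ℕ) (hX : PT sz a X) {r k j x z : ι → ℕ} {mix : ι → Bool} (hr : PT sz a r)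
    (hk : PT sz a k) (hj : PT sz a j) (hmix : PT sz a mix) (hx : PT sz a x) (hz : PT sz a z) :
    PT sz a fun i => (X i).pairOk d (r i) (k i) (j i) (mix i) (x i) (z i) := by
  have hd : PT sz a fun _ => List.range d := (PT.const d).range
  have he := hd.elem
  have hX' := hX.inside (l := fun _ => List.range d)
  have hx' := hx.inside (l := fun _ => List.range d)
  have hz' := hz.inside (l := fun _ => List.range d)
  have hr' := hr.inside (l := fun _ => List.range d)
  have hk' := hk.inside (l := fun _ => List.range d)
  have hj' := hj.inside (l := fun _ => List.range d)
  have hm' := hmix.inside (l := fun _ => List.range d)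
  have hv := PT_vtx hX' hx' he
  have hu := PT_vtx hX' hz' he
  have hTu := PT_inSet hX' hr' hu
  refine hd.all (f := fun i e => entryOk ((X i).inSet (r i)) (k i) (j i) (mix i)
    ((X i).vtx (x i) e) ((X i).vtx (z i) e) ((X i).coin d (x i) 0 e) ((X i).coin d (x i) 1 e)
      ((X i).coin d (x i) 2 e)) ?_
  exact PT.ite (PT_coin d hX' hx' (PT.const 0) he)
    (PT.ite (PT_coin d hX' hx' (PT.const 1) he)
      (hTu.and (hv.beq_nat (PT.ite (hm'.and (PT_coin d hX' hx' (PT.const 2) he)) hj' hk')))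
      (hTu.and (hk'.lt hv)))
    ((PT_coin d hX' hx' (PT.const 1) he).not.and ((PT_inSet hX' hr' hv).and (hu.lt hk')))

theorem PT_pairEdge (d : ℕ) (hX : PT sz a X) {k x z : ι → ℕ}
    (hk : PT sz a k) (hx : PT sz a x) (hz : PT sz a z) :
    PT sz a fun i => (X i).pairEdge d (k i) (x i) (z i) := by
  have hd : PT sz a fun _ => List.range d := (PT.const d).range
  have he := hd.elem
  have hX' := hX.inside (l := fun _ => List.range d)
  have hx' := hx.inside (l := fun _ => List.range d)
  have hz' := hz.inside (l := fun _ => List.range d)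
  exact hd.map (f := fun i e => entryLabel (k i) ((X i).vtx (x i) e) ((X i).vtx (z i) e)
    ((X i).coin d (x i) 0 e) ((X i).coin d (x i) 1 e))
    (PT.ite (PT_coin d hX' hx' (PT.const 0) he) (PT.ite (PT_coin d hX' hx' (PT.const 1) he)
      hk.inside (PT_vtx hX' hx' he)) (PT_vtx hX' hz' he))

theorem PT_selected (d : ℕ) (hX : PT sz a X) {r k j L x z : ι → ℕ} {mix : ι → Bool}
    (hr : PT sz a r) (hk : PT sz a k) (hj : PT sz a j) (hmix : PT sz a mix) (hL : PT sz a L)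
    (hx : PT sz a x) (hz : PT sz a z) :
    PT sz a fun i => (X i).selected d (r i) (k i) (j i) (mix i) (L i) (x i) (z i) :=
  hL.range.filter (f := fun i t => (X i).pairOk d (r i) (k i) (j i) (mix i) (x i + t) (z i + t))
    (PT_pairOk d hX.inside hr.inside hk.inside hj.inside hmix.inside (hx.inside.add hL.range.elem)
      (hz.inside.add hL.range.elem))

theorem PT_simulated (d : ℕ) (hX : PT sz a X) {k m x z : ι → ℕ} {sel : ι → List ℕ}
    (hk : PT sz a k) (hm : PT sz a m) (hs : PT sz a sel) (hx : PT sz a x) (hz : PT sz a z) :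
    PT sz a fun i => (X i).simulated d (k i) (m i) (sel i) (x i) (z i) := by
  have hi := PT.getD rfl (x := 0) (hs.inside (l := fun i => List.range (m i))) hm.range.elem
  exact hX.fst.data.dataCons (PT.dataCons
    (hm.range.map (f := fun i t => (X i).pairEdge d (k i) (x i + (sel i).getD t 0)
      (z i + (sel i).getD t 0))
      (PT_pairEdge d hX.inside hk.inside (hx.inside.add hi) (hz.inside.add hi))).data
    (hm.range.map (f := fun i t => (X i).bit (x i + (sel i).getD t 0))
      (PT_bit hX.inside (hx.inside.add hi))).data)

theorem simulated_eq_encodeInstance (d : ℕ) {X : Ctx} (hX : X.Valid) {k m : ℕ} (hk : k < X.1)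
    (sel : List ℕ) (x z : ℕ) : ∃ (G : Hypergraph X.1 m d) (y : Fin m → Bool),
      X.simulated d k m sel x z = encodeInstance G y := by
  have hlab : ∀ x z e, entryLabel k (X.vtx x e) (X.vtx z e) (X.coin d x 0 e) (X.coin d x 1 e)
      < X.1 := by
    intro x z e
    have := fun i => hX.vtx_lt (by omega) i e
    unfold entryLabel
    split_ifs
    · exact hk
    · exact this x
    · exact this z
  refine ⟨fun t e => ⟨_, hlab (x + sel.getD t 0) (z + sel.getD t 0) e⟩,
    fun t => X.bit (x + sel.getD t 0), ?_⟩
  simp only [simulated, encodeInstance, pairEdge, Data.ofBits]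
  have hlist : ∀ {α : Type} [Enc α] (m : ℕ) (f : ℕ → α),
      enc ((List.range m).map f) = Data.ofList (List.ofFn fun t : Fin m => enc (f t)) := by
    intro α _ m f
    change Data.ofList (List.map enc _) = _
    rw [List.ofFn_eq_map, ← List.map_coe_finRange_eq_range, List.map_map, List.map_map]
    rfl
  rw [hlist, hlist]
  congr 2
  congr 1
  congr 1
  funext t
  rw [hlist]
  rfl

theorem PT_batch {d : ℕ} {D : Cmd} {q : Polynomial ℕ}
    (hD : ∀ (n m : ℕ) (G : Hypergraph n m d) (y : Fin m → Bool),
      HaltsWithin D (encodeInstance G y) (q.eval (n + m)))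
    (hX : PT sz a X) (hV : ∀ i, (X i).Valid) {N L m r k j b : ι → ℕ} {mix : ι → Bool}
    (hN : PT sz a N) (hL : PT sz a L) (hm : PT sz a m) (hr : PT sz a r) (hk : PT sz a k)
    (hj : PT sz a j) (hmix : PT sz a mix) (hb : PT sz a b) (hkn : ∀ i, k i < (X i).1)
    (hmM : ∀ i, m i ≤ (X i).M) :
    PT sz a fun i => (X i).batch d D q (N i) (L i) (m i) (r i) (k i) (j i) (mix i) (b i) := by
  have hx := hb.mul hL
  have hz := (hN.mul hL).add hx
  have hs := PT_selected d hX hr hk hj hmix hL hx hz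
  refine PT.ite (hm.le hs.length) (PT.tapeAccepts hD (PT_simulated d hX hk hm hs hx hz)
    (PT_runCoins d q hX hb) fun i => ?_) (PT.const false)
  obtain ⟨G, y, h⟩ := simulated_eq_encodeInstance d (hV i) (m := m i) (hkn i)
    ((X i).selected d (r i) (k i) (j i) (mix i) (L i) (b i * L i) (N i * L i + b i * L i))
    (b i * L i) (N i * L i + b i * L i)
  refine ⟨_, _, G, y, h, ?_⟩
  rw [runCoins, List.length_map, List.length_range]
  exact eval_mono q (Nat.add_le_add_left (hmM i) _)

theorem PT_count {d : ℕ} {D : Cmd} {q : Polynomial ℕ}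
    (hD : ∀ (n m : ℕ) (G : Hypergraph n m d) (y : Fin m → Bool),
      HaltsWithin D (encodeInstance G y) (q.eval (n + m)))
    (hX : PT sz a X) (hV : ∀ i, (X i).Valid) {N L m r k j : ι → ℕ} (mix : Bool)
    (hN : PT sz a N) (hL : PT sz a L) (hm : PT sz a m) (hr : PT sz a r) (hk : PT sz a k)
    (hj : PT sz a j) (hkn : ∀ i, k i < (X i).1) (hmM : ∀ i, m i ≤ (X i).M) :
    PT sz a fun i => (X i).count d D q (N i) (L i) (m i) (r i) (k i) (j i) mix :=
  (hN.range.filter (f := fun i b => (X i).batch d D q (N i) (L i) (m i) (r i) (k i) (j i) mix b)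
    (PT_batch hD hX.inside (fun z => hV z.1.1) hN.inside hL.inside hm.inside hr.inside hk.inside
      hj.inside (PT.const mix) hN.range.elem (fun z => hkn z.1.1) fun z => hmM z.1.1)).length

theorem PT_exceedsSome {d : ℕ} {D : Cmd} {q : Polynomial ℕ}
    (hD : ∀ (n m : ℕ) (G : Hypergraph n m d) (y : Fin m → Bool),
      HaltsWithin D (encodeInstance G y) (q.eval (n + m)))
    (hX : PT sz a X) (hV : ∀ i, (X i).Valid) {p m k j : ι → ℕ} (hp : PT sz a p) (hm : PT sz a m)
    (hk : PT sz a k) (hj : PT sz a j) (hkn : ∀ i, k i < (X i).1) (hmM : ∀ i, m i ≤ (X i).M) :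
    PT sz a fun i => (X i).exceedsSome d D q (p i) (m i) (k i) (j i) := by
  have hpp := hp.mul hp
  have hr := hpp.range.elem
  refine (((hpp.mul ((PT.const (4 * 16 ^ d)).mul hm)).succ).beq_nat (PT_M hX)).and
    (hpp.range.any (f := fun i r => (X i).exceeds d D q (p i) (m i) r (k i) (j i)) ?_)
  have hc := fun mix => PT_count hD hX.inside (fun z => hV z.1.1) mix
    hpp.inside ((PT.const (2 * 16 ^ d)).mul hm).inside hm.inside hr hk.inside
    hj.inside (fun z => hkn _) fun z => hmM z.1.1
  exact ((hc true).add (hp.inside.mul ((PT.const (8 * (d + 1))).mul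
    hX.fst.lg.inside))).lt (hc false)

theorem PT_statistical {d : ℕ} {D : Cmd} {q : Polynomial ℕ}
    (hD : ∀ (n m : ℕ) (G : Hypergraph n m d) (y : Fin m → Bool),
      HaltsWithin D (encodeInstance G y) (q.eval (n + m)))
    (hX : PT sz a X) (hV : ∀ i, (X i).Valid) {k j : ι → ℕ} (hk : PT sz a k) (hj : PT sz a j)
    (hkn : ∀ i, k i < (X i).1) :
    PT sz a fun i => (X i).statistical d D q (k i) (j i) := by
  have inner : ∀ {κ : Type} {sz : κ → ℕ} {a : κ → Data} {X : κ → Ctx} {p k j : κ → ℕ},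
      PT sz a X → (∀ i, (X i).Valid) → PT sz a p → PT sz a k → PT sz a j → (∀ i, k i < (X i).1) →
      PT sz a fun i => (List.range (X i).M).any fun m =>
        (X i).exceedsSome d D q (p i) (m + 1) (k i) (j i) := by
    intro κ sz a X p k j hX hV hp hk hj hkn
    exact (PT_M hX).range.any (f := fun i m => (X i).exceedsSome d D q (p i) (m + 1) (k i) (j i))
      (PT_exceedsSome hD hX.inside (fun z => hV _) hp.inside (PT_M hX).range.elem.succ hk.inside
        hj.inside (fun z => hkn _) fun z => List.mem_range.1 z.2)
  exact (PT_M hX).succ.range.any (f := fun i p => (List.range (X i).M).any fun m =>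
    (X i).exceedsSome d D q p (m + 1) (k i) (j i))
    (inner hX.inside (fun z => hV _) (PT_M hX).succ.range.elem hk.inside hj.inside fun z => hkn _)

theorem PT_merge {k j v : ι → ℕ} (hk : PT sz a k) (hj : PT sz a j) (hv : PT sz a v) :
    PT sz a fun i => merge (k i) (j i) (v i) :=
  PT.ite (hv.beq_nat hj) hk hv

theorem PT_clash (d : ℕ) (hX : PT sz a X) {k j x z : ι → ℕ} (hk : PT sz a k) (hj : PT sz a j)
    (hx : PT sz a x) (hz : PT sz a z) :
    PT sz a fun i => (X i).clash d (k i) (j i) (x i) (z i) := by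
  have hd : PT sz a fun _ => List.range d := (PT.const d).range
  exact ((PT_bit hX hx).beq_bool (PT_bit hX hz)).not.and (hd.all (f := fun i e =>
    merge (k i) (j i) ((X i).vtx (x i) e) == merge (k i) (j i) ((X i).vtx (z i) e))
    ((PT_merge hk.inside hj.inside (PT_vtx hX.inside hx.inside hd.elem)).beq_nat
      (PT_merge hk.inside hj.inside (PT_vtx hX.inside hz.inside hd.elem))))

theorem PT_conclusive (d : ℕ) (hX : PT sz a X) {k j : ι → ℕ} (hk : PT sz a k) (hj : PT sz a j) :
    PT sz a fun i => (X i).conclusive d (k i) (j i) := by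
  have inner : ∀ {κ : Type} {sz : κ → ℕ} {a : κ → Data} {X : κ → Ctx} {k j x : κ → ℕ},
      PT sz a X → PT sz a k → PT sz a j → PT sz a x →
      PT sz a fun i => (List.range (X i).M).any fun z => (X i).clash d (k i) (j i) (x i) z := by
    intro κ sz a X k j x hX hk hj hx
    exact (PT_M hX).range.any (f := fun i z => (X i).clash d (k i) (j i) (x i) z)
      (PT_clash d hX.inside hk.inside hj.inside hx.inside (PT_M hX).range.elem)
  exact (PT_M hX).range.any (f := fun i x => (List.range (X i).M).any fun z =>
    (X i).clash d (k i) (j i) x z) (inner hX.inside hk.inside hj.inside (PT_M hX).range.elem)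

theorem PT_detected {d : ℕ} {D : Cmd} {q : Polynomial ℕ}
    (hD : ∀ (n m : ℕ) (G : Hypergraph n m d) (y : Fin m → Bool),
      HaltsWithin D (encodeInstance G y) (q.eval (n + m)))
    (hX : PT sz a X) (hV : ∀ i, (X i).Valid) {k j : ι → ℕ} (hk : PT sz a k) (hj : PT sz a j)
    (hkn : ∀ i, k i < (X i).1) :
    PT sz a fun i => (X i).detected d D q (k i) (j i) := by
  have hpow : PT sz a fun i => (d + 4) * (X i).1 ^ (d + 1) := by
    refine (hX.fst.eval (Polynomial.C (d + 4) * Polynomial.X ^ (d + 1))).congr fun i => ?_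
    rw [Polynomial.eval_mul, Polynomial.eval_C, Polynomial.eval_pow, Polynomial.eval_X]
  exact PT.ite (hpow.le (PT_M hX)) (PT_conclusive d hX hk hj) (PT_statistical hD hX hV hk hj hkn)

theorem PT_invert {d : ℕ} {D : Cmd} {q : Polynomial ℕ}
    (hD : ∀ (n m : ℕ) (G : Hypergraph n m d) (y : Fin m → Bool),
      HaltsWithin D (encodeInstance G y) (q.eval (n + m)))
    (hX : PT sz a X) (hV : ∀ i, (X i).Valid) : PT sz a fun i => (X i).invert d D q := by
  have inner : ∀ {κ : Type} {sz : κ → ℕ} {a : κ → Data} {X : κ → Ctx} {t : κ → ℕ},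
      PT sz a X → (∀ i, (X i).Valid) → PT sz a t →
      PT sz a fun i => (List.range (X i).1).any fun k =>
        (X i).detected d D q k ((X i).vtx ((X i).M - 1) 0) && (X i).detected d D q k (t i) := by
    intro κ sz a X t hX hV ht
    have hv := PT_vtx hX ((PT_M hX).sub (PT.const 1)) (PT.const 0)
    have hk := (PT_n hX).range.elem
    exact (PT_n hX).range.any (f := fun i k => (X i).detected d D q k ((X i).vtx ((X i).M - 1) 0) &&
      (X i).detected d D q k (t i))
      ((PT_detected hD hX.inside (fun z => hV _) hk hv.inside fun z => List.mem_range.1 z.2).and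
        (PT_detected hD hX.inside (fun z => hV _) hk ht.inside fun z => List.mem_range.1 z.2))
  have hl := (PT_lastCoin d q hX).inside (l := fun i => List.range (X i).1)
  exact (PT_n hX).range.map (f := fun i t => if ((List.range (X i).1).any fun k =>
    (X i).detected d D q k ((X i).vtx ((X i).M - 1) 0) && (X i).detected d D q k t) = true
      then (X i).lastCoin d q else !(X i).lastCoin d q)
    (PT.ite (inner hX.inside (fun z => hV _) (PT_n hX).range.elem) hl hl.not)

end Ctx
end

/-! ### The inverting algorithm as a program -/

/-- The hyperedges as lists of numbers. -/
def edgeList {n m d : ℕ} (G : Hypergraph n m d) : List (List ℕ) :=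
  List.ofFn fun i => List.ofFn fun e => (G i e : ℕ)

theorem enc_ofFn {α : Type} [Enc α] {n : ℕ} (f : Fin n → α) :
    enc (List.ofFn f) = Data.ofList (List.ofFn fun i => enc (f i)) := by
  change Data.ofList (List.map enc _) = _
  rw [List.map_ofFn]
  rfl

theorem Inst.data_eq {d : ℕ} (I : Inst d) :
    I.data = enc (I.n, edgeList I.G, List.ofFn I.y) := by
  simp only [enc_prod, edgeList, enc_ofFn]
  rfl

/-- The context of the algorithm on an instance, with coins `w`. -/
def Inst.ctx {d : ℕ} (I : Inst d) (w : List Bool) : Ctx := (I.n, edgeList I.G, List.ofFn I.y, w)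

/-- The number of coins that the algorithm flips. -/
def Inst.numCoins {d : ℕ} (q : Polynomial ℕ) (I : Inst d) : ℕ :=
  I.m * I.n + (I.m * (3 * d) + I.m * q.eval (I.n + I.m)) + 1

theorem Inst.PT_data (d : ℕ) :
    PT (Inst.sz (d := d)) Inst.data fun I => (I.n, edgeList I.G, List.ofFn I.y) := by
  refine ⟨RT.id.congr fun I => I.data_eq, ?_⟩
  have hn : Bdd (Inst.sz (d := d)) fun I => I.n := Bdd.self.mono fun I => Nat.le_add_right _ _
  have hm : Bdd (Inst.sz (d := d)) fun I => I.m := Bdd.self.mono fun I => Nat.le_add_left _ _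
  have h1 := ((Bdd.const 2).mul hn).add (Bdd.const 1)
  have hE : Bdd (Inst.sz (d := d)) fun I => (enc (edgeList I.G)).size := by
    refine ((hm.mul ((((Bdd.const d).mul (h1.add (Bdd.const 1))).add (Bdd.const 1)).add
      (Bdd.const 1))).add (Bdd.const 1)).mono fun I => ?_
    refine (size_enc_list_le (B := d * (2 * I.n + 1 + 1) + 1) _ fun l hl => ?_).trans
      (by simp [edgeList])
    obtain ⟨i, rfl⟩ := (List.mem_ofFn' _ _).1 hl
    refine (size_enc_list_le (B := 2 * I.n + 1) _ fun v hv => ?_).trans (by simp)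
    obtain ⟨e, rfl⟩ := (List.mem_ofFn' _ _).1 hv
    have := (I.G i e).2
    change (enc (I.G i e : ℕ)).size ≤ _
    rw [size_enc_nat]
    omega
  have hY : Bdd (Inst.sz (d := d)) fun I => (enc (List.ofFn I.y)).size := by
    refine ((hm.mul (Bdd.const 4)).add (Bdd.const 1)).mono fun I => ?_
    exact (size_enc_list_le (B := 3) _ fun b _ => size_enc_bool b).trans (by simp)
  refine ((h1.add (hE.add hY)).add (Bdd.const 2)).mono fun I => ?_
  simp only [enc_prod, Data.size_cons, size_enc_nat]
  omega

theorem edgeList_valid {n m d : ℕ} (G : Hypergraph n m d) : ∀ l ∈ edgeList G, ∀ v ∈ l, v < n := by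
  intro l hl v hv
  obtain ⟨i, rfl⟩ := (List.mem_ofFn' _ _).1 hl
  obtain ⟨e, rfl⟩ := (List.mem_ofFn' _ _).1 hv
  exact (G i e).2

/-- The inverting algorithm is an efficient program. -/
theorem exists_inverter {d : ℕ} {D : Cmd} {q : Polynomial ℕ}
    (hD : ∀ (n m : ℕ) (G : Hypergraph n m d) (y : Fin m → Bool),
      HaltsWithin D (encodeInstance G y) (q.eval (n + m))) :
    ∃ A : Cmd, Efficient d A ∧ ∀ (I : Inst d) (s : Fin I.n → Bool),
      outputProb A (encodeInstance I.G I.y) (Data.ofBits s)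
        = 𝔼 ω : Fin (I.numCoins q) → Bool,
          if (I.ctx (List.ofFn ω)).invert d D q = List.ofFn s then (1 : ℝ) else 0 := by
  have hI := Inst.PT_data d
  have hn : PT (Inst.sz (d := d)) Inst.data fun I => I.n := hI.fst
  have hm : PT (Inst.sz (d := d)) Inst.data fun I => I.m :=
    hI.snd.snd.length.congr fun I => by simp
  have hlen : PT (Inst.sz (d := d)) Inst.data fun I => I.numCoins q :=
    ((hm.mul hn).add ((hm.mul (PT.const (3 * d))).add (hm.mul ((hn.add hm).eval q)))).succ
  have hX : PT (fun z : {z : Inst d × List Bool // z.2.length = z.1.numCoins q} => z.1.1.sz)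
      (fun z => Data.cons z.1.1.data (enc z.1.2)) fun z => z.1.1.ctx z.1.2 := by
    have h1 := hI.lift (fun z : {z : Inst d × List Bool // z.2.length = z.1.numCoins q} => z.1.1)
      (b := fun z => Data.cons z.1.1.data (enc z.1.2)) RT.id.hd
    have h2 : PT (fun z : {z : Inst d × List Bool // z.2.length = z.1.numCoins q} => z.1.1.sz)
        (fun z => Data.cons z.1.1.data (enc z.1.2)) fun z => z.1.2 := by
      refine ⟨RT.id.tl, ?_⟩
      refine (((hlen.bdd_nat.reindex fun z : {z : Inst d × List Bool //
        z.2.length = z.1.numCoins q} => z.1.1).mul (Bdd.const 4)).add (Bdd.const 1)).mono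
          fun z => ?_
      rw [← z.2]
      exact size_enc_list_le (B := 3) _ fun b _ => size_enc_bool b
    exact h1.fst.pair (h1.snd.fst.pair (h1.snd.snd.pair h2))
  obtain ⟨A, hA, h⟩ := exists_efficient_of_PT hlen (f := fun I w => (I.ctx w).invert d D q)
    (Ctx.PT_invert hD hX fun z => edgeList_valid z.1.1.G)
  refine ⟨A, hA, fun I s => ?_⟩
  rw [← h I (List.ofFn s), enc_ofFn]
  rfl

/-! ### Probabilities over finite sample spaces -/

open Classical in
/-- The probability of an event under the uniform distribution. -/
def prob {Ω : Type} [Fintype Ω] (p : Ω → Prop) : ℝ := 𝔼 ω, if p ω then (1 : ℝ) else 0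

section prob
variable {Ω Ω' : Type} [Fintype Ω] [Fintype Ω'] {p q : Ω → Prop}

theorem prob_eq_expect [DecidablePred p] : prob p = 𝔼 ω, if p ω then (1 : ℝ) else 0 := by
  unfold prob
  exact Finset.expect_congr rfl fun ω _ => by congr

theorem prob_nonneg : 0 ≤ prob p := by
  classical
  rw [prob_eq_expect]
  exact Finset.expect_nonneg fun ω _ => by split_ifs <;> norm_num

theorem prob_mono (h : ∀ ω, p ω → q ω) : prob p ≤ prob q := by
  classical
  rw [prob_eq_expect, prob_eq_expect]
  refine Finset.expect_le_expect fun ω _ => ?_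
  by_cases hp : p ω
  · simp [hp, h ω hp]
  · simp only [hp, if_false]
    split_ifs <;> norm_num

theorem prob_congr (h : ∀ ω, p ω ↔ q ω) : prob p = prob q :=
  le_antisymm (prob_mono fun ω => (h ω).1) (prob_mono fun ω => (h ω).2)

theorem prob_or_le : prob (fun ω => p ω ∨ q ω) ≤ prob p + prob q := by
  classical
  rw [prob_eq_expect, prob_eq_expect, prob_eq_expect, ← Finset.expect_add_distrib]
  refine Finset.expect_le_expect fun ω _ => ?_
  by_cases hp : p ω <;> by_cases hq : q ω <;> simp [hp, hq]

theorem prob_le_of_imp_or {r : Ω → Prop} (h : ∀ ω, r ω → p ω ∨ q ω) : prob r ≤ prob p + prob q :=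
  (prob_mono h).trans prob_or_le

theorem prob_exists_le {ι : Type} (S : Finset ι) (e : ι → Ω → Prop) :
    prob (fun ω => ∃ i ∈ S, e i ω) ≤ ∑ i ∈ S, prob (e i) := by
  classical
  simp only [prob_eq_expect]
  rw [← Finset.expect_sum_comm]
  refine Finset.expect_le_expect fun ω _ => ?_
  split_ifs with h
  · obtain ⟨i, hi, h⟩ := h
    refine le_trans (le_of_eq (by simp [h])) (Finset.single_le_sum
      (f := fun i => if e i ω then (1 : ℝ) else 0) (fun j _ => ?_) hi)
    split_ifs <;> norm_num
  · exact Finset.sum_nonneg fun j _ => by split_ifs <;> norm_num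

theorem prob_true [Nonempty Ω] : prob (fun _ : Ω => True) = 1 := by
  classical
  rw [prob_eq_expect]
  simp

theorem prob_le_one [Nonempty Ω] : prob p ≤ 1 :=
  (prob_mono fun _ _ => trivial).trans prob_true.le

theorem prob_add_prob_not [Nonempty Ω] : prob p + prob (fun ω => ¬p ω) = 1 := by
  classical
  rw [prob_eq_expect, prob_eq_expect, ← Finset.expect_add_distrib, ← prob_true (Ω := Ω),
    prob_eq_expect]
  refine Finset.expect_congr rfl fun ω _ => ?_
  by_cases hp : p ω <;> simp [hp]

theorem expect_prod (f : Ω × Ω' → ℝ) : 𝔼 z, f z = 𝔼 x, 𝔼 y, f (x, y) := by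
  rw [← Finset.univ_product_univ, Finset.expect_product]

theorem expect_comm (f : Ω → Ω' → ℝ) : 𝔼 x, 𝔼 y, f x y = 𝔼 y, 𝔼 x, f x y :=
  Finset.expect_comm _ _ _

theorem prob_prod (p : Ω × Ω' → Prop) : prob p = 𝔼 x, prob fun y => p (x, y) := by
  classical
  rw [prob_eq_expect, expect_prod]
  exact Finset.expect_congr rfl fun x _ => by rw [prob_eq_expect]

theorem expect_le_of_forall_le [Nonempty Ω] {f : Ω → ℝ} {c : ℝ} (h : ∀ ω, f ω ≤ c) :
    𝔼 ω, f ω ≤ c :=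
  (Finset.expect_le_expect fun ω _ => h ω).trans (le_of_eq (Fintype.expect_const c))

theorem le_expect_of_forall_le [Nonempty Ω] {f : Ω → ℝ} {c : ℝ} (h : ∀ ω, c ≤ f ω) :
    c ≤ 𝔼 ω, f ω :=
  (le_of_eq (Fintype.expect_const c).symm).trans (Finset.expect_le_expect fun ω _ => h ω)

theorem prob_prod_le [Nonempty Ω] {p : Ω × Ω' → Prop} {c : ℝ}
    (h : ∀ x, prob (fun y => p (x, y)) ≤ c) : prob p ≤ c := by
  rw [prob_prod]
  exact expect_le_of_forall_le h

/-- An exponential Markov inequality. -/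
theorem prob_le_expect_exp {f : Ω → ℝ} {t : ℝ} : prob (fun ω => t ≤ f ω) ≤
    Real.exp (-t) * 𝔼 ω, Real.exp (f ω) := by
  classical
  rw [prob_eq_expect, Finset.mul_expect]
  refine Finset.expect_le_expect fun ω _ => ?_
  rw [← Real.exp_add]
  split_ifs with h
  · exact Real.one_le_exp (by linarith)
  · positivity

/-- If the mean of a quantity with values at most `1` is large, then the quantity is often large. -/
theorem le_prob_of_le_expect [Nonempty Ω] {f : Ω → ℝ} {a : ℝ} (hf : ∀ ω, f ω ≤ 1) (ha : 0 ≤ a)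
    (h : 2 * a ≤ 𝔼 ω, f ω) : a ≤ prob fun ω => a ≤ f ω := by
  classical
  have h1 : 𝔼 ω, f ω ≤ 𝔼 ω, ((if a ≤ f ω then (1 : ℝ) else 0) + a) := by
    refine Finset.expect_le_expect fun ω _ => ?_
    split_ifs with hω
    · linarith [hf ω]
    · linarith
  rw [Finset.expect_add_distrib, Fintype.expect_const, ← prob_eq_expect] at h1
  linarith

/-- A map that turns the uniform distribution into the uniform distribution. -/
def UnifMap (Ψ : Ω → Ω') : Prop := ∀ f : Ω' → ℝ, 𝔼 ω, f (Ψ ω) = 𝔼 ω', f ω'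

theorem UnifMap.prob {Ψ : Ω → Ω'} (h : UnifMap Ψ) (p : Ω' → Prop) :
    RandomLocal.prob (fun ω => p (Ψ ω)) = RandomLocal.prob p := by
  classical
  rw [prob_eq_expect, prob_eq_expect]
  exact h fun ω' => if p ω' then 1 else 0

theorem UnifMap.of_bijective {Ψ : Ω → Ω'} (h : Function.Bijective Ψ) : UnifMap Ψ :=
  fun _ => Fintype.expect_bijective Ψ h _ _ fun _ => rfl

theorem UnifMap.comp {Ω'' : Type} [Fintype Ω''] {Ψ : Ω → Ω'} {Φ : Ω' → Ω''} (hΦ : UnifMap Φ)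
    (hΨ : UnifMap Ψ) : UnifMap fun ω => Φ (Ψ ω) :=
  fun f => (hΨ fun ω' => f (Φ ω')).trans (hΦ f)

theorem UnifMap.prodMap {A B : Type} [Fintype A] [Fintype B] {Ψ : Ω → Ω'} {Φ : A → B}
    (hΨ : UnifMap Ψ) (hΦ : UnifMap Φ) : UnifMap fun z : Ω × A => (Ψ z.1, Φ z.2) := by
  intro f
  rw [expect_prod, expect_prod]
  simp only
  rw [hΨ fun x => 𝔼 y, f (x, Φ y)]
  exact Finset.expect_congr rfl fun x _ => hΦ fun y => f (x, y)

theorem UnifMap.fst [Nonempty Ω'] : UnifMap fun z : Ω × Ω' => z.1 := by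
  intro f
  rw [expect_prod]
  exact Finset.expect_congr rfl fun x _ => Fintype.expect_const (f x)

/-- Distinct coordinates of a uniformly random function are uniform and independent. -/
theorem UnifMap.precomp {ι κ α : Type} [Fintype ι] [Fintype κ] [DecidableEq ι] [DecidableEq κ]
    [Fintype α] [Nonempty α] {φ : ι → κ} (hφ : Function.Injective φ) :
    UnifMap fun x : κ → α => fun i => x (φ i) := by
  classical
  let e : ι ≃ {k // k ∈ Set.range φ} := Equiv.ofInjective φ hφ
  let E : (κ → α) ≃ ({k // k ∈ Set.range φ} → α) × ({k // ¬ k ∈ Set.range φ} → α) :=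
    Equiv.piEquivPiSubtypeProd (fun k => k ∈ Set.range φ) fun _ => α
  have h1 : UnifMap (fun x => (E x).1) := UnifMap.fst.comp (UnifMap.of_bijective E.bijective)
  have h2 : UnifMap fun (y : {k // k ∈ Set.range φ} → α) (i : ι) => y (e i) :=
    UnifMap.of_bijective (e.arrowCongr (Equiv.refl α)).symm.bijective
  exact h2.comp h1

end prob

/-- The mean of a product of independent quantities. -/
theorem expect_prod_pi {ι α : Type} [Fintype ι] [DecidableEq ι] [Fintype α] (f : ι → α → ℝ) :
    𝔼 x : ι → α, ∏ i, f i (x i) = ∏ i, 𝔼 a, f i a := by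
  simp only [Fintype.expect_eq_sum_div_card]
  rw [Finset.prod_div_distrib, Finset.prod_univ_sum, Fintype.card_pi]
  simp [Fintype.piFinset_univ]

theorem prob_false {Ω : Type} [Fintype Ω] : prob (fun _ : Ω => False) = 0 := by
  classical
  rw [prob_eq_expect]
  simp

theorem prob_exists_le_mul {Ω ι : Type} [Fintype Ω] (S : Finset ι) (e : ι → Ω → Prop) {c : ℝ}
    (h : ∀ i ∈ S, prob (e i) ≤ c) : prob (fun ω => ∃ i ∈ S, e i ω) ≤ S.card * c :=
  (prob_exists_le S e).trans ((Finset.sum_le_sum h).trans (by simp))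

theorem prob_and_le {Ω : Type} [Fintype Ω] {a : Prop} {e : Ω → Prop} {c : ℝ} (hc : 0 ≤ c)
    (h : a → prob e ≤ c) : prob (fun ω => a ∧ e ω) ≤ c := by
  by_cases ha : a
  · exact (prob_mono fun ω hω => hω.2).trans (h ha)
  · exact (prob_mono (q := fun _ => False) fun ω hω => ha hω.1).trans (prob_false.trans_le hc)

/-- Independent trials. -/
theorem prob_forall_not {ι Ω : Type} [Fintype ι] [DecidableEq ι] [Fintype Ω] [Nonempty Ω]
    (e : Ω → Prop) :
    prob (fun ω : ι → Ω => ∀ i, ¬e (ω i)) = (1 - prob e) ^ Fintype.card ι := by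
  classical
  have h : 1 - prob e = 𝔼 ω, if ¬e ω then (1 : ℝ) else 0 := by
    have h' := prob_add_prob_not (p := e)
    rw [prob_eq_expect (p := fun ω => ¬e ω)] at h'
    linarith
  rw [h, ← Finset.card_univ, ← Finset.prod_const, ← expect_prod_pi fun (_ : ι) ω =>
    if ¬e ω then (1 : ℝ) else 0, prob_eq_expect]
  refine Finset.expect_congr rfl fun ω _ => ?_
  simp only [Finset.prod_ite_zero, Finset.prod_const_one, Finset.mem_univ, true_imp_iff]

theorem prob_eq_bool (c : Bool) : prob (fun b : Bool => b = c) = 1 / 2 := by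
  rw [prob_eq_expect, Fintype.expect_eq_sum_div_card]
  cases c <;> simp

theorem mul_prob_le_expect {Ω : Type} [Fintype Ω] {f : Ω → ℝ} {e : Ω → Prop} {c : ℝ}
    (hf : ∀ ω, 0 ≤ f ω) (h : ∀ ω, e ω → c ≤ f ω) : c * prob e ≤ 𝔼 ω, f ω := by
  classical
  rw [prob_eq_expect, Finset.mul_expect]
  refine Finset.expect_le_expect fun ω _ => ?_
  split_ifs with hω
  · simpa using h ω hω
  · simpa using hf ω

/-! ### Deviations of sums of independent quantities -/

theorem expect_exp_sum {Z : Type} [Fintype Z] (f : Z → ℝ) (N : ℕ) :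
    𝔼 z : Fin N → Z, Real.exp (∑ b, f (z b)) = (𝔼 a, Real.exp (f a)) ^ N := by
  simp only [Real.exp_sum]
  rw [expect_prod_pi fun (_ : Fin N) a => Real.exp (f a)]
  simp

section deviations
variable {Z : Type} [Fintype Z] [Nonempty Z]

theorem exp_mul_le {t x : ℝ} (hx : |x| ≤ 1) :
    Real.exp (t * x) ≤ Real.cosh t + x * Real.sinh t := by
  obtain ⟨h1, h2⟩ := abs_le.1 hx
  have h := convexOn_exp.2 (Set.mem_univ t) (Set.mem_univ (-t))
    (show 0 ≤ (1 + x) / 2 by linarith) (show 0 ≤ (1 - x) / 2 by linarith) (by ring)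
  simp only [smul_eq_mul] at h
  rw [show (1 + x) / 2 * t + (1 - x) / 2 * -t = t * x by ring] at h
  rw [Real.cosh_eq, Real.sinh_eq]
  linarith

theorem expect_exp_le {X : Z → ℝ} (hX : ∀ a, |X a| ≤ 1) (t : ℝ) :
    𝔼 a, Real.exp (t * X a) ≤ Real.cosh t + (𝔼 a, X a) * Real.sinh t := by
  refine (Finset.expect_le_expect fun a _ => exp_mul_le (t := t) (hX a)).trans (le_of_eq ?_)
  rw [Finset.expect_add_distrib, Fintype.expect_const, Finset.expect_mul]

/-- A sum of `p ^ 2` independent quantities of mean at most zero rarely exceeds `p * l`. -/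
theorem prob_sum_ge_le {X : Z → ℝ} (hX : ∀ a, |X a| ≤ 1) (hμ : 𝔼 a, X a ≤ 0) (p : ℕ) {l : ℝ}
    (hl : 0 ≤ l) (hp : 0 < p) :
    prob (fun z : Fin (p * p) → Z => p * l ≤ ∑ b, X (z b)) ≤ Real.exp (-l ^ 2 / 2) := by
  have hp' : (0 : ℝ) < p := by exact_mod_cast hp
  set t : ℝ := l / p with ht
  have ht0 : 0 ≤ t := by positivity
  have htp : t * p = l := by rw [ht]; field_simp
  have h1 : prob (fun z : Fin (p * p) → Z => p * l ≤ ∑ b, X (z b)) ≤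
      prob (fun z : Fin (p * p) → Z => l ^ 2 ≤ ∑ b, t * X (z b)) := by
    refine prob_mono fun z hz => ?_
    rw [← Finset.mul_sum]
    calc l ^ 2 = t * (p * l) := by rw [← mul_assoc, htp]; ring
      _ ≤ _ := mul_le_mul_of_nonneg_left hz ht0
  refine h1.trans (prob_le_expect_exp.trans ?_)
  rw [expect_exp_sum fun a => t * X a]
  have h2 : 𝔼 a, Real.exp (t * X a) ≤ Real.exp (t ^ 2 / 2) := by
    refine (expect_exp_le hX t).trans ?_
    have := mul_nonpos_of_nonpos_of_nonneg hμ (Real.sinh_nonneg_iff.2 ht0)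
    linarith [Real.cosh_le_exp_half_sq t]
  have h3 : 0 ≤ 𝔼 a, Real.exp (t * X a) := Finset.expect_nonneg fun a _ => (Real.exp_pos _).le
  calc Real.exp (-l ^ 2) * (𝔼 a, Real.exp (t * X a)) ^ (p * p)
      ≤ Real.exp (-l ^ 2) * Real.exp (t ^ 2 / 2) ^ (p * p) := by gcongr
    _ = Real.exp (-l ^ 2 / 2) := by
        rw [← Real.exp_nat_mul, ← Real.exp_add]
        congr 1
        push_cast
        rw [← htp]
        ring

/-- A sum of `p ^ 2` independent quantities of mean at least `5 * l / p` rarely fails to exceed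
`p * l`. -/
theorem prob_sum_le_le {X : Z → ℝ} (hX : ∀ a, |X a| ≤ 1) (p : ℕ) {l : ℝ} (hl : 0 ≤ l)
    (hlp : l ≤ p) (hp : 0 < p) (hμ : 5 * l ≤ p * 𝔼 a, X a) :
    prob (fun z : Fin (p * p) → Z => ∑ b, X (z b) ≤ p * l) ≤ Real.exp (-l ^ 2 / 2) := by
  have hp' : (0 : ℝ) < p := by exact_mod_cast hp
  set t : ℝ := l / p with ht
  have ht0 : 0 ≤ t := by positivity
  have ht1 : t ≤ 1 := by rw [ht, div_le_one hp']; exact hlp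
  have htp : t * p = l := by rw [ht]; field_simp
  have h1 : prob (fun z : Fin (p * p) → Z => ∑ b, X (z b) ≤ p * l) ≤
      prob (fun z : Fin (p * p) → Z => -l ^ 2 ≤ ∑ b, -t * X (z b)) := by
    refine prob_mono fun z hz => ?_
    rw [← Finset.mul_sum]
    have : t * ∑ b, X (z b) ≤ t * (p * l) := mul_le_mul_of_nonneg_left hz ht0
    have h2 : t * (p * l) = l ^ 2 := by rw [← mul_assoc, htp]; ring
    linarith
  refine h1.trans (prob_le_expect_exp.trans ?_)
  rw [expect_exp_sum fun a => -t * X a]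
  set μ := 𝔼 a, X a with hμ'
  have hμ0 : 0 ≤ μ := by
    by_contra hneg
    have := mul_neg_of_pos_of_neg hp' (not_le.1 hneg)
    linarith
  have h2 : 𝔼 a, Real.exp (-t * X a) ≤ Real.exp (t ^ 2 - t * μ) := by
    refine (expect_exp_le hX (-t)).trans ?_
    rw [Real.cosh_neg, Real.sinh_neg, ← hμ']
    have h3 : t ≤ Real.sinh t := Real.self_le_sinh_iff.2 ht0
    have h4 : Real.cosh t ≤ 1 + t ^ 2 := by
      refine (Real.cosh_le_exp_half_sq t).trans ?_
      have h5 : t ^ 2 / 2 ≤ 1 / 2 := by nlinarith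
      refine (Real.exp_bound_div_one_sub_of_interval (by positivity) (by linarith)).trans ?_
      rw [div_le_iff₀ (by linarith)]
      nlinarith [sq_nonneg t]
    have h6 := Real.add_one_le_exp (t ^ 2 - t * μ)
    nlinarith
  have h3 : 0 ≤ 𝔼 a, Real.exp (-t * X a) := Finset.expect_nonneg fun a _ => (Real.exp_pos _).le
  calc Real.exp (-(-l ^ 2)) * (𝔼 a, Real.exp (-t * X a)) ^ (p * p)
      ≤ Real.exp (-(-l ^ 2)) * Real.exp (t ^ 2 - t * μ) ^ (p * p) := by gcongr
    _ = Real.exp (2 * l ^ 2 - l * (p * μ)) := by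
        rw [← Real.exp_nat_mul, ← Real.exp_add]
        congr 1
        push_cast
        rw [← htp]
        ring
    _ ≤ Real.exp (-l ^ 2 / 2) := by
        refine Real.exp_le_exp.2 ?_
        nlinarith [mul_le_mul_of_nonneg_left hμ hl]

end deviations

/-! ### The law of a simulated instance -/

/-- The probability that at least `m` among `L` independent trials succeed, if a single trial
succeeds with probability `κ`. -/
def binomTail (κ : ℝ) : ℕ → ℕ → ℝ
  | _, 0 => 1
  | 0, _ + 1 => 0
  | L + 1, m + 1 => κ * binomTail κ L m + (1 - κ) * binomTail κ L (m + 1)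

theorem binomTail_zero (κ : ℝ) (L : ℕ) : binomTail κ L 0 = 1 := by cases L <;> rfl

/-- Markov's inequality for the number of failures. -/
theorem le_mul_binomTail {κ : ℝ} (h0 : 0 ≤ κ) (h1 : κ ≤ 1) (L m : ℕ) {K : ℝ} (hK : L ≤ K) :
    L * κ - m ≤ K * binomTail κ L m := by
  induction L generalizing m with
  | zero =>
    have hK : 0 ≤ K := by simpa using hK
    cases m with
    | zero => simpa [binomTail]
    | succ m => simp [binomTail]; linarith [(Nat.cast_nonneg m : (0 : ℝ) ≤ m)]
  | succ L ih =>
    have hK' : (L : ℝ) ≤ K := by push_cast at hK; linarith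
    cases m with
    | zero =>
      rw [binomTail_zero]
      have : ((L + 1 : ℕ) : ℝ) * κ ≤ (L + 1 : ℕ) := mul_le_of_le_one_right (by positivity) h1
      simp only [Nat.cast_zero]
      linarith
    | succ m =>
      have e1 := mul_le_mul_of_nonneg_left (ih m hK') h0
      have e2 := mul_le_mul_of_nonneg_left (ih (m + 1) hK') (sub_nonneg.2 h1)
      rw [binomTail]
      push_cast at e1 e2 ⊢
      linarith

theorem sum_cons {m : ℕ} {β : Type} [Fintype β] (f : (Fin (m + 1) → β) → ℝ) :
    ∑ b, f b = ∑ b : β, ∑ b' : Fin m → β, f (Fin.cons b b') := by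
  rw [← Fintype.sum_prod_type']
  exact Fintype.sum_equiv (Fin.consEquiv fun _ => β).symm _ _ fun ω => by simp [Fin.consEquiv]

/-- The successful ones among independent trials are independent samples from the law of a successful
trial. -/
theorem expect_first_of_trials {α β : Type} [Fintype α] [Nonempty α] [Fintype β] [DecidableEq β]
    (o : α → Option β) {κ : ℝ} {ν : β → ℝ} (hν : ∑ b, ν b = 1)
    (ho : ∀ b, prob (fun a => o a = some b) = κ * ν b) (L m : ℕ) (g : (Fin m → β) → ℝ) :
    𝔼 x : Fin L → α, (if h : m ≤ (List.ofFn fun i => o (x i)).reduceOption.length then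
      g (fun t => (List.ofFn fun i => o (x i)).reduceOption[(t : ℕ)]) else 0)
    = binomTail κ L m * ∑ b : Fin m → β, (∏ t, ν (b t)) * g b := by
  have split : ∀ φ : Option β → ℝ,
      𝔼 a, φ (o a) = κ * ∑ b, ν b * φ (some b) + (1 - κ) * φ none := by
    intro φ
    have h1 : ∀ a, φ (o a) = (∑ b, (if o a = some b then (1 : ℝ) else 0) * (φ (some b) - φ none))
        + φ none := by
      intro a
      rcases o a with _ | b
      · simp
      · simp [Finset.sum_ite_eq]
    rw [Finset.expect_congr rfl fun a _ => h1 a, Finset.expect_add_distrib, Fintype.expect_const,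
      Finset.expect_sum_comm]
    have h2 : ∀ b, 𝔼 a, (if o a = some b then (1 : ℝ) else 0) * (φ (some b) - φ none)
        = κ * ν b * (φ (some b) - φ none) := by
      intro b
      rw [← Finset.expect_mul, ← ho b, prob_eq_expect]
    rw [Finset.sum_congr rfl fun b _ => h2 b]
    have h3 : ∑ b, κ * ν b * (φ (some b) - φ none)
        = κ * ∑ b, ν b * φ (some b) - κ * (∑ b, ν b) * φ none := by
      rw [Finset.mul_sum, Finset.mul_sum, Finset.sum_mul, ← Finset.sum_sub_distrib]
      exact Finset.sum_congr rfl fun b _ => by ring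
    rw [h3, hν]
    ring
  induction L generalizing m with
  | zero =>
    cases m with
    | zero => simp [binomTail_zero, Subsingleton.elim _ (Fin.elim0 : Fin 0 → β)]
    | succ m => simp [binomTail]
  | succ L ih =>
    cases m with
    | zero =>
      simp [binomTail_zero, Subsingleton.elim _ (Fin.elim0 : Fin 0 → β)]
    | succ m =>
      rw [expect_cons]
      have h1 : ∀ a, 𝔼 x : Fin L → α,
          (if h : m + 1 ≤ (List.ofFn fun i => o ((Fin.cons a x : Fin (L + 1) → α) i)).reduceOption.length then
            g (fun t => (List.ofFn fun i => o ((Fin.cons a x : Fin (L + 1) → α) i)).reduceOption[(t : ℕ)]) else 0)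
          = (o a).elim (binomTail κ L (m + 1) * ∑ b : Fin (m + 1) → β, (∏ t, ν (b t)) * g b)
            fun b => binomTail κ L m * ∑ b' : Fin m → β, (∏ t, ν (b' t)) * g (Fin.cons b b') := by
        intro a
        rcases hoa : o a with _ | b
        · simp only [Option.elim]
          rw [← ih (m + 1) g]
          refine Finset.expect_congr rfl fun x _ => ?_
          have : (List.ofFn fun i => o ((Fin.cons a x : Fin (L + 1) → α) i)).reduceOption
              = (List.ofFn fun i => o (x i)).reduceOption := by
            simp [List.ofFn_succ, hoa]
          simp only [this]
        · simp only [Option.elim]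
          rw [← ih m fun b' => g (Fin.cons b b')]
          refine Finset.expect_congr rfl fun x _ => ?_
          have : (List.ofFn fun i => o ((Fin.cons a x : Fin (L + 1) → α) i)).reduceOption
              = b :: (List.ofFn fun i => o (x i)).reduceOption := by
            simp [List.ofFn_succ, hoa]
          simp only [this, List.length_cons, Nat.add_le_add_iff_right]
          split_ifs with h
          · congr 1
            funext t
            refine Fin.cases ?_ (fun t => ?_) t <;> simp
          · rfl
      rw [Finset.expect_congr rfl fun a _ => h1 a, split fun y => y.elim _ _, binomTail, add_mul]
      simp only [Option.elim]
      rw [mul_assoc (1 - κ), add_left_inj, sum_cons, mul_assoc]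
      congr 1
      rw [Finset.mul_sum]
      refine Finset.sum_congr rfl fun b _ => ?_
      simp only [Fin.prod_univ_succ, Fin.cons_zero, Fin.cons_succ, Finset.mul_sum]
      exact Finset.sum_congr rfl fun b' _ => by ring

/-- What decides about an entry of a simulated hyperedge: the source vertex, the label candidate, and
three coins. -/
abbrev Entry (n : ℕ) : Type := Fin n × Fin n × Bool × Bool × Bool

/-- Whether an entry is accepted; see `entryOk`. -/
def Entry.ok {n : ℕ} (T : Fin n → Bool) (k j : Fin n) (mix : Bool) (a : Entry n) : Bool :=
  if a.2.2.1 = true then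
    (if a.2.2.2.1 = true then T a.2.1 && decide (a.1 = if (mix && a.2.2.2.2) = true then j else k)
      else T a.2.1 && decide (k < a.1))
  else !a.2.2.2.1 && (T a.1 && decide (a.2.1 < k))

/-- The vertex of the simulated hyperedge; see `entryLabel`. -/
def Entry.label {n : ℕ} (k : Fin n) (a : Entry n) : Fin n :=
  if a.2.2.1 = true then (if a.2.2.2.1 = true then k else a.1) else a.2.1

/-- The number of elements of a set that is given by its characteristic function. -/
def card {n : ℕ} (T : Fin n → Bool) : ℝ := ∑ v, if T v = true then 1 else 0

/-- The point mass at the bit `b`. -/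
def dirac (b x : Bool) : ℝ := if b = x then 1 else 0

/-- The law of the bit of the vertex `w` in a simulated instance. -/
def vertexLaw {n : ℕ} (s T : Fin n → Bool) (k j : Fin n) (mix : Bool) (w : Fin n) (x : Bool) : ℝ :=
  if w < k then (∑ v, if T v = true then dirac (s v) x else 0) / card T
  else if w = k then (dirac (s k) x + dirac (s (if mix = true then j else k)) x) / 2
  else dirac (s w) x

/-- Every pair of a vertex and a value of its bit is produced with a probability proportional to the
law of the bit; the factor does not depend on the vertex. -/
theorem prob_entry {n : ℕ} (s T : Fin n → Bool) (hT : card T ≠ 0) (k j : Fin n) (mix : Bool)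
    (w : Fin n) (x : Bool) :
    prob (fun a : Entry n => a.ok T k j mix = true ∧ a.label k = w ∧ s a.1 = x)
      = card T / (4 * n ^ 2) * vertexLaw s T k j mix w x := by
  classical
  have hn : (n : ℝ) ≠ 0 := by
    have := k.pos
    positivity
  have hcard : (Fintype.card (Entry n) : ℝ) = 8 * n ^ 2 := by
    simp
    ring
  have hc : ((Finset.univ.filter fun x : Bool × Bool => x.1 = false).card : ℝ) = 2 := by
    norm_num [show (Finset.univ.filter fun x : Bool × Bool => x.1 = false).card = 2 from rfl]
  rcases lt_trichotomy w k with hw | rfl | hw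
  · rw [prob_congr (q := fun a : Entry n => (T a.1 = true ∧ s a.1 = x) ∧ a.2.1 = w ∧
      a.2.2.1 = false ∧ a.2.2.2.1 = false), prob_eq_expect, Fintype.expect_eq_sum_div_card, hcard]
    · have h : ∑ a : Entry n, (if (T a.1 = true ∧ s a.1 = x) ∧ a.2.1 = w ∧ a.2.2.1 = false ∧
          a.2.2.2.1 = false then (1 : ℝ) else 0)
          = (∑ v, if T v = true then dirac (s v) x else 0) * 2 := by
        simp [Fintype.sum_prod_type, ite_and, dirac, hc, Finset.sum_mul]
      rw [h, vertexLaw, if_pos hw]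
      field_simp
      ring
    · rintro ⟨v, u, c₀, c₁, c₂⟩
      cases c₀ <;> cases c₁ <;> simp [Entry.ok, Entry.label] <;> grind
  · rw [prob_congr (q := fun a : Entry n => T a.2.1 = true ∧ a.2.2.1 = true ∧ a.2.2.2.1 = true ∧
      a.1 = (if (mix && a.2.2.2.2) = true then j else w) ∧
      s (if (mix && a.2.2.2.2) = true then j else w) = x), prob_eq_expect,
      Fintype.expect_eq_sum_div_card, hcard]
    · have h : ∑ a : Entry n, (if T a.2.1 = true ∧ a.2.2.1 = true ∧ a.2.2.2.1 = true ∧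
          a.1 = (if (mix && a.2.2.2.2) = true then j else w) ∧
          s (if (mix && a.2.2.2.2) = true then j else w) = x then (1 : ℝ) else 0)
          = card T * (dirac (s w) x + dirac (s (if mix = true then j else w)) x) := by
        rw [Fintype.sum_prod_type, Finset.sum_congr rfl fun v _ => Fintype.sum_prod_type _,
          Finset.sum_comm, card, Finset.sum_mul]
        refine Finset.sum_congr rfl fun u _ => ?_
        rcases hu : T u with _ | _ <;> cases mix <;>
          simp [hu, Fintype.sum_prod_type, ite_and, dirac, Finset.sum_add_distrib, add_comm]
      rw [h, vertexLaw, if_neg (lt_irrefl w), if_pos rfl]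
      field_simp
      ring
    · rintro ⟨v, u, c₀, c₁, c₂⟩
      cases c₀ <;> cases c₁ <;> simp [Entry.ok, Entry.label] <;> grind
  · rw [prob_congr (q := fun a : Entry n => (T a.2.1 = true ∧ s w = x) ∧ a.1 = w ∧
      a.2.2.1 = true ∧ a.2.2.2.1 = false), prob_eq_expect, Fintype.expect_eq_sum_div_card, hcard]
    · have h : ∑ a : Entry n, (if (T a.2.1 = true ∧ s w = x) ∧ a.1 = w ∧ a.2.2.1 = true ∧
          a.2.2.2.1 = false then (1 : ℝ) else 0) = card T * dirac (s w) x * 2 := by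
        rw [Fintype.sum_prod_type, Finset.sum_congr rfl fun v _ => Fintype.sum_prod_type _,
          Finset.sum_comm, card, Finset.sum_mul, Finset.sum_mul]
        refine Finset.sum_congr rfl fun u _ => ?_
        rcases hu : T u with _ | _ <;> simp [hu, Fintype.sum_prod_type, ite_and, dirac, hc]
      rw [h, vertexLaw, if_neg hw.not_gt, if_neg hw.ne']
      field_simp
      ring
    · rintro ⟨v, u, c₀, c₁, c₂⟩
      cases c₀ <;> cases c₁ <;> simp [Entry.ok, Entry.label] <;> grind

/-- The simulated hyperedge and its output bit, if all entries are accepted. -/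
def trial {n d : ℕ} (P : (Fin d → Bool) → Bool) (s T : Fin n → Bool) (k j : Fin n) (mix : Bool)
    (a : Fin d → Entry n) : Option ((Fin d → Fin n) × Bool) :=
  if ∀ e, (a e).ok T k j mix = true then
    some (fun e => (a e).label k, P fun e => s (a e).1) else none

/-- The law of the output bit of the hyperedge `w`, if the bits of the vertices of a hyperedge are
drawn independently from the laws `φ`. -/
def bitLaw {n d : ℕ} (P : (Fin d → Bool) → Bool) (φ : Fin n → Bool → ℝ) (w : Fin d → Fin n)
    (y : Bool) : ℝ :=
  ∑ x : Fin d → Bool, if P x = y then ∏ e, φ (w e) (x e) else 0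

theorem sum_bitLaw {n d : ℕ} (P : (Fin d → Bool) → Bool) {φ : Fin n → Bool → ℝ}
    (hφ : ∀ v, ∑ x, φ v x = 1) (w : Fin d → Fin n) : ∑ y, bitLaw P φ w y = 1 := by
  simp only [bitLaw]
  rw [Finset.sum_comm]
  simp only [Finset.sum_ite_eq, Finset.mem_univ, if_true]
  have h := Finset.prod_univ_sum (fun _ : Fin d => Finset.univ) fun e x => φ (w e) x
  rw [Fintype.piFinset_univ] at h
  rw [← h, Finset.prod_congr rfl fun e _ => hφ (w e)]
  simp

theorem sum_vertexLaw {n : ℕ} (s T : Fin n → Bool) (hT : card T ≠ 0) (k j : Fin n) (mix : Bool)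
    (w : Fin n) : ∑ x, vertexLaw s T k j mix w x = 1 := by
  have hd : ∀ b, dirac b true + dirac b false = 1 := fun b => by cases b <;> simp [dirac]
  rw [Fintype.sum_bool]
  unfold vertexLaw
  split_ifs
  · rw [← add_div, ← Finset.sum_add_distrib, div_eq_one_iff_eq hT, card]
    exact Finset.sum_congr rfl fun v _ => by split_ifs <;> simp [hd]
  · linarith [hd (s k), hd (s j)]
  · linarith [hd (s k)]
  · exact hd _

/-- The simulated hyperedges are uniformly random, and their output bits follow `bitLaw`. -/
theorem prob_trial {n d : ℕ} (P : (Fin d → Bool) → Bool) (s T : Fin n → Bool) (hT : card T ≠ 0)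
    (k j : Fin n) (mix : Bool) (b : (Fin d → Fin n) × Bool) :
    prob (fun a : Fin d → Entry n => trial P s T k j mix a = some b) = (card T / (4 * n)) ^ d *
      (bitLaw P (vertexLaw s T k j mix) b.1 b.2 / n ^ d) := by
  classical
  obtain ⟨w, y⟩ := b
  have h1 : ∀ a : Fin d → Entry n, (if trial P s T k j mix a = some (w, y) then (1 : ℝ) else 0)
      = ∑ x : Fin d → Bool, if P x = y then
        ∏ e, (if (a e).ok T k j mix = true ∧ (a e).label k = w e ∧ s (a e).1 = x e then (1 : ℝ)
          else 0) else 0 := by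
    intro a
    rw [Finset.sum_eq_single fun e => s (a e).1]
    · simp only [Finset.prod_ite_zero, Finset.prod_const_one, trial, Finset.mem_univ, true_imp_iff]
      rw [← ite_and]
      refine if_congr ?_ rfl rfl
      split_ifs with h
      · simp only [Option.some.injEq, Prod.mk.injEq, funext_iff]
        simp [h, and_comm]
      · simp only [false_iff]
        exact fun h' => h fun e => (h'.2 e).1
    · intro x _ hx
      have : ∃ e, s (a e).1 ≠ x e := by
        by_contra! h
        exact hx (funext fun e => (h e).symm)
      obtain ⟨e, he⟩ := this
      rw [Finset.prod_eq_zero (Finset.mem_univ e) (by simp [he])]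
      simp
    · simp
  rw [prob_eq_expect, Finset.expect_congr rfl fun a _ => h1 a, Finset.expect_sum_comm, bitLaw,
    Finset.sum_div, Finset.mul_sum]
  refine Finset.sum_congr rfl fun x _ => ?_
  split_ifs
  · rw [expect_prod_pi fun e (a : Entry n) => if a.ok T k j mix = true ∧ a.label k = w e ∧
      s a.1 = x e then (1 : ℝ) else 0]
    have h2 : ∀ e, 𝔼 a : Entry n, (if a.ok T k j mix = true ∧ a.label k = w e ∧ s a.1 = x e then
        (1 : ℝ) else 0) = card T / (4 * n) / n * vertexLaw s T k j mix (w e) (x e) := by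
      intro e
      rw [← prob_eq_expect, prob_entry s T hT]
      have hn : (n : ℝ) ≠ 0 := by
        have := k.pos
        positivity
      field_simp
    rw [Finset.prod_congr rfl fun e _ => h2 e, Finset.prod_mul_distrib, Finset.prod_const,
      Finset.card_univ, Fintype.card_fin, div_pow]
    ring
  · simp

/-- The acceptance probability of `D` on random instances with `m` hyperedges where the output bit of
each hyperedge is determined by independent samples from the laws `φ` of its vertices. -/
def hybrid {n d : ℕ} (P : (Fin d → Bool) → Bool) (D : Cmd) (m : ℕ) (φ : Fin n → Bool → ℝ) : ℝ :=
  𝔼 G : Hypergraph n m d, ∑ y : Fin m → Bool, (∏ i, bitLaw P φ (G i) (y i)) * acceptProb D G y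

/-- The verdict of the distinguisher on the first `m` of the given hyperedges and output bits. -/
def verdict {n d : ℕ} (D : Cmd) (m : ℕ) (l : List ((Fin d → Fin n) × Bool)) (w : List Bool) : Bool :=
  if h : m ≤ l.length then
    tapeAccepts D (encodeInstance (fun t : Fin m => (l[(t : ℕ)]).1) fun t => (l[(t : ℕ)]).2) w
  else false

/-- The randomness of a batch: the entries of `L` trials, and the coins of the distinguisher. -/
abbrev Sample (n d L Q : ℕ) : Type := (Fin L → Fin d → Entry n) × (Fin Q → Bool)

/-- The verdict of the distinguisher on a batch. -/
def Sample.batch {n d L Q : ℕ} (P : (Fin d → Bool) → Bool) (D : Cmd) (m : ℕ) (s T : Fin n → Bool)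
    (k j : Fin n) (mix : Bool) (z : Sample n d L Q) : Bool :=
  verdict D m (List.ofFn fun i => trial P s T k j mix (z.1 i)).reduceOption (List.ofFn z.2)

/-- Provided that sufficiently many trials succeed, a batch is a random instance in which the bits of
the vertices follow `vertexLaw`. -/
theorem expect_batch {n d L Q m : ℕ} (P : (Fin d → Bool) → Bool) {D : Cmd} {q : Polynomial ℕ}
    (hD : ∀ (n m : ℕ) (G : Hypergraph n m d) (y : Fin m → Bool),
      HaltsWithin D (encodeInstance G y) (q.eval (n + m))) (hQ : q.eval (n + m) ≤ Q)
    (s T : Fin n → Bool) (hT : card T ≠ 0) (k j : Fin n) (mix : Bool) :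
    𝔼 z : Sample n d L Q, (if z.batch P D m s T k j mix = true then (1 : ℝ) else 0)
      = binomTail ((card T / (4 * n)) ^ d) L m * hybrid P D m (vertexLaw s T k j mix) := by
  classical
  have hn : (n : ℝ) ≠ 0 := by
    have := k.pos
    positivity
  have : Nonempty (Fin n) := ⟨k⟩
  rw [expect_prod]
  have h1 : ∀ x : Fin L → Fin d → Entry n, 𝔼 w : Fin Q → Bool,
      (if Sample.batch P D m s T k j mix (x, w) = true then (1 : ℝ) else 0)
      = (if h : m ≤ (List.ofFn fun i => trial P s T k j mix (x i)).reduceOption.length then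
        (fun b : Fin m → (Fin d → Fin n) × Bool => acceptProb D (fun t => (b t).1) fun t => (b t).2)
        (fun t => (List.ofFn fun i => trial P s T k j mix (x i)).reduceOption[(t : ℕ)]) else 0) := by
    intro x
    by_cases h : m ≤ (List.ofFn fun i => trial P s T k j mix (x i)).reduceOption.length
    · simp only [Sample.batch, verdict, h, dite_true]
      rw [acceptProb, outputProb_eq_expect (hD _ _ _ _) hQ]
    · simp [Sample.batch, verdict, h]
  rw [Finset.expect_congr rfl fun x _ => h1 x]
  refine (expect_first_of_trials (κ := (card T / (4 * n)) ^ d)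
    (ν := fun b => bitLaw P (vertexLaw s T k j mix) b.1 b.2 / n ^ d) (trial P s T k j mix) ?_
    (prob_trial P s T hT k j mix) L m
    fun b => acceptProb D (fun t => (b t).1) fun t => (b t).2).trans ?_
  · rw [Fintype.sum_prod_type]
    simp only
    rw [Finset.sum_congr rfl fun w _ => (Finset.sum_div _ _ _).symm,
      Finset.sum_congr rfl fun w _ => by rw [sum_bitLaw P (sum_vertexLaw s T hT k j mix) w]]
    simp [hn]
  · congr 1
    rw [hybrid, Fintype.expect_eq_sum_div_card, Finset.sum_div]
    refine (Fintype.sum_equiv (Equiv.arrowProdEquivProdArrow (Fin m) (fun _ => Fin d → Fin n)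
      fun _ => Bool) _ (fun z => (∏ t, bitLaw P (vertexLaw s T k j mix) (z.1 t) (z.2 t) / n ^ d) *
        acceptProb D z.1 z.2) fun b => rfl).trans ?_
    rw [Fintype.sum_prod_type]
    refine Finset.sum_congr rfl fun G _ => ?_
    rw [Finset.sum_div]
    refine Finset.sum_congr rfl fun y _ => ?_
    rw [Finset.prod_div_distrib]
    simp
    field_simp

/-- The difference between the verdicts on a batch without and with mixing. -/
def Sample.gap {n d L Q : ℕ} (P : (Fin d → Bool) → Bool) (D : Cmd) (m : ℕ)
    (s T : Fin n → Bool) (k j : Fin n) (z : Sample n d L Q) : ℝ :=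
  (if z.batch P D m s T k j false = true then 1 else 0) -
    if z.batch P D m s T k j true = true then 1 else 0

theorem Sample.abs_gap_le {n d L Q : ℕ} (P : (Fin d → Bool) → Bool) (D : Cmd)
    (m : ℕ) (s T : Fin n → Bool) (k j : Fin n) (z : Sample n d L Q) :
    |z.gap P D m s T k j| ≤ 1 := by
  unfold Sample.gap
  split_ifs <;> norm_num

/-! ### The randomness of the algorithm -/

/-- The number of coins that the algorithm flips on `n` vertices and `M` hyperedges. -/
abbrev coinCount (d : ℕ) (q : Polynomial ℕ) (n M : ℕ) : ℕ :=
  M * n + (M * (3 * d) + M * q.eval (n + M)) + 1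

/-- The randomness of the algorithm and of its input: the hyperedges and the coins. -/
abbrev Outcome (d : ℕ) (q : Polynomial ℕ) (n M : ℕ) : Type :=
  Hypergraph n M d × (Fin (coinCount d q n M) → Bool)

theorem mul_add_lt {a A b B : ℕ} (ha : a < A) (hb : b < B) : a * B + b < A * B := by
  have := Nat.mul_le_mul_right B (Nat.succ_le_of_lt ha)
  rw [Nat.succ_mul] at this
  omega

theorem mul_add_inj {a a' b b' B : ℕ} (hb : b < B) (hb' : b' < B)
    (h : a * B + b = a' * B + b') : a = a' ∧ b = b' := by
  have hB : 0 < B := by omega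
  have h1 : (a * B + b) / B = a := by
    rw [mul_comm, Nat.mul_add_div hB, Nat.div_eq_of_lt hb, add_zero]
  have h2 : (a' * B + b') / B = a' := by
    rw [mul_comm, Nat.mul_add_div hB, Nat.div_eq_of_lt hb', add_zero]
  have : a = a' := by rw [← h1, h, h2]
  subst this
  exact ⟨rfl, by omega⟩

namespace Outcome
variable {d : ℕ} {q : Polynomial ℕ} {n M : ℕ}

/-- The context of the algorithm on the hyperedges and output bits for the secret `s`. -/
def ctx (P : (Fin d → Bool) → Bool) (s : Fin n → Bool) (o : Outcome d q n M) : Ctx :=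
  (n, edgeList o.1, List.ofFn (localFn P o.1 s), List.ofFn o.2)

variable (P : (Fin d → Bool) → Bool) (s : Fin n → Bool) (o : Outcome d q n M)

theorem ctx_M : (o.ctx P s).M = M := by simp [ctx, Ctx.M, edgeList]

theorem getD_ofFn {α : Type} {k : ℕ} (f : Fin k → α) (i : Fin k) (x : α) :
    (List.ofFn f).getD i x = f i := by
  rw [List.getD_eq_getElem _ _ (by simp)]
  simp

theorem ctx_vtx (i : Fin M) (e : Fin d) : (o.ctx P s).vtx i e = o.1 i e := by
  rw [Ctx.vtx]
  simp only [ctx, edgeList]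
  rw [getD_ofFn, getD_ofFn]

theorem ctx_bit (i : Fin M) : (o.ctx P s).bit i = P fun e => s (o.1 i e) := getD_ofFn _ i _

theorem ctx_getD (i : Fin (coinCount d q n M)) : (o.ctx P s).2.2.2.getD i false = o.2 i :=
  getD_ofFn _ i _

theorem setIdx_lt {r u : ℕ} (hr : r < M) (hu : u < n) : r * n + u < coinCount d q n M := by
  have := mul_add_lt hr hu
  simp only [coinCount]
  omega

/-- The `r`-th random set. -/
def set (r : Fin M) (u : Fin n) : Bool := o.2 ⟨r * n + u, setIdx_lt r.2 u.2⟩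

theorem ctx_inSet (r : Fin M) (u : Fin n) : (o.ctx P s).inSet r u = o.set r u :=
  o.ctx_getD P s ⟨_, setIdx_lt r.2 u.2⟩

theorem coinIdx_lt {x c e : ℕ} (hx : x < M) (hc : c < 3) (he : e < d) :
    M * n + (x * (3 * d) + (c * d + e)) < coinCount d q n M := by
  have := mul_add_lt hx (mul_add_lt hc he)
  simp only [coinCount]
  omega

theorem ctx_coin (x : Fin M) (c : Fin 3) (e : Fin d) :
    (o.ctx P s).coin d x c e = o.2 ⟨_, coinIdx_lt x.2 c.2 e.2⟩ := by
  rw [Ctx.coin, ctx_M]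
  exact o.ctx_getD P s ⟨_, coinIdx_lt x.2 c.2 e.2⟩

theorem runIdx_lt {b i : ℕ} (hb : b < M) (hi : i < q.eval (n + M)) :
    M * n + (M * (3 * d) + (b * q.eval (n + M) + i)) < coinCount d q n M := by
  have := mul_add_lt hb hi
  simp only [coinCount]
  omega

theorem ctx_runCoins (b : Fin M) : (o.ctx P s).runCoins d q b =
    List.ofFn fun i : Fin (q.eval (n + M)) => o.2 ⟨_, runIdx_lt b.2 i.2⟩ := by
  rw [Ctx.runCoins, ctx_M, List.ofFn_eq_map]
  change (List.range (q.eval (n + M))).map _ = _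
  rw [← List.map_coe_finRange_eq_range, List.map_map]
  refine List.map_congr_left fun i _ => ?_
  exact o.ctx_getD P s ⟨_, runIdx_lt b.2 i.2⟩

/-- The coin that decides which of the two vertex classes holds ones. -/
def lastCoin : Bool := o.2 ⟨_, Nat.lt_succ_self _⟩

theorem ctx_lastCoin : (o.ctx P s).lastCoin d q = o.lastCoin := by
  rw [Ctx.lastCoin, ctx_M]
  exact o.ctx_getD P s ⟨_, Nat.lt_succ_self _⟩

section sample
variable {N L : ℕ}

theorem srcIdx_lt (hM : N * L + N * L < M) {b i : ℕ} (hb : b < N) (hi : i < L) : b * L + i < M := by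
  have := mul_add_lt hb hi
  omega

theorem labIdx_lt (hM : N * L + N * L < M) {b i : ℕ} (hb : b < N) (hi : i < L) : N * L + b * L + i < M := by
  have := mul_add_lt hb hi
  omega

/-- The randomness of the `b`-th of `N` batches that consist of `L` trials. -/
def sample (hM : N * L + N * L < M) (hNM : N ≤ M) (b : Fin N) : Sample n d L (q.eval (n + M)) :=
  (fun i e => (o.1 ⟨b * L + i, srcIdx_lt hM b.2 i.2⟩ e, o.1 ⟨N * L + b * L + i, labIdx_lt hM b.2 i.2⟩ e,
    o.2 ⟨_, coinIdx_lt (srcIdx_lt hM b.2 i.2) (show 0 < 3 by norm_num) e.2⟩,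
    o.2 ⟨_, coinIdx_lt (srcIdx_lt hM b.2 i.2) (show 1 < 3 by norm_num) e.2⟩,
    o.2 ⟨_, coinIdx_lt (srcIdx_lt hM b.2 i.2) (show 2 < 3 by norm_num) e.2⟩),
  fun i => o.2 ⟨_, runIdx_lt (lt_of_lt_of_le b.2 hNM) i.2⟩)

theorem entryOk_eq {T' : ℕ → Bool} {T : Fin n → Bool} (hT : ∀ u : Fin n, T' u = T u) (k j : Fin n)
    (mix : Bool) (a : Entry n) :
    entryOk T' k j mix a.1 a.2.1 a.2.2.1 a.2.2.2.1 a.2.2.2.2 = a.ok T k j mix := by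
  obtain ⟨v, u, c₀, c₁, c₂⟩ := a
  rw [Bool.eq_iff_iff]
  cases c₀ <;> cases c₁ <;> simp [entryOk, Entry.ok, hT, Fin.ext_iff]
  intro _
  split_ifs <;> rfl

theorem entryLabel_eq (k : Fin n) (a : Entry n) :
    entryLabel k a.1 a.2.1 a.2.2.1 a.2.2.2.1 = (a.label k : ℕ) := by
  unfold entryLabel Entry.label
  split_ifs <;> rfl

theorem filterMap_ite {α β : Type} (p : α → Bool) (g : α → β) (l : List α) :
    (l.map fun a => if p a = true then some (g a) else none).reduceOption
      = (l.filter p).map g := by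
  induction l with
  | nil => rfl
  | cons a l ih => rcases h : p a with _ | _ <;> simp [h, ih]

theorem enc_map_range {α : Type} [Enc α] (m : ℕ) (f : ℕ → α) :
    enc ((List.range m).map f) = Data.ofList (List.ofFn fun t : Fin m => enc (f t)) := by
  rw [← enc_ofFn, List.ofFn_eq_map, ← List.map_coe_finRange_eq_range, List.map_map]
  rfl

theorem ctx_batch {D : Cmd} (hM : N * L + N * L < M) (hNM : N ≤ M) (m : ℕ) (r : Fin M) (k j : Fin n) (mix : Bool)
    (b : Fin N) :
    (o.ctx P s).batch d D q N L m r k j mix b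
      = (o.sample hM hNM b).batch P D m s (o.set r) k j mix := by
  set X := o.ctx P s with hX
  -- the indices of the successful trials
  set A : List (Fin L) := (List.finRange L).filter fun i =>
    decide (∀ e, ((o.sample hM hNM b).1 i e).ok (o.set r) k j mix = true) with hA
  have hok : ∀ i : Fin L, X.pairOk d r k j mix (b * L + i) (N * L + b * L + i)
      = decide (∀ e, ((o.sample hM hNM b).1 i e).ok (o.set r) k j mix = true) := by
    intro i
    rw [Bool.eq_iff_iff, decide_eq_true_eq, Ctx.pairOk, List.all_eq_true]
    have h : ∀ e : Fin d, entryOk (X.inSet r) k j mix (X.vtx (b * L + i) e)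
        (X.vtx (N * L + b * L + i) e) (X.coin d (b * L + i) 0 e) (X.coin d (b * L + i) 1 e)
        (X.coin d (b * L + i) 2 e) = ((o.sample hM hNM b).1 i e).ok (o.set r) k j mix := by
      intro e
      have h0 := o.ctx_coin P s ⟨b * L + i, srcIdx_lt hM b.2 i.2⟩ 0 e
      have h1 := o.ctx_coin P s ⟨b * L + i, srcIdx_lt hM b.2 i.2⟩ 1 e
      have h2 := o.ctx_coin P s ⟨b * L + i, srcIdx_lt hM b.2 i.2⟩ 2 e
      have hv := o.ctx_vtx P s ⟨b * L + i, srcIdx_lt hM b.2 i.2⟩ e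
      have hu := o.ctx_vtx P s ⟨N * L + b * L + i, labIdx_lt hM b.2 i.2⟩ e
      simp only [Fin.val_zero, Fin.val_one, Fin.val_two, ← hX] at h0 h1 h2 hv hu
      rw [h0, h1, h2, hv, hu]
      have hT := o.ctx_inSet P s r
      rw [← hX] at hT
      exact entryOk_eq hT k j mix ((o.sample hM hNM b).1 i e)
    exact ⟨fun h' e => (h e).symm.trans (h' e (List.mem_range.2 e.2)),
      fun h' e he => (h ⟨e, List.mem_range.1 he⟩).trans (h' _)⟩
  have hsel : X.selected d r k j mix L (b * L) (N * L + b * L) = A.map fun i : Fin L => (i : ℕ) := by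
    rw [Ctx.selected, ← List.map_coe_finRange_eq_range, List.filter_map]
    congr 1
    exact List.filter_congr fun i _ => hok i
  have hl : (List.ofFn fun i => trial P s (o.set r) k j mix ((o.sample hM hNM b).1 i)).reduceOption
      = A.map fun i => (fun e => ((o.sample hM hNM b).1 i e).label k,
        P fun e => s ((o.sample hM hNM b).1 i e).1) := by
    rw [List.ofFn_eq_map, hA, ← filterMap_ite]
    simp only [trial, decide_eq_true_eq]
  rw [Ctx.batch, Sample.batch, verdict, hsel]
  simp only [hl, List.length_map, decide_eq_true_eq, List.getElem_map]
  split_ifs with hm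
  · have hrun := o.ctx_runCoins P s ⟨b, lt_of_lt_of_le b.2 hNM⟩
    rw [← hX] at hrun
    rw [hrun]
    congr 1
    rw [Ctx.simulated, enc_map_range, enc_map_range, encodeInstance]
    have hget : ∀ t : Fin m, (A.map fun i : Fin L => (i : ℕ)).getD t 0
        = (A[(t : ℕ)]'(lt_of_lt_of_le t.2 hm) : Fin L) := by
      intro t
      rw [List.getD_eq_getElem _ _ (by simpa using lt_of_lt_of_le t.2 hm)]
      simp
    simp only [hget]
    refine congrArg₂ Data.cons rfl (congrArg₂ Data.cons ?_ ?_)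
    · congr 2
      funext t
      generalize A[(t : ℕ)]'(lt_of_lt_of_le t.2 hm) = i
      rw [Ctx.pairEdge, enc_map_range]
      congr 2
      funext e
      have h0 := o.ctx_coin P s ⟨b * L + i, srcIdx_lt hM b.2 i.2⟩ 0 e
      have h1 := o.ctx_coin P s ⟨b * L + i, srcIdx_lt hM b.2 i.2⟩ 1 e
      have hv := o.ctx_vtx P s ⟨b * L + i, srcIdx_lt hM b.2 i.2⟩ e
      have hu := o.ctx_vtx P s ⟨N * L + b * L + i, labIdx_lt hM b.2 i.2⟩ e
      simp only [Fin.val_zero, Fin.val_one, ← hX] at h0 h1 hv hu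
      rw [h0, h1, hv, hu]
      exact congrArg Data.ofNat (entryLabel_eq k ((o.sample hM hNM b).1 i e))
    · rw [Data.ofBits]
      congr 2
      funext t
      exact congrArg Data.ofBool (o.ctx_bit P s ⟨b * L + (A[(t : ℕ)]'(lt_of_lt_of_le t.2 hm) : Fin L), _⟩)
  · rfl

theorem length_filter_range (f : ℕ → Bool) (N : ℕ) :
    (((List.range N).filter f).length : ℝ) = ∑ b : Fin N, if f b = true then (1 : ℝ) else 0 := by
  rw [← Finset.sum_range fun b => if f b = true then (1 : ℝ) else 0, ← Finset.natCast_card_filter,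
    Finset.card_def, Finset.filter_val, Finset.range_val, Multiset.range, Multiset.filter_coe,
    Multiset.coe_card]
  simp

set_option synthInstance.maxSize 1000 in
/-- The random set `r` and the batches are uniformly random and independent. -/
theorem unifMap_set_sample (hn : 0 < n) (hM : N * L + N * L < M) (hNM : N ≤ M) (r : Fin M) :
    UnifMap fun o : Outcome d q n M => (o.set r, fun b => o.sample hM hNM b) := by
  have : Nonempty (Fin n) := ⟨⟨0, hn⟩⟩
  let φ : Fin N × Fin L × Bool → Fin M := fun x =>
    if x.2.2 = true then ⟨N * L + x.1 * L + x.2.1, labIdx_lt hM x.1.2 x.2.1.2⟩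
    else ⟨x.1 * L + x.2.1, srcIdx_lt hM x.1.2 x.2.1.2⟩
  have hφ : Function.Injective φ := by
    rintro ⟨b, i, c⟩ ⟨b', i', c'⟩ h
    have h1 := mul_add_lt b.2 i.2
    have h2 := mul_add_lt b'.2 i'.2
    have key : (b : ℕ) * L + i = b' * L + i' → (b, i) = (b', i') := fun h => by
      obtain ⟨h1, h2⟩ := mul_add_inj i.2 i'.2 h
      rw [Fin.ext h1, Fin.ext h2]
    cases c <;> cases c' <;> simp [φ] at h
    · simpa using key h
    · omega
    · omega
    · simpa using key (by omega)
  let ψ : Fin n ⊕ (Fin N × Fin L × Fin 3 × Fin d) ⊕ (Fin N × Fin (q.eval (n + M))) → Fin (coinCount d q n M) :=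
    Sum.elim (fun u => ⟨r * n + u, setIdx_lt r.2 u.2⟩)
      (Sum.elim (fun x => ⟨_, coinIdx_lt (srcIdx_lt hM x.1.2 x.2.1.2) x.2.2.1.2 x.2.2.2.2⟩)
        fun x => ⟨_, runIdx_lt (lt_of_lt_of_le x.1.2 hNM) x.2.2⟩)
  have hψ : Function.Injective ψ := by
    have b1 : ∀ u : Fin n, (r : ℕ) * n + u < M * n := fun u => mul_add_lt r.2 u.2
    have b2 : ∀ x : Fin N × Fin L × Fin 3 × Fin d,
        (x.1 * L + x.2.1 : ℕ) * (3 * d) + (x.2.2.1 * d + x.2.2.2) < M * (3 * d) := fun x =>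
      mul_add_lt (srcIdx_lt hM x.1.2 x.2.1.2) (mul_add_lt x.2.2.1.2 x.2.2.2.2)
    rintro (u | x | x) (u' | x' | x') h <;> simp only [ψ, Sum.elim_inl, Sum.elim_inr, Fin.mk.injEq] at h
    · rw [Fin.ext (show (u : ℕ) = u' by omega)]
    · have := b1 u; omega
    · have := b1 u; omega
    · have := b1 u'; omega
    · obtain ⟨b, i, c, e⟩ := x
      obtain ⟨b', i', c', e'⟩ := x'
      obtain ⟨h1, h2⟩ := mul_add_inj (mul_add_lt c.2 e.2) (mul_add_lt c'.2 e'.2)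
        (Nat.add_left_cancel h)
      obtain ⟨h3, h4⟩ := mul_add_inj i.2 i'.2 h1
      obtain ⟨h5, h6⟩ := mul_add_inj e.2 e'.2 h2
      rw [show b = b' from Fin.ext h3, show i = i' from Fin.ext h4, show c = c' from Fin.ext h5,
        show e = e' from Fin.ext h6]
    · have := b2 x; omega
    · have := b1 u'; omega
    · have := b2 x'; omega
    · obtain ⟨b, i⟩ := x
      obtain ⟨b', i'⟩ := x'
      obtain ⟨h1, h2⟩ := mul_add_inj i.2 i'.2 (Nat.add_left_cancel (Nat.add_left_cancel h))
      rw [show b = b' from Fin.ext h1, show i = i' from Fin.ext h2]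
  let R : (Fin N × Fin L × Bool → Fin d → Fin n) ×
      (Fin n ⊕ (Fin N × Fin L × Fin 3 × Fin d) ⊕ (Fin N × Fin (q.eval (n + M))) → Bool) →
      (Fin n → Bool) × (Fin N → Sample n d L (q.eval (n + M))) := fun z =>
    (fun u => z.2 (Sum.inl u), fun b => (fun i e => (z.1 (b, i, false) e, z.1 (b, i, true) e,
      z.2 (Sum.inr (Sum.inl (b, i, 0, e))), z.2 (Sum.inr (Sum.inl (b, i, 1, e))),
      z.2 (Sum.inr (Sum.inl (b, i, 2, e)))), fun i => z.2 (Sum.inr (Sum.inr (b, i)))))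
  have hR : Function.Bijective R := by
    refine Function.bijective_iff_has_inverse.2 ⟨fun y => (fun x e =>
      if x.2.2 = true then ((y.2 x.1).1 x.2.1 e).2.1 else ((y.2 x.1).1 x.2.1 e).1,
      Sum.elim y.1 (Sum.elim (fun x => ![((y.2 x.1).1 x.2.1 x.2.2.2).2.2.1,
        ((y.2 x.1).1 x.2.1 x.2.2.2).2.2.2.1, ((y.2 x.1).1 x.2.1 x.2.2.2).2.2.2.2] x.2.2.1)
        fun x => (y.2 x.1).2 x.2)), fun z => ?_, fun y => ?_⟩
    · refine Prod.ext (funext fun ⟨b, i, c⟩ => ?_) (funext ?_)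
      · cases c <;> rfl
      · rintro (u | ⟨b, i, c, e⟩ | x)
        · rfl
        · fin_cases c <;> rfl
        · rfl
    · rfl
  have h1 := (UnifMap.precomp (α := Fin d → Fin n) hφ).prodMap (UnifMap.precomp (α := Bool) hψ)
  exact (UnifMap.of_bijective hR).comp h1

/-- Different random sets are uniformly random and independent. -/
theorem unifMap_sets {N : ℕ} (hn : 0 < n) (hNM : N ≤ M) :
    UnifMap fun (o : Outcome d q n M) (r : Fin N) => o.set (r.castLE hNM) := by
  have : Nonempty (Fin n) := ⟨⟨0, hn⟩⟩
  let ψ : Fin N × Fin n → Fin (coinCount d q n M) := fun x =>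
    ⟨x.1 * n + x.2, setIdx_lt (lt_of_lt_of_le x.1.2 hNM) x.2.2⟩
  have hψ : Function.Injective ψ := by
    rintro ⟨b, i⟩ ⟨b', i'⟩ h
    simp only [ψ, Fin.mk.injEq] at h
    obtain ⟨h1, h2⟩ := mul_add_inj i.2 i'.2 h
    rw [Fin.ext h1, Fin.ext h2]
  have hR : UnifMap fun (z : Fin N × Fin n → Bool) r u => z (r, u) :=
    UnifMap.of_bijective (Equiv.curry (Fin N) (Fin n) Bool).bijective
  have hsnd : UnifMap fun o : Outcome d q n M => o.2 :=
    UnifMap.fst.comp (UnifMap.of_bijective (Equiv.prodComm _ _).bijective)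
  exact hR.comp ((UnifMap.precomp hψ).comp hsnd)

/-- The last coin and a fixed vertex of a fixed hyperedge are uniformly random and independent. -/
theorem unifMap_guess (hn : 0 < n) (i : Fin M) (e : Fin d) :
    UnifMap fun o : Outcome d q n M => (o.1 i e, o.lastCoin) := by
  have : Nonempty (Fin n) := ⟨⟨0, hn⟩⟩
  have h1 : UnifMap fun G : Hypergraph n M d => G i e := by
    have h2 : UnifMap fun f : Unit → Fin n => f () :=
      UnifMap.of_bijective (Equiv.funUnique Unit (Fin n)).bijective
    have h3 : UnifMap fun G : Hypergraph n M d => G i :=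
      (UnifMap.of_bijective (Equiv.funUnique Unit (Fin d → Fin n)).bijective).comp
        (UnifMap.precomp (φ := fun _ : Unit => i) fun _ _ _ => rfl)
    exact h2.comp ((UnifMap.precomp (φ := fun _ : Unit => e) fun _ _ _ => rfl).comp h3)
  have h4 : UnifMap fun w : Fin (coinCount d q n M) → Bool => w ⟨_, Nat.lt_succ_self _⟩ :=
    (UnifMap.of_bijective (Equiv.funUnique Unit Bool).bijective).comp
      (UnifMap.precomp (φ := fun _ : Unit => (⟨_, Nat.lt_succ_self _⟩ : Fin (coinCount d q n M))) fun _ _ _ => rfl)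
  exact h1.prodMap h4

end sample

theorem size_lt {m p : ℕ} (hpM : p * p * (4 * 16 ^ d * m) + 1 = M) :
    p * p * (2 * 16 ^ d * m) + p * p * (2 * 16 ^ d * m) < M := by
  rw [← hpM]
  have : p * p * (4 * 16 ^ d * m) = p * p * (2 * 16 ^ d * m) + p * p * (2 * 16 ^ d * m) := by ring
  omega

theorem exceeds_iff {D : Cmd} {m p : ℕ} (hpM : p * p * (4 * 16 ^ d * m) + 1 = M) (hp : p * p ≤ M)
    (r : Fin M) (k j : Fin n) :
    (o.ctx P s).exceeds d D q p m r k j = true ↔ (p : ℝ) * (8 * (d + 1) * lg n : ℕ) <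
      ∑ b, (o.sample (size_lt hpM) hp b).gap P D m s (o.set r) k j := by
  have hcount : ∀ mix, ((o.ctx P s).count d D q (p * p) (2 * 16 ^ d * m) m r k j mix : ℝ)
      = ∑ b, if (o.sample (size_lt hpM) hp b).batch P D m s (o.set r) k j mix = true
        then (1 : ℝ) else 0 := by
    intro mix
    rw [Ctx.count, length_filter_range]
    exact Finset.sum_congr rfl fun b _ => by
      rw [o.ctx_batch P s (size_lt hpM) hp m r k j mix b]
  simp only [Sample.gap]
  rw [Ctx.exceeds, decide_eq_true_eq, Finset.sum_sub_distrib, ← hcount, ← hcount, ← Nat.cast_lt (α := ℝ)]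
  push_cast
  rw [lt_sub_iff_add_lt']
  rfl

end Outcome

/-! ### From the given instance to a random one -/

section hybrid
variable {d n m : ℕ} (P : (Fin d → Bool) → Bool) (D : Cmd) (s : Fin n → Bool)

/-- The laws of the bits of the vertices when the bits of the vertices below `k` are random. -/
def stepLaw (k : ℕ) (w : Fin n) (x : Bool) : ℝ := if (w : ℕ) < k then 1 / 2 else dirac (s w) x

theorem prod_dirac {ι : Type} [Fintype ι] [DecidableEq ι] (f x : ι → Bool) :
    ∏ i, dirac (f i) (x i) = if f = x then 1 else 0 := by
  simp only [dirac, Finset.prod_ite_zero, Finset.prod_const_one, Finset.mem_univ, true_imp_iff,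
    funext_iff]

/-- Without random bits, the output bits are those of the local function. -/
theorem hybrid_stepLaw_zero : hybrid P D m (stepLaw s 0)
    = 𝔼 G : Hypergraph n m d, acceptProb D G (localFn P G s) := by
  classical
  refine Finset.expect_congr rfl fun G _ => ?_
  have h : ∀ w y, bitLaw P (stepLaw s 0) w y = dirac (P fun e => s (w e)) y := by
    intro w y
    simp only [bitLaw, stepLaw, Nat.not_lt_zero, if_false]
    simp only [prod_dirac fun e => s (w e), ← ite_and]
    rw [Finset.sum_eq_single fun e => s (w e)]
    · simp [dirac]
    · intro x _ hx
      rw [if_neg]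
      exact fun h => hx h.2.symm
    · simp
  simp only [h]
  rw [Finset.sum_eq_single (localFn P G s)]
  · rw [prod_dirac fun i => P fun e => s (G i e)]
    change (if localFn P G s = localFn P G s then (1 : ℝ) else 0) * _ = _
    rw [if_pos rfl, one_mul]
  · intro y _ hy
    rw [prod_dirac fun i => P fun e => s (G i e), if_neg (fun h => hy h.symm), zero_mul]
  · simp

/-- With random bits at all vertices, the output bits are independent and biased. -/
theorem hybrid_stepLaw_last : hybrid P D m (stepLaw s n)
    = 𝔼 G : Hypergraph n m d, ∑ b, bernWeight (bias P) b * acceptProb D G b := by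
  classical
  refine Finset.expect_congr rfl fun G _ => Finset.sum_congr rfl fun b _ => ?_
  congr 1
  refine Finset.prod_congr rfl fun i _ => ?_
  have h : ∀ y, bitLaw P (stepLaw s n) (G i) y = 𝔼 x, if P x = y then (1 : ℝ) else 0 := by
    intro y
    simp only [bitLaw, stepLaw, Fin.is_lt, if_true]
    rw [Fintype.expect_eq_sum_div_card, Finset.sum_div]
    refine Finset.sum_congr rfl fun x _ => ?_
    split_ifs <;> simp
  rw [h]
  rcases b i with _ | _
  · rw [bias, if_neg (by simp), eq_sub_iff_add_eq, ← Finset.expect_add_distrib]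
    refine (Finset.expect_congr rfl fun x _ => ?_).trans (Fintype.expect_const (1 : ℝ))
    rcases P x with _ | _ <;> simp
  · rw [bias, if_pos rfl]

/-- Some vertex matters when the bits are replaced by random bits, one after the other. -/
theorem exists_step {δ : ℝ} (hn : 0 < n)
    (h : δ ≤ hybrid P D m (stepLaw s 0) - hybrid P D m (stepLaw s n)) :
    ∃ k : Fin n, δ / n ≤ hybrid P D m (stepLaw s k) - hybrid P D m (stepLaw s (k + 1)) := by
  by_contra! hlt
  have : Nonempty (Fin n) := ⟨⟨0, hn⟩⟩
  have h1 := Finset.sum_lt_sum_of_nonempty (s := (Finset.univ : Finset (Fin n)))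
    Finset.univ_nonempty fun k _ => hlt k
  rw [Fin.sum_univ_eq_sum_range fun k => hybrid P D m (stepLaw s k) - hybrid P D m (stepLaw s (k + 1)),
    Finset.sum_range_sub'] at h1
  have hn' : (n : ℝ) ≠ 0 := by positivity
  simp only [Finset.sum_const, Finset.card_univ, Fintype.card_fin, nsmul_eq_mul] at h1
  rw [mul_div_cancel₀ _ hn'] at h1
  linarith

/-- The bits of the elements of `T` are ones and zeros equally often. -/
def Balanced (T : Fin n → Bool) : Prop :=
  ∀ x, 2 * ∑ v, (if T v = true then dirac (s v) x else 0) = card T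

variable {s}

/-- A balanced set provides random bits for the vertices below `k`. -/
theorem vertexLaw_false {T : Fin n → Bool} (hT : card T ≠ 0) (hB : Balanced s T) (k j : Fin n) :
    vertexLaw s T k j false = stepLaw s k := by
  funext w x
  have h : (∑ v, if T v = true then dirac (s v) x else 0) / card T = 1 / 2 := by
    rw [div_eq_iff hT]
    linarith [hB x]
  unfold vertexLaw stepLaw
  rw [h]
  rcases lt_trichotomy w k with hw | rfl | hw
  · simp [hw]
  · simp
  · simp [hw.not_gt, hw.ne']

/-- If `k` and `j` carry different bits, then mixing them makes the bit of `k` random as well. -/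
theorem vertexLaw_true {T : Fin n → Bool} (hT : card T ≠ 0) (hB : Balanced s T) {k j : Fin n}
    (hkj : s k ≠ s j) : vertexLaw s T k j true = stepLaw s (k + 1) := by
  funext w x
  have h : (∑ v, if T v = true then dirac (s v) x else 0) / card T = 1 / 2 := by
    rw [div_eq_iff hT]
    linarith [hB x]
  unfold vertexLaw stepLaw
  rw [h]
  rcases lt_trichotomy w k with hw | rfl | hw
  · have : (w : ℕ) < k + 1 := Nat.lt_succ_of_lt hw
    simp [hw, this]
  · have : dirac (s w) x + dirac (s j) x = 1 := by
      unfold dirac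
      cases x <;> cases h1 : s w <;> cases h2 : s j <;> simp_all
    simp [this]
  · have : ¬(w : ℕ) < k + 1 := by
      have : (k : ℕ) < w := hw
      omega
    simp [hw.not_gt, hw.ne', this]

end hybrid

section test
variable {d n M m p : ℕ} {P : (Fin d → Bool) → Bool} {D : Cmd} {q : Polynomial ℕ}
  {s : Fin n → Bool}

theorem expect_gap {L Q : ℕ} (hD : ∀ (n m : ℕ) (G : Hypergraph n m d) (y : Fin m → Bool),
      HaltsWithin D (encodeInstance G y) (q.eval (n + m))) (hQ : q.eval (n + m) ≤ Q)
    {T : Fin n → Bool} (hT : card T ≠ 0) (k j : Fin n) :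
    𝔼 z : Sample n d L Q, z.gap P D m s T k j = binomTail ((card T / (4 * n)) ^ d) L m *
      (hybrid P D m (vertexLaw s T k j false) - hybrid P D m (vertexLaw s T k j true)) := by
  simp only [Sample.gap]
  rw [Finset.expect_sub_distrib, expect_batch P hD hQ s T hT k j, expect_batch P hD hQ s T hT k j]
  ring

/-- If `k` and `j` carry the same bit, then mixing them changes nothing, whatever the set is. -/
theorem expect_gap_of_eq {L Q : ℕ} (hD : ∀ (n m : ℕ) (G : Hypergraph n m d) (y : Fin m → Bool),
      HaltsWithin D (encodeInstance G y) (q.eval (n + m))) (hQ : q.eval (n + m) ≤ Q)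
    (T : Fin n → Bool) {k j : Fin n} (hkj : s k = s j) :
    𝔼 z : Sample n d L Q, z.gap P D m s T k j = 0 := by
  by_cases hT : card T = 0
  · have hT' : ∀ v, T v = false := by
      intro v
      rw [card, Finset.sum_eq_zero_iff_of_nonneg fun v _ => by split_ifs <;> norm_num] at hT
      simpa using hT v (Finset.mem_univ v)
    have h : ∀ (mix : Bool) (a : Entry n), a.ok T k j mix = false := by
      intro mix a
      simp [Entry.ok, hT']
    refine (Finset.expect_congr rfl fun z _ => ?_).trans (Finset.expect_const_zero _)
    simp [Sample.gap, Sample.batch, trial, h]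
  · rw [expect_gap hD hQ hT]
    have : vertexLaw s T k j false = vertexLaw s T k j true := by
      funext w x
      simp [vertexLaw, hkj]
    rw [this, sub_self, mul_zero]

/-- The significance threshold of the tests, in units of `p`. -/
def threshold (d n : ℕ) : ℝ := (8 * (d + 1) * lg n : ℕ)

theorem Outcome.le_of_size (hm : 0 < m) (hp : 0 < p) (hpM : p * p * (4 * 16 ^ d * m) + 1 = M) :
    p * p ≤ M ∧ m ≤ M := by
  have h1 : 0 < 16 ^ d := by positivity
  have h3 : 0 < p * p := by positivity
  rw [← hpM]
  constructor
  · have : 1 ≤ 4 * 16 ^ d * m := Nat.succ_le_of_lt (by positivity)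
    nlinarith
  · have : 1 ≤ p * p * 16 ^ d := Nat.succ_le_of_lt (by positivity)
    nlinarith

/-- For vertices with the same bit, the numbers of accepted batches rarely differ much. -/
theorem prob_gap_gt_le {L : ℕ} (hD : ∀ (n m : ℕ) (G : Hypergraph n m d) (y : Fin m → Bool),
      HaltsWithin D (encodeInstance G y) (q.eval (n + m))) (hn : 0 < n) (hmM : m ≤ M) (hp : 0 < p)
    (hM : p * p * L + p * p * L < M) (hpp : p * p ≤ M) (r : Fin M) {k j : Fin n}
    (hkj : s k = s j) {t : ℝ} (ht : 0 ≤ t) :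
    prob (fun o : Outcome d q n M => p * t < ∑ b, (o.sample hM hpp b).gap P D m s (o.set r) k j)
      ≤ Real.exp (-t ^ 2 / 2) := by
  have : Nonempty (Fin n) := ⟨⟨0, hn⟩⟩
  have hQ : q.eval (n + m) ≤ q.eval (n + M) := eval_mono q (Nat.add_le_add_left hmM n)
  have h := (Outcome.unifMap_set_sample (q := q) (d := d) hn hM hpp r).prob
    fun z => (p : ℝ) * t < ∑ b, (z.2 b).gap P D m s z.1 k j
  refine h.le.trans (prob_prod_le fun T => ?_)
  have h2 := prob_sum_ge_le (X := fun z : Sample n d L (q.eval (n + M)) => z.gap P D m s T k j)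
    (Sample.abs_gap_le P D m s T k j) (expect_gap_of_eq hD hQ T hkj).le p ht hp
  exact (prob_mono fun z hz => le_of_lt hz).trans h2

/-- Vertices with the same bit rarely pass the test. -/
theorem prob_exceeds_le (hD : ∀ (n m : ℕ) (G : Hypergraph n m d) (y : Fin m → Bool),
      HaltsWithin D (encodeInstance G y) (q.eval (n + m))) (hn : 0 < n) (hm : 0 < m)
    (hpM : p * p * (4 * 16 ^ d * m) + 1 = M) {r : ℕ} (hr : r < p * p) {k j : Fin n}
    (hkj : s k = s j) :
    prob (fun o : Outcome d q n M => (o.ctx P s).exceeds d D q p m r k j = true)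
      ≤ Real.exp (-threshold d n ^ 2 / 2) := by
  have hp : 0 < p := by
    rcases Nat.eq_zero_or_pos p with rfl | h
    · simp at hr
    · exact h
  obtain ⟨hpp, hmM⟩ := Outcome.le_of_size hm hp hpM
  refine (prob_mono fun o ho => (o.exceeds_iff P s hpM hpp ⟨r, lt_of_lt_of_le hr hpp⟩ k j).1 ho).trans
    (prob_gap_gt_le hD hn hmM hp (Outcome.size_lt hpM) hpp _ hkj (Nat.cast_nonneg _))

theorem card_le (T : Fin n → Bool) : card T ≤ n := by
  refine (Finset.sum_le_sum (g := fun _ => (1 : ℝ)) fun v _ => ?_).trans (by simp)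
  split_ifs <;> norm_num

/-- If the set is not small, a batch has enough successful trials with a probability that is bounded
below in terms of `d`. -/
theorem le_binomTail {n : ℕ} (hn : 0 < n) {T : Fin n → Bool} (hT : n ≤ 4 * card T) (hm : 0 < m) {L : ℕ}
    (hL : L = 2 * 16 ^ d * m) :
    1 ≤ 2 * 16 ^ d * binomTail ((card T / (4 * n)) ^ d) L m := by
  have hn' : (0 : ℝ) < n := by exact_mod_cast hn
  set κ := (card T / (4 * n)) ^ d with hκ
  have hbase : (1 : ℝ) / 16 ≤ card T / (4 * n) := by
    rw [div_le_div_iff₀ (by norm_num) (by positivity)]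
    linarith
  have hκ0 : (1 / 16 : ℝ) ^ d ≤ κ := pow_le_pow_left₀ (by norm_num) hbase d
  have hκ1 : κ ≤ 1 := by
    refine pow_le_one₀ (le_trans (by norm_num) hbase) ?_
    rw [div_le_one (by positivity)]
    linarith [card_le T]
  have h16 : (0 : ℝ) < 16 ^ d := by positivity
  have hm' : (0 : ℝ) < m := by exact_mod_cast hm
  have hβ := le_mul_binomTail (le_trans (by positivity) hκ0) hκ1 L m le_rfl
  have hL' : (L : ℝ) = 2 * 16 ^ d * m := by rw [hL]; push_cast; ring
  rw [hL'] at hβ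
  have e1 : (16 : ℝ) ^ d * (1 / 16) ^ d = 1 := by rw [← mul_pow]; norm_num
  have e2 := mul_le_mul_of_nonneg_left hκ0 h16.le
  rw [e1] at e2
  have e4 := mul_le_mul_of_nonneg_left e2 hm'.le
  have e3 : (m : ℝ) * 1 ≤ m * (2 * 16 ^ d * binomTail κ L m) := by linarith
  exact le_of_mul_le_mul_left e3 hm'

/-- At a vertex that matters, and for a vertex `j` with a different bit, the numbers of accepted
batches usually differ significantly. -/
theorem prob_gap_le_le {L : ℕ} (hD : ∀ (n m : ℕ) (G : Hypergraph n m d) (y : Fin m → Bool),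
      HaltsWithin D (encodeInstance G y) (q.eval (n + m))) (hn : 0 < n) (hm : 0 < m) (hmM : m ≤ M)
    (hp : 0 < p) (hL : L = 2 * 16 ^ d * m)
    (hM : p * p * L + p * p * L < M) (hpp : p * p ≤ M) (r : Fin M) {k j : Fin n}
    (hkj : s k ≠ s j) {t γ : ℝ} (ht : 0 ≤ t)
    (hγ : γ ≤ hybrid P D m (stepLaw s k) - hybrid P D m (stepLaw s (k + 1)))
    (h1 : t ≤ p) (h5 : 10 * 16 ^ d * t ≤ p * γ) :
    prob (fun o : Outcome d q n M => (Balanced s (o.set r) ∧ n ≤ 4 * card (o.set r)) ∧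
      ∑ b, (o.sample hM hpp b).gap P D m s (o.set r) k j ≤ p * t) ≤ Real.exp (-t ^ 2 / 2) := by
  have : Nonempty (Fin n) := ⟨⟨0, hn⟩⟩
  have hn' : (0 : ℝ) < n := by exact_mod_cast hn
  have hp' : (0 : ℝ) < p := by exact_mod_cast hp
  have hQ : q.eval (n + m) ≤ q.eval (n + M) := eval_mono q (Nat.add_le_add_left hmM n)
  have h := (Outcome.unifMap_set_sample (q := q) (d := d) hn hM hpp r).prob
    fun z => (Balanced s z.1 ∧ n ≤ 4 * card z.1) ∧ ∑ b, (z.2 b).gap P D m s z.1 k j ≤ (p : ℝ) * t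
  refine h.le.trans (prob_prod_le fun T => ?_)
  by_cases hT : Balanced s T ∧ n ≤ 4 * card T
  · have h2 := prob_sum_le_le (X := fun z : Sample n d L (q.eval (n + M)) => z.gap P D m s T k j)
      (Sample.abs_gap_le P D m s T k j) p ht h1 hp
    refine (prob_mono fun z hz => hz.2).trans (h2 ?_)
    have hT0 : 0 < card T := by linarith [hT.2]
    have hβ := le_binomTail (d := d) hn hT.2 hm hL
    rw [expect_gap hD hQ hT0.ne', vertexLaw_false hT0.ne' hT.1, vertexLaw_true hT0.ne' hT.1 hkj]
    generalize hybrid P D m (stepLaw s k) - hybrid P D m (stepLaw s (k + 1)) = F at hγ ⊢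
    generalize binomTail _ L m = B at hβ ⊢
    have h16 : (0 : ℝ) < 16 ^ d := by positivity
    have hγ0 : 0 ≤ p * γ := le_trans (by positivity) h5
    have hpF : p * γ ≤ p * F := mul_le_mul_of_nonneg_left hγ hp'.le
    have h6 : p * F ≤ 2 * 16 ^ d * B * (p * F) := le_mul_of_one_le_left (by linarith) hβ
    have h7 : 2 * 16 ^ d * (5 * t) ≤ 2 * 16 ^ d * (p * (B * F)) := by linarith
    exact le_of_mul_le_mul_left h7 (by positivity)
  · rw [prob_congr (q := fun _ => False) (by tauto)]
    classical
    rw [prob_eq_expect]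
    simp only [if_false, Finset.expect_const_zero]
    positivity

/-- If the random set is large and balanced, the test rarely fails at a vertex that matters. -/
theorem prob_not_exceeds_le (hD : ∀ (n m : ℕ) (G : Hypergraph n m d) (y : Fin m → Bool),
      HaltsWithin D (encodeInstance G y) (q.eval (n + m))) (hn : 0 < n) (hm : 0 < m) (hp : 0 < p)
    (hpM : p * p * (4 * 16 ^ d * m) + 1 = M) (r : Fin M) {k j : Fin n}
    (hkj : s k ≠ s j) {γ : ℝ}
    (hγ : γ ≤ hybrid P D m (stepLaw s k) - hybrid P D m (stepLaw s (k + 1)))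
    (h1 : threshold d n ≤ p) (h5 : 10 * 16 ^ d * threshold d n ≤ p * γ) :
    prob (fun o : Outcome d q n M => (Balanced s (o.set r) ∧ n ≤ 4 * card (o.set r)) ∧
      ¬(o.ctx P s).exceeds d D q p m r k j = true) ≤ Real.exp (-threshold d n ^ 2 / 2) := by
  obtain ⟨hpp, hmM⟩ := Outcome.le_of_size hm hp hpM
  exact (prob_mono fun o ho => And.imp_right (fun h => not_lt.1 fun h' =>
    h ((o.exceeds_iff P s hpM hpp r k j).2 h')) ho).trans
    (prob_gap_le_le hD hn hm hmM hp rfl (Outcome.size_lt hpM) hpp r hkj (Nat.cast_nonneg _) hγ h1 h5)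

end test

/-! ### Random balanced sets -/

section balanced
variable {n : ℕ}

theorem balanced_iff (s T : Fin n → Bool) :
    Balanced s T ↔ card (fun v => xor (T v) (s v)) = card s := by
  have h1 : card (fun v => xor (T v) (s v)) = card s - (∑ v, if T v = true then dirac (s v) true else 0)
      + ∑ v, if T v = true then dirac (s v) false else 0 := by
    simp only [card]
    rw [← Finset.sum_sub_distrib, ← Finset.sum_add_distrib]
    refine Finset.sum_congr rfl fun v _ => ?_
    have : ∀ a b : Bool, (if xor a b = true then (1 : ℝ) else 0) = (if b = true then 1 else 0) -
        (if a = true then dirac b true else 0) + if a = true then dirac b false else 0 := by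
      intro a b
      cases a <;> cases b <;> simp [dirac]
    exact this (T v) (s v)
  have h2 : card T = (∑ v, if T v = true then dirac (s v) true else 0)
      + ∑ v, if T v = true then dirac (s v) false else 0 := by
    simp only [card]
    rw [← Finset.sum_add_distrib]
    refine Finset.sum_congr rfl fun v _ => ?_
    rcases T v with _ | _ <;> rcases s v with _ | _ <;> simp [dirac]
  simp only [Balanced, Bool.forall_bool]
  rw [h1, h2]
  constructor
  · intro h
    linarith [h.1]
  · intro h
    constructor <;> linarith

/-- A random set is balanced for `s` as often as a random string has as many ones as `s`. -/
theorem prob_balanced (s : Fin n → Bool) :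
    prob (fun T => Balanced s T) = prob fun u : Fin n → Bool => card u = card s := by
  rw [prob_congr fun T => balanced_iff s T]
  refine (UnifMap.of_bijective (Ψ := fun (T : Fin n → Bool) v => xor (T v) (s v)) ?_).prob
    fun u => card u = card s
  refine Function.Involutive.bijective fun T => ?_
  funext v
  simp

theorem card_eq_nat (T : Fin n → Bool) :
    card T = (Finset.univ.filter fun v => T v = true).card := by
  rw [card, Finset.natCast_card_filter]

/-- For most strings, a random set is balanced with a substantial probability. -/
theorem prob_prob_balanced_lt (n : ℕ) {θ : ℝ} (hθ : 0 ≤ θ) :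
    prob (fun s : Fin n → Bool => prob (fun T => Balanced s T) < θ) ≤ (n + 1) * θ := by
  have h1 : ∀ s : Fin n → Bool, prob (fun T => Balanced s T) < θ → ∃ c ∈ Finset.range (n + 1),
      card s = (c : ℕ) ∧ prob (fun u : Fin n → Bool => card u = (c : ℕ)) < θ := by
    intro s hs
    rw [prob_balanced] at hs
    refine ⟨_, ?_, card_eq_nat s, by rw [← card_eq_nat]; exact hs⟩
    rw [Finset.mem_range, Nat.lt_succ_iff]
    exact (Finset.card_le_univ _).trans (by simp)
  refine (prob_mono h1).trans ((prob_exists_le _ _).trans ?_)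
  have h2 : ∀ c : ℕ, prob (fun s : Fin n → Bool => card s = (c : ℕ) ∧
      prob (fun u : Fin n → Bool => card u = (c : ℕ)) < θ) ≤ θ := by
    intro c
    by_cases h : prob (fun u : Fin n → Bool => card u = (c : ℕ)) < θ
    · exact (prob_mono fun s hs => hs.1).trans h.le
    · refine (prob_mono (q := fun _ => False) fun s hs => h hs.2).trans ?_
      classical
      rw [prob_eq_expect]
      simpa using hθ
  exact (Finset.sum_le_sum fun c _ => h2 c).trans (by simp)

/-- Random sets are rarely small. -/
theorem prob_card_lt_le (n : ℕ) : prob (fun T : Fin n → Bool => 4 * card T < n) ≤ (9 / 10) ^ n := by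
  classical
  -- the exponential moment method, with `√2 ^ 4 = 4`
  set c : ℝ := Real.sqrt 2 with hc
  have hc2 : c ^ 2 = 2 := Real.sq_sqrt (by norm_num)
  have hc4 : c ^ 4 = 4 := by rw [show c ^ 4 = (c ^ 2) ^ 2 by ring, hc2]; norm_num
  have hc0 : 0 ≤ c := Real.sqrt_nonneg 2
  have hc1 : 1 ≤ c := by nlinarith
  have hprod : ∀ T : Fin n → Bool, ∏ v, (c * if T v = true then (1 / 4 : ℝ) else 1)
      = c ^ n * (1 / 4) ^ (Finset.univ.filter fun v => T v = true).card := by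
    intro T
    rw [Finset.prod_mul_distrib, Finset.prod_const, Finset.card_univ, Fintype.card_fin,
      Finset.prod_ite]
    simp
  have h1 : prob (fun T : Fin n → Bool => 4 * card T < n)
      ≤ 𝔼 T : Fin n → Bool, ∏ v, (c * if T v = true then (1 / 4 : ℝ) else 1) := by
    rw [prob_eq_expect]
    refine Finset.expect_le_expect fun T _ => ?_
    split_ifs with h
    · rw [hprod, card_eq_nat] at *
      set k := (Finset.univ.filter fun v => T v = true).card
      have hk : 4 * k ≤ n := by exact_mod_cast h.le
      rw [div_pow, one_pow, mul_one_div, one_le_div (by positivity), ← hc4, ← pow_mul]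
      exact pow_le_pow_right₀ hc1 hk
    · exact Finset.prod_nonneg fun v _ => by positivity
  refine h1.trans ?_
  rw [expect_prod_pi fun (_ : Fin n) (b : Bool) => c * if b = true then (1 / 4 : ℝ) else 1,
    Finset.prod_const, Finset.card_univ, Fintype.card_fin]
  refine pow_le_pow_left₀ (Finset.expect_nonneg fun b _ => by positivity) ?_ n
  rw [Fintype.expect_eq_sum_div_card]
  simp
  nlinarith

end balanced

/-! ### Correctness of the inverting algorithm -/

namespace Outcome
variable {d n M : ℕ} {P : (Fin d → Bool) → Bool} {D : Cmd} {q : Polynomial ℕ} {s : Fin n → Bool}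

theorem invert_eq_iff (o : Outcome d q n M) : (o.ctx P s).invert d D q = List.ofFn s ↔
    ∀ i : Fin n, (if (∃ k : Fin n, (o.ctx P s).detected d D q k ((o.ctx P s).vtx (M - 1) 0) = true ∧
      (o.ctx P s).detected d D q k i = true) then o.lastCoin else !o.lastCoin) = s i := by
  classical
  rw [Ctx.invert, ctx_M, ctx_lastCoin]
  change List.map _ (List.range n) = _ ↔ _
  have hr : List.range n = (List.finRange n).map fun i : Fin n => (i : ℕ) :=
    List.map_coe_finRange_eq_range.symm
  rw [hr, List.map_map, List.ofFn_eq_map, List.map_inj_left]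
  simp only [List.mem_finRange, true_imp_iff, Function.comp_apply]
  refine forall_congr' fun i => Eq.congr_left ?_
  refine if_congr ?_ rfl rfl
  change ((List.range n).any _) = true ↔ _
  simp only [List.any_eq_true, List.mem_range, Bool.and_eq_true]
  exact ⟨fun ⟨k, hk, h⟩ => ⟨⟨k, hk⟩, h⟩, fun ⟨k, h⟩ => ⟨k, k.2, h⟩⟩

/-- The proposed string is correct if all detected differences are differences, if the differences
from one vertex with another bit than the random vertex are detected, and if the guess is correct. -/
theorem invert_eq_of_detected (o : Outcome d q n M) {v k : Fin n}
    (hv : (o.ctx P s).vtx (M - 1) 0 = v)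
    (sound : ∀ k j : Fin n, (o.ctx P s).detected d D q k j = true → s k ≠ s j)
    (complete : ∀ j, s k ≠ s j → (o.ctx P s).detected d D q k j = true)
    (hk : s k ≠ s v) (hb : o.lastCoin = s v) : (o.ctx P s).invert d D q = List.ofFn s := by
  rw [invert_eq_iff, hv, hb]
  intro i
  by_cases hi : s i = s v
  · rw [if_pos ⟨k, complete v hk, complete i (by rw [hi]; exact hk)⟩, hi]
  · rw [if_neg]
    · revert hi
      cases s i <;> cases s v <;> simp
    · rintro ⟨k', h1, h2⟩
      have h1 := sound _ _ h1
      have h2 := sound _ _ h2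
      revert hi h1 h2
      cases s i <;> cases s v <;> cases s k' <;> simp

theorem invert_eq_of_const (o : Outcome d q n M) {v : Fin n}
    (hv : (o.ctx P s).vtx (M - 1) 0 = v)
    (sound : ∀ k j : Fin n, (o.ctx P s).detected d D q k j = true → s k ≠ s j)
    (hs : ∀ i, s i = s v) (hb : o.lastCoin = !s v) : (o.ctx P s).invert d D q = List.ofFn s := by
  rw [invert_eq_iff, hv, hb]
  intro i
  rw [if_neg, hs i, Bool.not_not]
  rintro ⟨k, h1, -⟩
  exact sound _ _ h1 (hs k)

end Outcome

/-! ### Conclusive evidence -/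

namespace Outcome
variable {d n M : ℕ} {P : (Fin d → Bool) → Bool} {D : Cmd} {q : Polynomial ℕ} {s : Fin n → Bool}

theorem conclusive_sound (o : Outcome d q n M) {k j : Fin n}
    (h : (o.ctx P s).conclusive d k j = true) : s k ≠ s j := by
  simp only [Ctx.conclusive, List.any_eq_true, List.mem_range, ctx_M] at h
  obtain ⟨x, hx, z, hz, h⟩ := h
  simp only [Ctx.clash, Bool.and_eq_true, Bool.not_eq_true', beq_eq_false_iff_ne, List.all_eq_true,
    List.mem_range, beq_iff_eq] at h
  intro hkj
  refine h.1 ?_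
  have hbx := o.ctx_bit P s ⟨x, hx⟩
  have hbz := o.ctx_bit P s ⟨z, hz⟩
  rw [hbx, hbz]
  congr 1
  funext e
  have he := h.2 e e.2
  have hvx := o.ctx_vtx P s ⟨x, hx⟩ e
  have hvz := o.ctx_vtx P s ⟨z, hz⟩ e
  simp only at hvx hvz
  rw [hvx, hvz] at he
  have key : ∀ v w : Fin n, Ctx.merge k j v = Ctx.merge k j w → s v = s w := by
    intro v w hvw
    simp only [Ctx.merge, beq_iff_eq, Fin.val_inj] at hvw
    by_cases h1 : v = j <;> by_cases h2 : w = j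
    · rw [h1, h2]
    · rw [if_pos h1, if_neg h2, Fin.val_inj] at hvw
      rw [h1, ← hvw, hkj]
    · rw [if_neg h1, if_pos h2, Fin.val_inj] at hvw
      rw [h2, hvw, hkj]
    · rw [if_neg h1, if_neg h2, Fin.val_inj] at hvw
      rw [hvw]
  exact key _ _ he

/-- If all tuples occur, then so do two that consist of `k` and `j` only and whose bits are `x` and
`x'`. They become equal when `j` is replaced by `k`. -/
theorem conclusive_complete (o : Outcome d q n M) (hall : ∀ t, ∃ i, o.1 i = t)
    {x x' : Fin d → Bool} (hP : P x ≠ P x') {k j : Fin n} (hkj : s k ≠ s j) :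
    (o.ctx P s).conclusive d k j = true := by
  have hbit : ∀ b, b ≠ s k → s j = b := by
    intro b
    revert hkj
    cases b <;> cases s k <;> cases s j <;> simp
  have hs : ∀ x : Fin d → Bool, (fun e => s (if x e = s k then k else j)) = x := by
    intro x
    funext e
    split_ifs with h
    · exact h.symm
    · exact hbit _ h
  obtain ⟨i, hi⟩ := hall fun e => if x e = s k then k else j
  obtain ⟨i', hi'⟩ := hall fun e => if x' e = s k then k else j
  simp only [Ctx.conclusive, List.any_eq_true, List.mem_range, ctx_M]
  refine ⟨i, i.2, i', i'.2, ?_⟩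
  simp only [Ctx.clash, Bool.and_eq_true, Bool.not_eq_true', beq_eq_false_iff_ne, List.all_eq_true,
    List.mem_range, beq_iff_eq]
  constructor
  · rw [ctx_bit, ctx_bit, hi, hi', hs, hs]
    exact hP
  · intro e he
    have hv := o.ctx_vtx P s i ⟨e, he⟩
    have hv' := o.ctx_vtx P s i' ⟨e, he⟩
    simp only at hv hv'
    rw [hv, hv', hi, hi']
    have : ∀ a : Bool, Ctx.merge k j (if a = s k then k else j : Fin n) = k := by
      intro a
      unfold Ctx.merge
      split_ifs <;> simp_all
    rw [this, this]

/-- All tuples occur among sufficiently many random hyperedges. -/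
theorem prob_missing_le (hn : 0 < n) (hM : (d + 4) * n ^ (d + 1) ≤ M) :
    prob (fun o : Outcome d q n M => ∃ t, ∀ i, o.1 i ≠ t) ≤ 1 / 4 := by
  have : Nonempty (Fin n) := ⟨⟨0, hn⟩⟩
  have hn' : (0 : ℝ) < n := by exact_mod_cast hn
  have h0 : ∀ t : Fin d → Fin n, prob (fun G : Hypergraph n M d => ∀ i, G i ≠ t)
      ≤ Real.exp (-((d + 4) * n)) := by
    intro t
    rw [prob_forall_not fun w => w = t]
    have ht : prob (fun w : Fin d → Fin n => w = t) = 1 / n ^ d := by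
      rw [prob_eq_expect, Fintype.expect_eq_sum_div_card]
      simp
    rw [ht, Fintype.card_fin]
    have h1 : (0 : ℝ) ≤ 1 - 1 / n ^ d := by
      rw [sub_nonneg, div_le_one (by positivity)]
      exact one_le_pow₀ (by exact_mod_cast hn)
    refine (pow_le_pow_left₀ h1 (Real.one_sub_le_exp_neg _) M).trans ?_
    rw [← Real.exp_nat_mul]
    refine Real.exp_le_exp.2 ?_
    have hM' : ((d : ℝ) + 4) * n ^ (d + 1) ≤ M := by exact_mod_cast hM
    rw [mul_neg, neg_le_neg_iff, mul_one_div, le_div_iff₀ (by positivity)]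
    calc ((d : ℝ) + 4) * n * n ^ d = (d + 4) * n ^ (d + 1) := by ring
      _ ≤ M := hM'
  have h1 : prob (fun G : Hypergraph n M d => ∃ t ∈ Finset.univ, ∀ i, G i ≠ t) ≤ _ :=
    prob_exists_le_mul Finset.univ (fun t (G : Hypergraph n M d) => ∀ i, G i ≠ t)
      fun t _ => h0 t
  have h2 := (UnifMap.fst (Ω := Hypergraph n M d) (Ω' := Fin (coinCount d q n M) → Bool)).prob
    fun G : Hypergraph n M d => ∃ t, ∀ i, G i ≠ t
  refine h2.le.trans ?_
  refine (prob_mono fun G hG => ?_).trans (h1.trans ?_)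
  · obtain ⟨t, ht⟩ := hG
    exact ⟨t, Finset.mem_univ t, ht⟩
  · have h3 : (n : ℝ) ^ d ≤ Real.exp (d * n) := by
      rw [Real.exp_nat_mul]
      exact pow_le_pow_left₀ hn'.le (by linarith [Real.add_one_le_exp (n : ℝ)]) d
    simp only [Finset.card_univ, Fintype.card_fun, Fintype.card_fin, Nat.cast_pow]
    calc (n : ℝ) ^ d * Real.exp (-((d + 4) * n))
        ≤ Real.exp (d * n) * Real.exp (-((d + 4) * n)) := by gcongr
      _ = Real.exp (-(4 * n)) := by rw [← Real.exp_add]; ring_nf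
      _ ≤ Real.exp (-2) := Real.exp_le_exp.2 (by
          have : (1 : ℝ) ≤ n := by exact_mod_cast hn
          linarith)
      _ ≤ 1 / 4 := by
          rw [Real.exp_neg, show (2 : ℝ) = 1 + 1 by norm_num, Real.exp_add, ← one_div]
          have := Real.exp_one_gt_d9
          exact one_div_le_one_div_of_le (by norm_num) (by nlinarith)

theorem prob_guess (hn : 0 < n) (i : Fin M) (e : Fin d) (E : Fin n → Prop) (f : Fin n → Bool) :
    prob (fun o : Outcome d q n M => E (o.1 i e) ∧ o.lastCoin = f (o.1 i e)) = prob E / 2 := by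
  classical
  rw [(unifMap_guess hn i e).prob fun z => E z.1 ∧ z.2 = f z.1, prob_prod, prob_eq_expect,
    Finset.expect_div]
  refine Finset.expect_congr rfl fun v _ => ?_
  simp only
  by_cases h : E v
  · rw [if_pos h, ← prob_eq_bool (f v)]
    exact prob_congr fun b => by simp [h]
  · rw [if_neg h, zero_div, ← prob_false (Ω := Bool)]
    exact prob_congr fun b => by simp [h]

/-- With so many hyperedges that presumably all tuples occur, the secret is found with constant
probability. -/
theorem le_prob_invert_of_many (hn : 0 < n) (hM : (d + 4) * n ^ (d + 1) ≤ M) {x x' : Fin d → Bool}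
    (hP : P x ≠ P x') :
    1 / 4 ≤ prob fun o : Outcome d q n M => (o.ctx P s).invert d D q = List.ofFn s := by
  classical
  have : Nonempty (Fin n) := ⟨⟨0, hn⟩⟩
  have hM0 : 0 < M := lt_of_lt_of_le (by positivity) hM
  have hd : 0 < d := by
    rcases Nat.eq_zero_or_pos d with rfl | h
    · exact absurd (congrArg P (Subsingleton.elim x x')) hP
    · exact h
  have h1 := prob_guess (q := q) hn (⟨M - 1, by omega⟩ : Fin M) ⟨0, hd⟩ (fun _ => True)
    fun v => if ∃ k, s k ≠ s v then s v else !s v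
  rw [prob_true] at h1
  have h2 := prob_missing_le (d := d) (q := q) hn hM
  have h3 := prob_le_of_imp_or (r := fun o : Outcome d q n M => True ∧ o.lastCoin =
      if ∃ k, s k ≠ s (o.1 ⟨M - 1, by omega⟩ ⟨0, hd⟩) then s (o.1 ⟨M - 1, by omega⟩ ⟨0, hd⟩)
        else !s (o.1 ⟨M - 1, by omega⟩ ⟨0, hd⟩))
    (p := fun o => (o.ctx P s).invert d D q = List.ofFn s)
    (q := fun o : Outcome d q n M => ∃ t, ∀ i, o.1 i ≠ t) fun o ho => by
      by_cases hall : ∃ t, ∀ i, o.1 i ≠ t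
      · exact Or.inr hall
      push Not at hall
      left
      have hv := o.ctx_vtx P s ⟨M - 1, by omega⟩ ⟨0, hd⟩
      simp only at hv
      have hdet : ∀ k j : Fin n, (o.ctx P s).detected d D q k j = (o.ctx P s).conclusive d k j := by
        intro k j
        rw [Ctx.detected, ctx_M]
        exact if_pos (decide_eq_true hM)
      have sound : ∀ k j : Fin n, (o.ctx P s).detected d D q k j = true → s k ≠ s j :=
        fun k j h => o.conclusive_sound (by rw [← hdet, h])
      by_cases hk : ∃ k, s k ≠ s (o.1 ⟨M - 1, by omega⟩ ⟨0, hd⟩)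
      · obtain ⟨k, hk'⟩ := hk
        refine o.invert_eq_of_detected hv sound (k := k) (fun j hj => ?_) hk' ?_
        · rw [hdet]
          exact o.conclusive_complete hall hP hj
        · rw [ho.2, if_pos ⟨k, hk'⟩]
      · refine o.invert_eq_of_const hv sound (fun i => ?_) (by rw [ho.2, if_neg hk])
        push Not at hk
        exact hk i
  linarith

end Outcome

/-! ### Statistical evidence -/

theorem lg_pos {n : ℕ} (hn : 0 < n) : 0 < lg n := by
  by_contra h
  have h1 := lt_two_pow_lg n
  rw [Nat.eq_zero_of_not_pos h] at h1
  omega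

/-- All tests of the algorithm together rarely err. -/
theorem union_bound_le {d n M : ℕ} (hn : 0 < n) (hM : M < (d + 4) * n ^ (d + 1)) :
    ((M : ℝ) + 1) * (M * (M * (n * (n * Real.exp (-threshold d n ^ 2 / 2))))) ≤ 1 / 128 := by
  have hl := lg_pos hn
  have hnat : (M + 1) * (M * (M * (n * (n * 128)))) ≤ 2 ^ (32 * (d + 1) * lg n) := by
    have h1 : M + 1 ≤ 2 ^ ((2 * d + 3) * lg n) := by
      have h2 : d + 4 ≤ 2 ^ (d + 2) := by
        have := Nat.lt_two_pow_self (n := d + 2)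
        rcases d with _ | d
        · norm_num
        · have : d + 1 < 2 ^ (d + 1) := Nat.lt_two_pow_self
          have h3 : 2 ^ (d + 1 + 2) = 4 * 2 ^ (d + 1) := by ring
          omega
      calc M + 1 ≤ (d + 4) * n ^ (d + 1) := hM
        _ ≤ 2 ^ (d + 2) * (2 ^ lg n) ^ (d + 1) := by gcongr; exact (lt_two_pow_lg n).le
        _ = 2 ^ (d + 2 + lg n * (d + 1)) := by rw [← pow_mul, ← pow_add]
        _ ≤ 2 ^ ((2 * d + 3) * lg n) := by
          refine Nat.pow_le_pow_right (by norm_num) ?_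
          nlinarith
    have h2 : M ≤ 2 ^ ((2 * d + 3) * lg n) := by omega
    have h3 : n ≤ 2 ^ lg n := (lt_two_pow_lg n).le
    calc (M + 1) * (M * (M * (n * (n * 128))))
        ≤ 2 ^ ((2 * d + 3) * lg n) * (2 ^ ((2 * d + 3) * lg n) * (2 ^ ((2 * d + 3) * lg n) *
          (2 ^ lg n * (2 ^ lg n * 2 ^ 7)))) := by gcongr; norm_num
      _ = 2 ^ ((2 * d + 3) * lg n + ((2 * d + 3) * lg n + ((2 * d + 3) * lg n +
          (lg n + (lg n + 7))))) := by simp only [← pow_add]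
      _ ≤ 2 ^ (32 * (d + 1) * lg n) := by
          refine Nat.pow_le_pow_right (by norm_num) ?_
          nlinarith
  have hreal : ((M : ℝ) + 1) * (M * (M * (n * (n * 128)))) ≤ 2 ^ (32 * (d + 1) * lg n) := by
    exact_mod_cast hnat
  have hexp : (2 : ℝ) ^ (32 * (d + 1) * lg n) * Real.exp (-threshold d n ^ 2 / 2) ≤ 1 := by
    have h2 : (2 : ℝ) ≤ Real.exp 1 := by linarith [Real.exp_one_gt_d9]
    have h3 : (2 : ℝ) ^ (32 * (d + 1) * lg n) ≤ Real.exp ((32 * (d + 1) * lg n : ℕ) * 1) := by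
      rw [Real.exp_nat_mul]
      exact pow_le_pow_left₀ (by norm_num) h2 _
    refine (mul_le_mul_of_nonneg_right h3 (Real.exp_pos _).le).trans ?_
    rw [← Real.exp_add, Real.exp_le_one_iff, threshold]
    push_cast
    have h4 : (1 : ℝ) ≤ lg n := by exact_mod_cast hl
    have h5 : (1 : ℝ) ≤ (d + 1) * lg n := by nlinarith [(Nat.cast_nonneg d : (0 : ℝ) ≤ d)]
    nlinarith
  have h := mul_le_mul_of_nonneg_right hreal (Real.exp_pos (-threshold d n ^ 2 / 2)).le
  linarith

namespace Outcome
variable {d n M m p : ℕ} {P : (Fin d → Bool) → Bool} {D : Cmd} {q : Polynomial ℕ}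
  {s : Fin n → Bool}

theorem statistical_iff (o : Outcome d q n M) (k j : ℕ) :
    (o.ctx P s).statistical d D q k j = true ↔ ∃ p ∈ Finset.range (M + 1), ∃ m ∈ Finset.range M,
      p * p * (4 * 16 ^ d * (m + 1)) + 1 = M ∧ ∃ r ∈ Finset.range (p * p),
        (o.ctx P s).exceeds d D q p (m + 1) r k j = true := by
  simp only [Ctx.statistical, Ctx.exceedsSome, List.any_eq_true, List.mem_range, ctx_M,
    Bool.and_eq_true, beq_iff_eq, Finset.mem_range]

/-- False statistical evidence is rare. -/
theorem prob_unsound_le (hD : ∀ (n m : ℕ) (G : Hypergraph n m d) (y : Fin m → Bool),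
      HaltsWithin D (encodeInstance G y) (q.eval (n + m))) (hn : 0 < n)
    (hM : M < (d + 4) * n ^ (d + 1)) :
    prob (fun o : Outcome d q n M => ∃ k ∈ Finset.univ, ∃ j ∈ Finset.univ, s k = s j ∧
      (o.ctx P s).statistical d D q k j = true) ≤ 1 / 128 := by
  set E := Real.exp (-threshold d n ^ 2 / 2) with hE
  have hE0 : 0 < E := Real.exp_pos _
  have h : prob (fun o : Outcome d q n M => ∃ k ∈ Finset.univ, ∃ j ∈ Finset.univ, s k = s j ∧
      (o.ctx P s).statistical d D q k j = true) ≤ n * (n * ((M + 1) * (M * (M * E)))) := by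
    have hcard : ((Finset.univ : Finset (Fin n)).card : ℝ) = n := by simp
    rw [← hcard]
    refine prob_exists_le_mul _ _ fun k _ => prob_exists_le_mul _ _ fun j _ =>
      prob_and_le (by positivity) fun hkj => ?_
    rw [prob_congr fun o => o.statistical_iff k j]
    refine (prob_exists_le_mul (c := M * (M * E)) _ _ fun p _ => ?_).trans (by simp)
    refine (prob_exists_le_mul (c := M * E) _ _ fun m _ => ?_).trans (by simp)
    refine prob_and_le (by positivity) fun hpM => ?_
    refine (prob_exists_le_mul (c := E) _ _ fun r hr => ?_).trans ?_
    · exact prob_exceeds_le hD hn (Nat.succ_pos m) hpM (Finset.mem_range.1 hr) hkj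
    · rw [Finset.card_range]
      have : p * p ≤ M := by
        rcases Nat.eq_zero_or_pos p with rfl | hp
        · simp
        · exact (le_of_size (Nat.succ_pos m) hp hpM).1
      have : ((p * p : ℕ) : ℝ) ≤ M := by exact_mod_cast this
      gcongr
  refine h.trans (le_trans (le_of_eq ?_) (union_bound_le hn hM))
  ring

/-- A large balanced set is rarely missing, if there are many random sets. -/
theorem prob_no_set_le (hn : 0 < n) {N : ℕ} (hNM : N ≤ M) {θ : ℝ}
    (hθ : 2 * θ ≤ prob fun T => Balanced s T) (hθn : (9 / 10) ^ n ≤ θ) (hN : 5 ≤ N * θ) :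
    prob (fun o : Outcome d q n M => ∀ r : Fin N, ¬(Balanced s (o.set (r.castLE hNM)) ∧
      n ≤ 4 * card (o.set (r.castLE hNM)))) ≤ 1 / 128 := by
  have h1 := (unifMap_sets (d := d) (q := q) hn hNM).prob
    fun T => ∀ r, ¬(Balanced s (T r) ∧ n ≤ 4 * card (T r))
  refine h1.le.trans ?_
  rw [prob_forall_not fun T => Balanced s T ∧ n ≤ 4 * card T, Fintype.card_fin]
  have h2 : prob (fun T => Balanced s T) ≤ prob (fun T => Balanced s T ∧ n ≤ 4 * card T) +
      prob fun T : Fin n → Bool => 4 * card T < n := by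
    refine prob_le_of_imp_or fun T hT => ?_
    rcases le_or_gt (n : ℝ) (4 * card T) with h | h
    · exact Or.inl ⟨hT, h⟩
    · exact Or.inr h
  have h3 : θ ≤ prob fun T => Balanced s T ∧ n ≤ 4 * card T := by
    linarith [prob_card_lt_le n]
  have h4 : prob (fun T => Balanced s T ∧ n ≤ 4 * card T) ≤ 1 := prob_le_one
  refine (pow_le_pow_left₀ (by linarith) ((by linarith : _ ≤ 1 - θ).trans
    (Real.one_sub_le_exp_neg θ)) N).trans ?_
  rw [← Real.exp_nat_mul]
  refine (Real.exp_le_exp.2 (by linarith : (N : ℝ) * -θ ≤ -5)).trans ?_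
  rw [Real.exp_neg, show (5 : ℝ) = (5 : ℕ) * 1 by norm_num, Real.exp_nat_mul, ← one_div]
  refine one_div_le_one_div_of_le (by norm_num) ?_
  have h5 : (2.7 : ℝ) ≤ Real.exp 1 := by linarith [Real.exp_one_gt_d9]
  exact le_trans (by norm_num) (pow_le_pow_left₀ (by norm_num) h5 5)

/-- If random sets are balanced often enough and some vertex matters, then the secret is found with
constant probability. -/
theorem le_prob_invert_of_few (hD : ∀ (n m : ℕ) (G : Hypergraph n m d) (y : Fin m → Bool),
      HaltsWithin D (encodeInstance G y) (q.eval (n + m))) (hd : 0 < d) (hn : 0 < n) (hm : 0 < m)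
    (hp : 0 < p) (hpM : p * p * (4 * 16 ^ d * m) + 1 = M) (hM : M < (d + 4) * n ^ (d + 1))
    {k : Fin n} {γ θ : ℝ}
    (hγ : γ ≤ hybrid P D m (stepLaw s k) - hybrid P D m (stepLaw s (k + 1)))
    (h1 : threshold d n ≤ p) (h5 : 10 * 16 ^ d * threshold d n ≤ p * γ)
    (hθ : 2 * θ ≤ prob fun T => Balanced s T) (hθn : (9 / 10) ^ n ≤ θ) (hN : 5 ≤ (p * p : ℕ) * θ) :
    1 / 32 ≤ prob fun o : Outcome d q n M => (o.ctx P s).invert d D q = List.ofFn s := by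
  classical
  have : Nonempty (Fin n) := ⟨⟨0, hn⟩⟩
  obtain ⟨hpp, hmM⟩ := le_of_size hm hp hpM
  have hM0 : M - 1 < M := by omega
  have hn' : (0 : ℝ) < n := by exact_mod_cast hn
  -- the guess is right with constant probability
  have hO : (1 : ℝ) / 8 ≤ prob fun v => s k ≠ s v := by
    have hθ0 : 0 < θ := lt_of_lt_of_le (by positivity) hθn
    obtain ⟨T, hT, hTn⟩ : ∃ T : Fin n → Bool, Balanced s T ∧ n ≤ 4 * card T := by
      by_contra! hno
      have h2 : prob (fun T => Balanced s T) ≤ prob fun T : Fin n → Bool => 4 * card T < n :=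
        prob_mono hno
      linarith [prob_card_lt_le n]
    rw [prob_eq_expect, Fintype.expect_eq_sum_div_card, Fintype.card_fin, le_div_iff₀ hn']
    have h2 : ∑ v, (if T v = true then dirac (s v) (!s k) else 0)
        ≤ ∑ v, if s k ≠ s v then (1 : ℝ) else 0 := by
      refine Finset.sum_le_sum fun v _ => ?_
      rcases T v with _ | _ <;> rcases s v with _ | _ <;> rcases s k with _ | _ <;> simp [dirac]
    linarith [hT (!s k)]
  have hguess := prob_guess (q := q) hn (⟨M - 1, hM0⟩ : Fin M) ⟨0, hd⟩ (fun v => s k ≠ s v) s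
  -- what may go wrong
  have hsound := prob_unsound_le (P := P) (s := s) hD hn hM
  have hset := prob_no_set_le (d := d) (q := q) (s := s) hn hpp hθ hθn hN
  have hmiss : prob (fun o : Outcome d q n M => ∃ r ∈ (Finset.univ : Finset (Fin (p * p))),
      ∃ j ∈ Finset.univ, s k ≠ s j ∧ ((Balanced s (o.set (r.castLE hpp)) ∧
        n ≤ 4 * card (o.set (r.castLE hpp))) ∧
        ¬(o.ctx P s).exceeds d D q p m r k j = true)) ≤ 1 / 128 := by
    set E := Real.exp (-threshold d n ^ 2 / 2) with hE
    have hE0 : 0 < E := Real.exp_pos _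
    have h2 : prob (fun o : Outcome d q n M => ∃ r ∈ (Finset.univ : Finset (Fin (p * p))),
      ∃ j ∈ Finset.univ, s k ≠ s j ∧ ((Balanced s (o.set (r.castLE hpp)) ∧
        n ≤ 4 * card (o.set (r.castLE hpp))) ∧
        ¬(o.ctx P s).exceeds d D q p m r k j = true)) ≤
        (Finset.univ : Finset (Fin (p * p))).card * ((Finset.univ : Finset (Fin n)).card * E) :=
      prob_exists_le_mul _ _ fun r _ => prob_exists_le_mul _ _ fun j _ =>
        prob_and_le hE0.le fun hkj =>
          prob_not_exceeds_le hD hn hm hp hpM (r.castLE hpp) hkj hγ h1 h5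
    refine h2.trans (le_trans ?_ (union_bound_le hn hM))
    rw [Finset.card_univ, Finset.card_univ, Fintype.card_fin, Fintype.card_fin]
    have e1 : ((p * p : ℕ) : ℝ) ≤ M := by exact_mod_cast hpp
    have e2 : (1 : ℝ) ≤ M := by exact_mod_cast (show 1 ≤ M by omega)
    have e3 : (1 : ℝ) ≤ n := by exact_mod_cast hn
    have e4 : 0 ≤ (n : ℝ) * E := by positivity
    calc ((p * p : ℕ) : ℝ) * (n * E) ≤ M * (n * E) := by gcongr
      _ ≤ M * (n * (n * E)) := by
        refine mul_le_mul_of_nonneg_left (mul_le_mul_of_nonneg_left ?_ hn'.le) (by positivity)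
        exact le_mul_of_one_le_left hE0.le e3
      _ ≤ M * (M * (n * (n * E))) :=
        mul_le_mul_of_nonneg_left (le_mul_of_one_le_left (by positivity) e2) (by positivity)
      _ ≤ (M + 1) * (M * (M * (n * (n * E)))) :=
        le_mul_of_one_le_left (by positivity) (by linarith)
  have hall := prob_le_of_imp_or (r := fun o : Outcome d q n M =>
      s k ≠ s (o.1 ⟨M - 1, hM0⟩ ⟨0, hd⟩) ∧ o.lastCoin = s (o.1 ⟨M - 1, hM0⟩ ⟨0, hd⟩))
    (p := fun o => (o.ctx P s).invert d D q = List.ofFn s)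
    (q := fun o => (∃ k ∈ Finset.univ, ∃ j ∈ Finset.univ, s k = s j ∧
        (o.ctx P s).statistical d D q k j = true) ∨
      ((∀ r : Fin (p * p), ¬(Balanced s (o.set (r.castLE hpp)) ∧
        n ≤ 4 * card (o.set (r.castLE hpp)))) ∨
      (∃ r ∈ (Finset.univ : Finset (Fin (p * p))),
      ∃ j ∈ Finset.univ, s k ≠ s j ∧ ((Balanced s (o.set (r.castLE hpp)) ∧
        n ≤ 4 * card (o.set (r.castLE hpp))) ∧
        ¬(o.ctx P s).exceeds d D q p m r k j = true)))) fun o ho => by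
      by_contra! hno
      obtain ⟨hinv, hs, ⟨r, hr⟩, hc⟩ := hno
      refine hinv ?_
      have hdet : ∀ k j : Fin n, (o.ctx P s).detected d D q k j
          = (o.ctx P s).statistical d D q k j := by
        intro k j
        rw [Ctx.detected, ctx_M]
        refine if_neg ?_
        rw [decide_eq_true_eq]
        exact not_le.2 hM
      have hv := o.ctx_vtx P s ⟨M - 1, hM0⟩ ⟨0, hd⟩
      simp only at hv
      refine o.invert_eq_of_detected hv (k := k) (fun k j h hkj => ?_) (fun j hj => ?_) ho.1 ho.2
      · exact hs k (Finset.mem_univ k) j (Finset.mem_univ j) hkj (by rw [← hdet, h])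
      · rw [hdet, statistical_iff]
        have hpM' : p ≤ p * p := Nat.le_mul_of_pos_left p hp
        refine ⟨p, Finset.mem_range.2 (by omega), m - 1, Finset.mem_range.2 (by omega), ?_⟩
        rw [show m - 1 + 1 = m by omega]
        exact ⟨hpM, r, Finset.mem_range.2 r.2,
          hc r (Finset.mem_univ r) j (Finset.mem_univ j) hj hr⟩
  have h2 := hall.trans (add_le_add_right (prob_or_le.trans (add_le_add_right prob_or_le _)) _)
  linarith

end Outcome

/-! ### The advantage of a distinguisher -/

section advantage
variable {d n m : ℕ} {P : (Fin d → Bool) → Bool} {D : Cmd}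

theorem acceptProb_nonneg (G : Hypergraph n m d) (y : Fin m → Bool) : 0 ≤ acceptProb D G y :=
  ENNReal.toReal_nonneg

theorem acceptProb_le_one {q : Polynomial ℕ} (hD : ∀ (n m : ℕ) (G : Hypergraph n m d)
      (y : Fin m → Bool), HaltsWithin D (encodeInstance G y) (q.eval (n + m)))
    (G : Hypergraph n m d) (y : Fin m → Bool) : acceptProb D G y ≤ 1 := by
  rw [acceptProb, outputProb_eq_expect (hD _ _ _ _) le_rfl]
  exact expect_le_of_forall_le fun ω => by split_ifs <;> norm_num

theorem bias_nonneg : 0 ≤ bias P := Finset.expect_nonneg fun x _ => by split_ifs <;> norm_num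

theorem bias_le_one : bias P ≤ 1 := expect_le_of_forall_le fun x => by split_ifs <;> norm_num

theorem bernWeight_nonneg (b : Fin m → Bool) : 0 ≤ bernWeight (bias P) b :=
  Finset.prod_nonneg fun i _ => by
    split_ifs
    · exact bias_nonneg
    · exact sub_nonneg.2 bias_le_one

theorem advantage_eq_expect : advantage P D n m = 𝔼 s : Fin n → Bool,
    (hybrid P D m (stepLaw s 0) - hybrid P D m (stepLaw s n)) := by
  simp only [advantage, hybrid_stepLaw_zero, hybrid_stepLaw_last]
  rw [Finset.expect_sub_distrib, expect_comm, Fintype.expect_const]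

theorem hybrid_sub_le_one {q : Polynomial ℕ} (hD : ∀ (n m : ℕ) (G : Hypergraph n m d)
      (y : Fin m → Bool), HaltsWithin D (encodeInstance G y) (q.eval (n + m))) (hn : 0 < n)
    (s : Fin n → Bool) : hybrid P D m (stepLaw s 0) - hybrid P D m (stepLaw s n) ≤ 1 := by
  have : Nonempty (Fin n) := ⟨⟨0, hn⟩⟩
  rw [hybrid_stepLaw_zero, hybrid_stepLaw_last]
  have h1 : 𝔼 G : Hypergraph n m d, acceptProb D G (localFn P G s) ≤ 1 :=
    expect_le_of_forall_le fun G => acceptProb_le_one hD _ _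
  have h2 : 0 ≤ 𝔼 G : Hypergraph n m d, ∑ b, bernWeight (bias P) b * acceptProb D G b :=
    Finset.expect_nonneg fun G _ => Finset.sum_nonneg fun b _ =>
      mul_nonneg (bernWeight_nonneg b) (acceptProb_nonneg G b)
  linarith

/-- If the output bits are constant, nothing can be distinguished. -/
theorem advantage_eq_zero (h : ∀ x x', P x = P x') : advantage P D n m = 0 := by
  classical
  have hbias : bias P = if P (fun _ => false) = true then 1 else 0 := by
    rw [bias, Finset.expect_congr rfl fun x _ => by rw [h x fun _ => false], Fintype.expect_const]
  rw [advantage, sub_eq_zero]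
  refine Finset.expect_congr rfl fun G _ => ?_
  have hw : ∀ b : Fin m → Bool, bernWeight (bias P) b
      = if (fun _ => P fun _ => false) = b then 1 else 0 := by
    intro b
    rw [bernWeight, hbias, ← prod_dirac]
    refine Finset.prod_congr rfl fun i _ => ?_
    rcases b i with _ | _ <;> rcases P fun _ => false with _ | _ <;> simp [dirac]
  have hf : ∀ s : Fin n → Bool, localFn P G s = fun _ => P fun _ => false :=
    fun s => funext fun i => h _ _
  simp only [hw, hf, ite_mul, one_mul, zero_mul, Finset.sum_ite_eq, Finset.mem_univ, if_true]
  exact Fintype.expect_const _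

/-- Without output bits, nothing can be distinguished. -/
theorem advantage_of_isEmpty : advantage P D n 0 = 0 := by
  rw [advantage, sub_eq_zero]
  refine Finset.expect_congr rfl fun G _ => ?_
  rw [Fintype.sum_unique]
  simp only [bernWeight, Finset.univ_eq_empty, Finset.prod_empty, one_mul]
  rw [Finset.expect_congr rfl fun s _ => by rw [Subsingleton.elim (localFn P G s) default]]
  exact Fintype.expect_const _

end advantage

section success
variable {d n M : ℕ} {P : (Fin d → Bool) → Bool} {D : Cmd} {q : Polynomial ℕ}

theorem successProb_eq_expect {A : Cmd} (hA : ∀ (I : Inst d) (s : Fin I.n → Bool),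
      outputProb A (encodeInstance I.G I.y) (Data.ofBits s)
        = 𝔼 ω : Fin (I.numCoins q) → Bool,
          if (I.ctx (List.ofFn ω)).invert d D q = List.ofFn s then (1 : ℝ) else 0) :
    successProb P A n M = 𝔼 s : Fin n → Bool,
      prob fun o : Outcome d q n M => (o.ctx P s).invert d D q = List.ofFn s := by
  classical
  rw [successProb, expect_comm]
  refine Finset.expect_congr rfl fun s _ => ?_
  rw [prob_prod]
  refine Finset.expect_congr rfl fun G _ => ?_
  rw [hA ⟨n, M, G, localFn P G s⟩ s, prob_eq_expect]
  rfl

/-- Without hyperedges, a single bit is guessed. -/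
theorem prob_invert_of_isEmpty (hn : n = 1) (hM : M = 0) (s : Fin n → Bool) :
    prob (fun o : Outcome d q n M => (o.ctx P s).invert d D q = List.ofFn s) = 1 / 2 := by
  subst hn hM
  have hdet : ∀ (o : Outcome d q 1 0) (k j : ℕ), (o.ctx P s).detected d D q k j = false := by
    intro o k j
    have h1 : (o.ctx P s).statistical d D q k j = false := by
      rw [← Bool.not_eq_true, o.statistical_iff]
      simp
    rw [Ctx.detected, o.ctx_M, h1, if_neg]
    rw [decide_eq_true_eq]
    change ¬(d + 4) * 1 ^ (d + 1) ≤ 0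
    simp
  have hiff : ∀ o : Outcome d q 1 0, (o.ctx P s).invert d D q = List.ofFn s ↔
      o.lastCoin = !s 0 := by
    intro o
    rw [o.invert_eq_iff]
    simp only [hdet, Bool.false_eq_true, and_self, exists_false, if_false]
    rw [Fin.forall_fin_one]
    cases o.lastCoin <;> cases s 0 <;> simp
  rw [prob_congr hiff, ← prob_eq_bool (!s 0)]
  have hsnd : UnifMap fun o : Outcome d q 1 0 => o.2 :=
    UnifMap.fst.comp (UnifMap.of_bijective (Equiv.prodComm _ _).bijective)
  have h4 : UnifMap fun w : Fin (coinCount d q 1 0) → Bool => w ⟨_, Nat.lt_succ_self _⟩ :=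
    (UnifMap.of_bijective (Equiv.funUnique Unit Bool).bijective).comp
      (UnifMap.precomp (φ := fun _ : Unit => (⟨_, Nat.lt_succ_self _⟩ : Fin (coinCount d q 1 0)))
        fun _ _ _ => rfl)
  exact (h4.comp hsnd).prob fun b => b = !s 0

end success

/-! ### The number of hyperedges -/

/-- The number of hyperedges on which the algorithm runs: one more than `p ^ 2` batches of
`4 * 16 ^ d * m` hyperedges need, for `p` of the order of `(n / ε) * log n`. As `ε ≤ 1` in the relevant
case, `n / ε < 2` means `n = 1`. None are used then, as `log (n / ε)` and with it the bound that is to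
be met may be arbitrarily small. -/
def sampleSize (d K n m : ℕ) (ε : ℝ) : ℕ :=
  if n / ε < 2 ∨ m = 0 then 0
  else ⌈K * lg n * (n / ε)⌉₊ * ⌈K * lg n * (n / ε)⌉₊ * (4 * 16 ^ d * m) + 1

/-- The number of binary digits is of the order of the logarithm, which is bounded below for `2 ≤ x`. -/
theorem lg_le_log {n : ℕ} (hn : 0 < n) {x : ℝ} (hx : 2 ≤ x) (hnx : n ≤ x) : (lg n : ℝ) ≤ 4 * Real.log x := by
  have h1 : (2 : ℝ) ^ lg n ≤ 2 * n := by exact_mod_cast two_pow_lg_le hn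
  have hn' : (0 : ℝ) < n := by exact_mod_cast hn
  have h2 := Real.log_le_log (by positivity) h1
  rw [Real.log_pow, Real.log_mul (by norm_num) hn'.ne'] at h2
  have h3 := Real.log_le_log hn' hnx
  have h4 := Real.log_le_log (by norm_num) hx
  have h5 := Real.log_two_gt_d9
  have h6 : (0 : ℝ) ≤ lg n := Nat.cast_nonneg _
  nlinarith

theorem sampleSize_le (d : ℕ) {K : ℕ} (hK : 0 < K) (n m : ℕ) (ε : ℝ) (hn : 0 < n) (hε : 0 < ε) (hε1 : ε ≤ 1) :
    (sampleSize d K n m ε : ℝ) ≤ 1000 * K ^ 2 * 16 ^ d * (m * (n / ε) ^ 2 * Real.log (n / ε) ^ 3) := by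
  have hn' : (1 : ℝ) ≤ n := by exact_mod_cast hn
  have hx : (n : ℝ) ≤ n / ε := by
    rw [le_div_iff₀ hε]
    nlinarith
  rw [sampleSize]
  set x := n / ε with hxdef
  split_ifs with h
  · have := Real.log_nonneg (hn'.trans hx)
    rw [Nat.cast_zero]
    positivity
  · push Not at h
    have hl := lg_le_log hn h.1 hx
    have hl1 : (1 : ℝ) ≤ lg n := by exact_mod_cast lg_pos hn
    have hK1 : (1 : ℝ) ≤ K := by exact_mod_cast hK
    have hm1 : (1 : ℝ) ≤ m := by exact_mod_cast Nat.pos_of_ne_zero h.2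
    have hlog : 1 / 2 ≤ Real.log x := by
      have := Real.log_le_log (by norm_num) h.1
      linarith [Real.log_two_gt_d9]
    set p := ⌈K * lg n * x⌉₊ with hp
    have hy : 1 ≤ K * lg n * x := by
      have : 1 ≤ K * (lg n : ℝ) := one_le_mul_of_one_le_of_one_le hK1 hl1
      nlinarith [h.1]
    have hp2 : (p : ℝ) ≤ 2 * (K * lg n * x) := by
      have := (Nat.ceil_lt_add_one (by linarith : 0 ≤ K * lg n * x)).le
      linarith
    have hp1 : (1 : ℝ) ≤ p := hy.trans (Nat.le_ceil _)
    have h16 : (1 : ℝ) ≤ 16 ^ d := one_le_pow₀ (by norm_num)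
    push_cast
    have e1 : (p : ℝ) * p * (4 * 16 ^ d * m) + 1 ≤ 5 * (16 ^ d * m) * (p * p) := by
      have : 1 ≤ (16 : ℝ) ^ d * m * (p * p) := one_le_mul_of_one_le_of_one_le
        (one_le_mul_of_one_le_of_one_le h16 hm1) (one_le_mul_of_one_le_of_one_le hp1 hp1)
      linarith
    have e2 : (p : ℝ) * p ≤ (2 * (K * lg n * x)) * (2 * (K * lg n * x)) :=
      mul_le_mul hp2 hp2 (by positivity) (by linarith)
    have e3 : (lg n : ℝ) ^ 2 ≤ 32 * Real.log x ^ 3 := by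
      have : (lg n : ℝ) ^ 2 ≤ (4 * Real.log x) ^ 2 := pow_le_pow_left₀ (by linarith) hl 2
      nlinarith [sq_nonneg (Real.log x)]
    calc (p : ℝ) * p * (4 * 16 ^ d * m) + 1 ≤ 5 * (16 ^ d * m) * (p * p) := e1
      _ ≤ 5 * (16 ^ d * m) * ((2 * (K * lg n * x)) * (2 * (K * lg n * x))) :=
        mul_le_mul_of_nonneg_left e2 (by positivity)
      _ = 20 * K ^ 2 * 16 ^ d * (m * x ^ 2) * (lg n : ℝ) ^ 2 := by ring
      _ ≤ 20 * K ^ 2 * 16 ^ d * (m * x ^ 2) * (32 * Real.log x ^ 3) :=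
        mul_le_mul_of_nonneg_left e3 (by positivity)
      _ ≤ 1000 * K ^ 2 * 16 ^ d * (m * x ^ 2 * Real.log x ^ 3) := by
        have : 0 ≤ (K : ℝ) ^ 2 * 16 ^ d * (m * x ^ 2 * Real.log x ^ 3) := by positivity
        linarith

/-- Exponential decay beats every power. -/
theorem exists_bound (d : ℕ) : ∃ K : ℕ, 160 * 16 ^ d * (d + 1) ≤ K ∧
    ∀ n : ℕ, 0 < n → (9 / 10 : ℝ) ^ n * (16 * (n + 1) * ((d + 4) * n ^ (d + 1))) ≤ K := by
  obtain ⟨B, hB⟩ := (tendsto_pow_const_mul_const_pow_of_abs_lt_one (d + 2)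
    (show |(9 / 10 : ℝ)| < 1 by norm_num [abs_of_pos])).bddAbove_range
  refine ⟨160 * 16 ^ d * (d + 1) + ⌈32 * (d + 4) * B⌉₊, Nat.le_add_right _ _, fun n hn => ?_⟩
  have h1 : (n : ℝ) ^ (d + 2) * (9 / 10) ^ n ≤ B := hB ⟨n, rfl⟩
  have h2 : 32 * (d + 4) * B ≤ ⌈32 * (d + 4) * B⌉₊ := Nat.le_ceil _
  have hn' : (1 : ℝ) ≤ n := by exact_mod_cast hn
  push_cast
  calc (9 / 10 : ℝ) ^ n * (16 * (n + 1) * ((d + 4) * n ^ (d + 1)))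
      ≤ (9 / 10 : ℝ) ^ n * (16 * (n + n) * ((d + 4) * n ^ (d + 1))) := by gcongr
    _ = 32 * (d + 4) * (n ^ (d + 2) * (9 / 10) ^ n) := by ring
    _ ≤ 32 * (d + 4) * B := by gcongr
    _ ≤ 160 * 16 ^ d * (d + 1) + ⌈32 * (d + 4) * B⌉₊ := by
        have : (0 : ℝ) ≤ 160 * 16 ^ d * (d + 1) := by positivity
        linarith

/-- The algorithm inverts with a probability proportional to the advantage of the distinguisher. -/
theorem le_successProb {d K : ℕ} (hK : 160 * 16 ^ d * (d + 1) ≤ K)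
    (hK' : ∀ n : ℕ, 0 < n → (9 / 10 : ℝ) ^ n * (16 * (n + 1) * ((d + 4) * n ^ (d + 1))) ≤ K)
    {P : (Fin d → Bool) → Bool} {D A : Cmd} {q : Polynomial ℕ}
    (hD : ∀ (n m : ℕ) (G : Hypergraph n m d) (y : Fin m → Bool),
      HaltsWithin D (encodeInstance G y) (q.eval (n + m)))
    (hA : ∀ (I : Inst d) (s : Fin I.n → Bool),
      outputProb A (encodeInstance I.G I.y) (Data.ofBits s)
        = 𝔼 ω : Fin (I.numCoins q) → Bool,
          if (I.ctx (List.ofFn ω)).invert d D q = List.ofFn s then (1 : ℝ) else 0)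
    {n m : ℕ} {ε : ℝ} (hn : 0 < n) (hε : 0 < ε) (h : ε ≤ advantage P D n m) :
    1 / 100 * ε ≤ successProb P A n (sampleSize d K n m ε) := by
  have : Nonempty (Fin n) := ⟨⟨0, hn⟩⟩
  have hn1 : (1 : ℝ) ≤ n := by exact_mod_cast hn
  have hε1 : ε ≤ 1 := by
    rw [advantage_eq_expect] at h
    exact h.trans (expect_le_of_forall_le fun s => hybrid_sub_le_one hD hn s)
  have hm : 0 < m := by
    rcases Nat.eq_zero_or_pos m with rfl | hm
    · rw [advantage_of_isEmpty] at h
      linarith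
    · exact hm
  obtain ⟨x, x', hP⟩ : ∃ x x', P x ≠ P x' := by
    by_contra! hc
    rw [advantage_eq_zero hc] at h
    linarith
  have hd : 0 < d := by
    rcases Nat.eq_zero_or_pos d with rfl | hd
    · exact absurd (congrArg P (Subsingleton.elim x x')) hP
    · exact hd
  rw [successProb_eq_expect hA]
  generalize hM : sampleSize d K n m ε = M
  rw [sampleSize] at hM
  split_ifs at hM with hcase
  · -- a single vertex
    have hx : n / ε < 2 := hcase.resolve_right hm.ne'
    rw [div_lt_iff₀ hε] at hx
    have hn2 : (n : ℝ) < 2 := by linarith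
    have hn2' : n < 2 := by exact_mod_cast hn2
    refine le_trans ?_ (le_expect_of_forall_le (c := 1 / 2) fun s => ?_)
    · linarith
    · exact (prob_invert_of_isEmpty (by omega) hM.symm s).ge
  · push Not at hcase
    set y := n / ε with hy
    have hpy : K * lg n * y ≤ ⌈K * lg n * y⌉₊ := Nat.le_ceil _
    generalize ⌈K * lg n * y⌉₊ = p at hpy hM
    rcases le_or_gt ((d + 4) * n ^ (d + 1)) M with hreg | hreg
    · refine le_trans ?_ (le_expect_of_forall_le (c := 1 / 4) fun s => ?_)
      · linarith
      · exact Outcome.le_prob_invert_of_many hn hreg hP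
    · have hl1 : (1 : ℝ) ≤ lg n := by exact_mod_cast lg_pos hn
      have hKr : 160 * 16 ^ d * ((d : ℝ) + 1) ≤ K := by exact_mod_cast hK
      have h16 : (1 : ℝ) ≤ 16 ^ d := one_le_pow₀ (by norm_num)
      have hd0 : (0 : ℝ) ≤ d := Nat.cast_nonneg d
      have hK1 : (160 : ℝ) ≤ K := by nlinarith
      have hKl : (0 : ℝ) ≤ K * lg n := by positivity
      have hpK : K * lg n ≤ (p : ℝ) := by nlinarith [hcase.1]
      have hp1 : (1 : ℝ) ≤ p := by nlinarith
      have hp : 0 < p := by exact_mod_cast (by linarith : (0 : ℝ) < p)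
      set θ := ε / (16 * (n + 1)) with hθ
      have hθ0 : 0 < θ := by positivity
      have hyε : y * ε = n := div_mul_cancel₀ _ hε.ne'
      have hpε : K * lg n * n ≤ p * ε := by
        rw [← hyε]
        nlinarith
      -- `1 / ε` is polynomially bounded, since there are few hyperedges
      have hθn : (9 / 10 : ℝ) ^ n ≤ θ := by
        rw [hθ, le_div_iff₀ (by positivity)]
        have e1 : (p : ℝ) ≤ (d + 4) * n ^ (d + 1) := by
          have e2 := (Outcome.le_of_size hm hp hM).1
          have e3 : p ≤ p * p := Nat.le_mul_of_pos_left p hp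
          exact_mod_cast (e3.trans e2).trans hreg.le
        have e4 : (K : ℝ) ≤ (d + 4) * n ^ (d + 1) * ε := by
          have : (K : ℝ) * 1 ≤ K * lg n * n := by
            rw [mul_assoc]
            gcongr
            nlinarith
          nlinarith
        have e5 := (hK' n hn).trans e4
        have e6 : (0 : ℝ) < (d + 4) * n ^ (d + 1) := by positivity
        refine le_of_mul_le_mul_left ?_ e6
        linarith
      have hgood : 3 / 8 * ε ≤ prob fun s : Fin n → Bool =>
          ε / 2 ≤ hybrid P D m (stepLaw s 0) - hybrid P D m (stepLaw s n) ∧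
          2 * θ ≤ prob fun T => Balanced s T := by
        rw [advantage_eq_expect] at h
        have e1 := le_prob_of_le_expect (a := ε / 2) (fun s => hybrid_sub_le_one (P := P) (m := m) hD hn s)
          (by positivity) (by linarith)
        have e2 := prob_prob_balanced_lt n (θ := 2 * θ) (by positivity)
        have e3 : ((n : ℝ) + 1) * (2 * θ) = ε / 8 := by
          rw [hθ]
          field_simp
          norm_num
        have e4 := prob_le_of_imp_or (r := fun s : Fin n → Bool =>
            ε / 2 ≤ hybrid P D m (stepLaw s 0) - hybrid P D m (stepLaw s n))
          (p := fun s => ε / 2 ≤ hybrid P D m (stepLaw s 0) - hybrid P D m (stepLaw s n) ∧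
            2 * θ ≤ prob fun T => Balanced s T)
          (q := fun s => prob (fun T => Balanced s T) < 2 * θ) fun s hs => by
            rcases le_or_gt (2 * θ) (prob fun T => Balanced s T) with h | h
            · exact Or.inl ⟨hs, h⟩
            · exact Or.inr h
        linarith
      refine le_trans ?_ (mul_prob_le_expect (c := 1 / 32) (e := fun s : Fin n → Bool =>
        ε / 2 ≤ hybrid P D m (stepLaw s 0) - hybrid P D m (stepLaw s n) ∧
          2 * θ ≤ prob fun T => Balanced s T) (fun s => prob_nonneg) fun s hs => ?_)
      · linarith
      · obtain ⟨k, hk⟩ := exists_step P D s hn hs.1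
        refine Outcome.le_prob_invert_of_few hD hd hn hm hp hM hreg hk ?_ ?_ hs.2 hθn ?_
        · have : threshold d n = 8 * (d + 1) * lg n := by
            rw [threshold]; push_cast; ring
          rw [this]
          refine le_trans ?_ hpK
          gcongr
          nlinarith
        · have : threshold d n = 8 * (d + 1) * lg n := by
            rw [threshold]; push_cast; ring
          rw [this, div_div, mul_div_assoc', le_div_iff₀ (by positivity)]
          have e1 := mul_le_mul_of_nonneg_right hKr (by positivity : (0 : ℝ) ≤ lg n * n)
          linarith
        · have e1 : 5 ≤ (p : ℝ) * θ := by
            rw [hθ, mul_div_assoc', le_div_iff₀ (by positivity)]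
            have : (160 : ℝ) * 1 * n ≤ K * lg n * n := by gcongr
            linarith
          push_cast
          nlinarith

end RandomLocal

end

theorem theorem1p2 (d : ℕ) (P : (Fin d → Bool) → Bool) :
    ∃ c C : ℝ, ∃ M : ℕ → ℕ → ℝ → ℕ, 0 < c ∧ 0 < C ∧
      (∀ (n m : ℕ) (ε : ℝ), 0 < n → 0 < ε → ε ≤ 1 →
        (M n m ε : ℝ) ≤ C * (m * (n / ε) ^ 2 * Real.log (n / ε) ^ 3)) ∧
      ∀ D : RandomLocal.Cmd, RandomLocal.Efficient d D →
        ∃ A : RandomLocal.Cmd, RandomLocal.Efficient d A ∧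
          ∀ (n m : ℕ) (ε : ℝ), 0 < n → 0 < ε →
            ε ≤ RandomLocal.advantage P D n m →
            c * ε ≤ RandomLocal.successProb P A n (M n m ε) := by
  obtain ⟨K, hK, hK'⟩ := RandomLocal.exists_bound d
  have hK0 : 0 < K := lt_of_lt_of_le (by positivity) hK
  refine ⟨1 / 100, 1000 * K ^ 2 * 16 ^ d, RandomLocal.sampleSize d K, by norm_num, by positivity,
    RandomLocal.sampleSize_le d hK0, fun D hD => ?_⟩
  obtain ⟨q, hq⟩ := hD
  obtain ⟨A, hA, h⟩ := RandomLocal.exists_inverter hq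
  exact ⟨A, hA, fun n m ε hn hε hadv => RandomLocal.le_successProb hK hK' hq h hn hε hadv⟩
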